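/- Let $\Lambda>0$ and let $(M,g,\Omega)$ be a conformal completion à la Penrose of a physical space-time $(\hat M,\hat g)$ satisfying the Einstein equations $\hat R_{\mu\nu}-\tfrac12\hat R\,\hat g_{\mu\nu}+\Lambda\hat g_{\mu\nu}=\tfrac{8\pi G}{c^4}\hat T_{\mu\nu}$. That is: $M$ is a smooth time-oriented $4$-manifold with boundary $\mathscr J=\partial M$ and smooth Lorentzian metric $g$ of signature $(-,+,+,+)$, $\hat M=M\setminus\mathscr J$, $\Omega$ is smooth, positive on $\hat M$ and zero on $\mathscr J$, and $g=\Omega^2\hat g$ on $\hat M$; with $N_\alpha=\nabla_\alpha\Omega$ one has $N_\alpha N^\alpha=-\Lambda/3$ and (partial gauge fixing) $\nabla_\alpha N_\beta=0$ on $\mathscr J$; and the rescaled Weyl tensor $d_{\alpha\beta\gamma}{}^{\delta}$, determined by $\Omega\, d_{\alpha\beta\gamma}{}^{\delta}=\hat C_{\alpha\beta\gamma}{}^{\delta}$ on $\hat M$, extends smoothly to $\mathscr J$. Here $\hat C_{\alpha\beta\gamma}{}^{\delta}$ is the Weyl tensor of $\hat g$ (equal to that of $g$). Let $\mathscr J^+$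 be the set of points of $\mathscr J$ at which the outward normal $N^\alpha$ is future-directed. Let $p_0\in\mathscr J^+$, let $\ell^\alpha$ be a future null vector at $p_0$ with $\ell^\mu N_\mu=-1$, and let $k^\alpha=N^\alpha-\tfrac{\Lambda}{6}\ell^\alpha$, which is the second null direction of the plane spanned by $\ell^\alpha$ and $N^\alpha$ at $p_0$. For a future null vector $v$ at $p_0$ with $v^\mu N_\mu=-1$, let $\gamma:[\lambda_1,0]\to M$ ($\lambda_1<0$) be a geodesic of $g$, affinely parametrized by $\lambda$, with $\gamma(0)=p_0$, $\dot\gamma(0)=v$ and $\gamma([\lambda_1,0))\subset\hat M$. Let $t(\lambda_i,\lambda_j)$ and $\hat t(\lambda_i,\lambda_j)$ be the parallel propagators along $\gamma$, from parameter $\lambda_j$ to $\lambda_i$, of the Levi-Civita connections of $g$ and $\hat g$. On covariant tensors at $p_0$ put $L(\lambda)=t(0,\lambda_1)\,\hat t(\lambda_1,\lambda)\,t(\lambda,0)$. Take the physical Weyl tensor $\hat C_{\alpha\beta\gamma\delta}$ (indices lowered with $\hat g$) at $\gamma(\lambda)$, transport it to $p_0$ with $t(0,\lambda)$, and apply $L(\lambda)$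 to all its indices. The result is a tensor at $p_0$ that, as $\lambda\to0^-$, has an expansion $$\lambda\, d^{(N)}_{\alpha\beta\gamma\delta}+\lambda^2 e^{(III)}_{\alpha\beta\gamma\delta}+o(\lambda^2).$$ Let $d^{(N)},e^{(III)}$ be the coefficients so obtained from such a geodesic with $v=\ell$, and let $d'^{(N)},e'^{(III)}$ be those from such a geodesic arriving along $k$, i.e. with the normalized tangent vector $v=\tfrac{6}{\Lambda}k$ (each geodesic having its own $\lambda_1<0$). These coefficients exist, and if $d^{(N)}=d'^{(N)}=0$ and each of $e^{(III)}$ and $e'^{(III)}$ is zero or of Petrov type N, then the asymptotic super-Poynting vector vanishes at $p_0$: $$P^\alpha|_{p_0}=-(\delta^\alpha_\mu+n^\alpha n_\mu)\,D^{\mu}{}_{\beta\gamma\delta}\,n^\beta n^\gamma n^\delta\big|_{p_0}=0 ,$$ where $n^\alpha=N^\alpha/\sqrt{\Lambda/3}$ is the unit normal to $\mathscr J$ and $D_{\alpha\beta\gamma\delta}=d_{\alpha\mu\gamma\nu}d_\beta{}^\mu{}_\delta{}^\nu+d_{\alpha\mu\delta\nu}d_\beta{}^\mu{}_\gamma{}^\nu-\tfrac18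 g_{\alpha\beta}g_{\gamma\delta}d_{\mu\nu\rho\sigma}d^{\mu\nu\rho\sigma}$ is the Bel–Robinson tensor of the rescaled Weyl tensor. By definition of the super-Poynting criterion, this means that no gravitational radiation arrives at $\mathscr J^+$ at $p_0$. -/

import Mathlib

open Set Filter Topology Asymptotics
open scoped Manifold ContDiff

namespace Peeling

noncomputable section

/-- The model vector space of a four-dimensional manifold. -/
abbrev E4 : Type := EuclideanSpace ℝ (Fin 4)

/-- The model with corners of a four-dimensional manifold with boundary. -/
abbrev I4 : ModelWithCorners ℝ E4 (EuclideanHalfSpace 4) := 𝓡∂ 4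

/-- The standard basis vectors of the model space. -/
def stdVec (i : Fin 4) : E4 := EuclideanSpace.single i 1

section Tensors

variable {M : Type*} [TopologicalSpace M] [ChartedSpace (EuclideanHalfSpace 4) M]
  [IsManifold I4 ∞ M]

/-- Components of a tangent vector at `x` in the coordinate basis of the preferred chart at `x`
(in Mathlib `TangentSpace I4 x` is the model space, identified through that chart). -/
def comps {x : M} (v : TangentSpace I4 x) : E4 := v

/-- The tangent vector at `x` with given components in the preferred chart at `x`. -/
def ofComps (x : M) (c : Fin 4 → ℝ) : TangentSpace I4 x := (WithLp.toLp 2 c : E4)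

/-- The coordinate vector `∂ᵢ` at `p` of the preferred chart around `x₀`. -/
def coordVec (x₀ : M) (i : Fin 4) (p : M) : TangentSpace I4 p :=
  (tangentCoordChange I4 x₀ p p (stdVec i) : E4)

/-- A field of bilinear forms on the tangent spaces. -/
abbrev BilinField (M : Type*) [TopologicalSpace M] [ChartedSpace (EuclideanHalfSpace 4) M]
    [IsManifold I4 ∞ M] : Type _ :=
  (x : M) → LinearMap.BilinForm ℝ (TangentSpace I4 x)

/-- Covariant tensors of rank four at `x`. -/
abbrev Tensor4 {M : Type*} [TopologicalSpace M] [ChartedSpace (EuclideanHalfSpace 4) M]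
    [IsManifold I4 ∞ M] (x : M) : Type :=
  MultilinearMap ℝ (fun _ : Fin 4 => TangentSpace I4 x) ℝ

/-- The `i`-th coordinate one-form at `x` of the preferred chart at `x`. -/
def coordForm (x : M) (i : Fin 4) : TangentSpace I4 x →ₗ[ℝ] ℝ where
  toFun v := comps v i
  map_add' _ _ := rfl
  map_smul' _ _ := rfl

/-- The tensor at `x` with components `C i j k l` in the preferred chart at `x`, that is
`(v₀, v₁, v₂, v₃) ↦ ∑ C i j k l * v₀ⁱ * v₁ʲ * v₂ᵏ * v₃ˡ`. -/
def tensorOfComps (x : M) (C : Fin 4 → Fin 4 → Fin 4 → Fin 4 → ℝ) : Tensor4 x :=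
  ∑ i, ∑ j, ∑ k, ∑ l, C i j k l •
    (MultilinearMap.mkPiAlgebra ℝ (Fin 4) ℝ).compLinearMap
      (fun m : Fin 4 => coordForm x (![i, j, k, l] m))

theorem tensorOfComps_apply (x : M) (C : Fin 4 → Fin 4 → Fin 4 → Fin 4 → ℝ)
    (v : Fin 4 → TangentSpace I4 x) :
    tensorOfComps x C v = ∑ i, ∑ j, ∑ k, ∑ l, C i j k l *
      (comps (v 0) i * comps (v 1) j * comps (v 2) k * comps (v 3) l) := by
  simp only [tensorOfComps, MultilinearMap.sum_apply, MultilinearMap.smul_apply, smul_eq_mul]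
  refine Finset.sum_congr rfl fun i _ => Finset.sum_congr rfl fun j _ =>
    Finset.sum_congr rfl fun k _ => Finset.sum_congr rfl fun l _ => ?_
  congr 1
  simp [Fin.prod_univ_four, coordForm]

/-- Components of a field of bilinear forms in the preferred chart around `x₀`, as functions of the
coordinates `y`. -/
def compMatrix (h : BilinField M) (x₀ : M) (y : E4) : Matrix (Fin 4) (Fin 4) ℝ :=
  Matrix.of fun i j =>
    h ((extChartAt I4 x₀).symm y) (coordVec x₀ i _) (coordVec x₀ j _)

/-- Components of a field of rank-four tensors in the preferred chart around `x₀`. -/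
def compTensor (T : (x : M) → Tensor4 x) (x₀ : M) (y : E4) (i j k l : Fin 4) : ℝ :=
  T ((extChartAt I4 x₀).symm y)
    ![coordVec x₀ i _, coordVec x₀ j _, coordVec x₀ k _, coordVec x₀ l _]

/-- Partial derivative `∂ₖ f` at `y` (one-sided at the boundary of the half-space). -/
def pd (k : Fin 4) (f : E4 → ℝ) (y : E4) : ℝ := fderivWithin ℝ f (range I4) y (stdVec k)

/-- Christoffel symbols `Γⁱⱼₖ` of the Levi-Civita connection of `h` in the chart around `x₀`. -/
def christoffel (h : BilinField M) (x₀ : M) (i j k : Fin 4) (y : E4) : ℝ :=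
  (1 / 2) * ∑ l, (compMatrix h x₀ y)⁻¹ i l *
    (pd j (fun z => compMatrix h x₀ z l k) y + pd k (fun z => compMatrix h x₀ z l j) y
      - pd l (fun z => compMatrix h x₀ z j k) y)

/-- Riemann tensor `R_{ijk}{}^l`, with `(∇ᵢ∇ⱼ - ∇ⱼ∇ᵢ) v_k = R_{ijk}{}^l v_l`. -/
def riemann (h : BilinField M) (x₀ : M) (i j k l : Fin 4) (y : E4) : ℝ :=
  pd j (christoffel h x₀ l i k) y - pd i (christoffel h x₀ l j k) y
    + ∑ m, (christoffel h x₀ m i k y * christoffel h x₀ l j m y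
      - christoffel h x₀ m j k y * christoffel h x₀ l i m y)

/-- Ricci tensor `R_{ik} = R_{ijk}{}^j`. -/
def ricci (h : BilinField M) (x₀ : M) (i k : Fin 4) (y : E4) : ℝ :=
  ∑ j, riemann h x₀ i j k j y

/-- Scalar curvature. -/
def scalarCurv (h : BilinField M) (x₀ : M) (y : E4) : ℝ :=
  ∑ i, ∑ k, (compMatrix h x₀ y)⁻¹ i k * ricci h x₀ i k y

/-- Components `C_{ijkl}` of the (four-dimensional, fully covariant) Weyl tensor of `h`. -/
def weylComps (h : BilinField M) (x₀ : M) (y : E4) (i j k l : Fin 4) : ℝ :=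
  (∑ m, riemann h x₀ i j k m y * compMatrix h x₀ y m l)
    - (1 / 2) * (compMatrix h x₀ y i k * ricci h x₀ l j y
        - compMatrix h x₀ y i l * ricci h x₀ k j y
        - compMatrix h x₀ y j k * ricci h x₀ l i y
        + compMatrix h x₀ y j l * ricci h x₀ k i y)
    + (1 / 6) * scalarCurv h x₀ y * (compMatrix h x₀ y i k * compMatrix h x₀ y l j
        - compMatrix h x₀ y i l * compMatrix h x₀ y k j)

/-- The Weyl tensor of `h` at `x`, all indices down. -/
def weyl (h : BilinField M) (x : M) : Tensor4 x :=
  tensorOfComps x (weylComps h x (extChartAt I4 x x))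

/-- `V` is parallel along the curve `c` with velocity `u`, on the parameter set `S`, for the
Levi-Civita connection of `h`: in the chart around `c t`, `dVⁱ/dt = - Γⁱⱼₖ uʲ Vᵏ` at `t`. -/
def IsParallelAlong (h : BilinField M) (c : ℝ → M) (u : (t : ℝ) → TangentSpace I4 (c t))
    (S : Set ℝ) (V : (t : ℝ) → TangentSpace I4 (c t)) : Prop :=
  ∀ t ∈ S, HasDerivWithinAt
    (fun s => (tangentCoordChange I4 (c s) (c t) (c s) (comps (V s)) : E4))
    (WithLp.toLp 2 fun i => - ∑ j, ∑ k,
      christoffel h (c t) i j k (extChartAt I4 (c t) (c t)) *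
        comps (u t) j * comps (V t) k)
    S t

/-- `τ s t : T_{c s}M → T_{c t}M`, for `s, t ∈ S`, is the parallel propagator along `c` for the
Levi-Civita connection of `h`. -/
def IsParallelPropagator (h : BilinField M) (c : ℝ → M)
    (u : (t : ℝ) → TangentSpace I4 (c t)) (S : Set ℝ)
    (τ : (s t : ℝ) → TangentSpace I4 (c s) →ₗ[ℝ] TangentSpace I4 (c t)) : Prop :=
  ∀ s ∈ S, τ s s = LinearMap.id ∧ ∀ v, IsParallelAlong h c u S (fun t => τ s t v)

/-- A bilinear form of signature `(-,+,+,+)`. -/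
def IsLorentzian {x : M} (b : LinearMap.BilinForm ℝ (TangentSpace I4 x)) : Prop :=
  ∃ f : Module.Basis (Fin 4) ℝ (TangentSpace I4 x), ∀ i j,
    b (f i) (f j) = if i = j then (if i = 0 then -1 else 1) else 0

/-- Petrov type N, for a tensor `W` with the algebraic properties of a Weyl tensor: `W ≠ 0` and
there is a quadruple principal null direction `ξ`, i.e. `W_{αβγδ} ξ^δ = 0`. -/
def IsPetrovTypeN {x : M} (b : LinearMap.BilinForm ℝ (TangentSpace I4 x)) (W : Tensor4 x) : Prop :=
  W ≠ 0 ∧ ∃ ξ : TangentSpace I4 x, ξ ≠ 0 ∧ b ξ ξ = 0 ∧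
    ∀ v₀ v₁ v₂ : TangentSpace I4 x, W ![v₀, v₁, v₂, ξ] = 0

/-- `d` and `e` are the coefficients of `s` and `s ^ 2` in the expansion of the tensor-valued
function `F` as `s → 0⁻`, which has no term of order zero. -/
def HasPeelingCoeffs {x : M} (F : ℝ → Tensor4 x) (d e : Tensor4 x) : Prop :=
  ∀ v : Fin 4 → TangentSpace I4 x,
    (fun s : ℝ => F s v - s * d v - s ^ 2 * e v) =o[𝓝[<] 0] (fun s : ℝ => s ^ 2)

end Tensors

/-- The metric `Ω⁻² g` on `{Ω ≠ 0}`. -/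
def rescale {M : Type*} [TopologicalSpace M] [ChartedSpace (EuclideanHalfSpace 4) M]
    [IsManifold I4 ∞ M] (g : BilinField M) (Ω : M → ℝ) : BilinField M :=
  fun x => ((Ω x ^ 2)⁻¹ : ℝ) • g x

/-- A conformal completion à la Penrose `(M, g, Ω)` of the physical space-time `(M̂, ĝ)`,
`M̂ = M \ ∂M`, `ĝ = Ω⁻² g`, which satisfies the Einstein equations with cosmological constant `Λ`;
`𝒥 = ∂M`. -/
structure ConformalCompletion (M : Type*) [TopologicalSpace M]
    [ChartedSpace (EuclideanHalfSpace 4) M] [IsManifold I4 ∞ M] (Λ : ℝ) where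
  /-- the conformal metric, regular up to the boundary -/
  g : BilinField M
  g_symm : ∀ x v w, g x v w = g x w v
  g_lorentzian : ∀ x, IsLorentzian (g x)
  g_smooth : ∀ x₀ i j,
    ContDiffOn ℝ ∞ (fun y => compMatrix g x₀ y i j) (extChartAt I4 x₀).target
  /-- the conformal factor -/
  Ω : M → ℝ
  Ω_smooth : ContMDiff I4 𝓘(ℝ, ℝ) ∞ Ω
  Ω_pos : ∀ x, x ∉ I4.boundary M → 0 < Ω x
  Ω_zero : ∀ x ∈ I4.boundary M, Ω x = 0
  /-- a timelike vector field giving the time orientation -/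
  time : (x : M) → TangentSpace I4 x
  time_continuous : Continuous (fun x => (⟨x, time x⟩ : TangentBundle I4 M))
  time_timelike : ∀ x, g x (time x) (time x) < 0
  /-- the coupling constant `8πG/c⁴` -/
  κ : ℝ
  κ_pos : 0 < κ
  /-- the physical energy-momentum tensor -/
  T : BilinField M
  einstein : ∀ x, x ∉ I4.boundary M → ∀ i j,
    ricci (rescale g Ω) x i j (extChartAt I4 x x)
      - (1 / 2) * compMatrix (rescale g Ω) x (extChartAt I4 x x) i j
          * scalarCurv (rescale g Ω) x (extChartAt I4 x x)
      + Λ * compMatrix (rescale g Ω) x (extChartAt I4 x x) i j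
      = κ * compMatrix T x (extChartAt I4 x x) i j
  /-- on `𝒥`, `N_α N^α = -Λ/3` for `N = dΩ` -/
  norm_grad : ∀ x ∈ I4.boundary M,
    ∑ i, ∑ j, (compMatrix g x (extChartAt I4 x x))⁻¹ i j
      * pd i (fun z => Ω ((extChartAt I4 x).symm z)) (extChartAt I4 x x)
      * pd j (fun z => Ω ((extChartAt I4 x).symm z)) (extChartAt I4 x x) = -Λ / 3
  /-- the partial gauge fixing: on `𝒥`, `∇_α N_β = 0` -/
  gauge : ∀ x ∈ I4.boundary M, ∀ i j,
    pd i (pd j (fun z => Ω ((extChartAt I4 x).symm z))) (extChartAt I4 x x)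
      - ∑ k, christoffel g x k i j (extChartAt I4 x x)
          * pd k (fun z => Ω ((extChartAt I4 x).symm z)) (extChartAt I4 x x) = 0
  /-- the rescaled Weyl tensor, index lowered with `g`, regular up to the boundary -/
  d : (x : M) → Tensor4 x
  d_smooth : ∀ x₀ i j k l,
    ContDiffOn ℝ ∞ (fun y => compTensor d x₀ y i j k l) (extChartAt I4 x₀).target
  /-- `Ω d_{αβγ}{}^δ = Ĉ_{αβγ}{}^δ` on `M̂`; with `δ` lowered by `g = Ω² ĝ` on the left and by `ĝ`
  on the right this is `d_{αβγδ} = Ω Ĉ_{αβγδ}` -/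
  d_eq : ∀ x, x ∉ I4.boundary M → d x = Ω x • weyl (rescale g Ω) x

namespace ConformalCompletion

variable {M : Type*} [TopologicalSpace M] [ChartedSpace (EuclideanHalfSpace 4) M]
  [IsManifold I4 ∞ M] {Λ : ℝ} (X : ConformalCompletion M Λ)

/-- The physical metric `ĝ = Ω⁻² g` (meaningful on `M̂ = M \ 𝒥`). -/
def ghat : BilinField M := rescale X.g X.Ω

/-- The inverse metric `g^{ij}` at `x`. -/
def gInv (x : M) : Matrix (Fin 4) (Fin 4) ℝ := (compMatrix X.g x (extChartAt I4 x x))⁻¹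

/-- The vector `N^α = g^{αβ} ∂_β Ω`. -/
def N (x : M) : TangentSpace I4 x :=
  ofComps x fun i => ∑ j, X.gInv x i j
    * pd j (fun z => X.Ω ((extChartAt I4 x).symm z)) (extChartAt I4 x x)

/-- A causal vector is future-directed when its product with the time orientation is negative. -/
def IsFuture {x : M} (v : TangentSpace I4 x) : Prop := X.g x v (X.time x) < 0

/-- `𝒥⁺` for `Λ > 0`: the points of `𝒥` where the outward timelike normal `N^α` is
future-directed. -/
def scriPlus : Set M := {x | x ∈ I4.boundary M ∧ X.IsFuture (X.N x)}

/-- The second null vector `k^α = N^α - (Λ/6) ℓ^α` of the fundamental plane. -/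
def k {p : M} (ℓ : TangentSpace I4 p) : TangentSpace I4 p := X.N p - (Λ / 6) • ℓ

/-- An affinely parametrized geodesic of `g` on `[s₁, 0]`, contained in `M̂` except for its endpoint
`p₀` at parameter `0`, where its tangent vector is `ℓ`. -/
structure ArrivingGeodesic (p₀ : M) (ℓ : TangentSpace I4 p₀) where
  s₁ : ℝ
  s₁_neg : s₁ < 0
  c : ℝ → M
  /-- the tangent vector field -/
  u : (t : ℝ) → TangentSpace I4 (c t)
  hasDeriv : ∀ t ∈ Icc s₁ 0,
    HasMFDerivWithinAt 𝓘(ℝ, ℝ) I4 c (Icc s₁ 0) t ((1 : ℝ →L[ℝ] ℝ).smulRight (u t))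
  geodesic : IsParallelAlong X.g c u (Icc s₁ 0) u
  endpoint : c 0 = p₀
  tangent : comps (u 0) = comps ℓ
  physical : ∀ t ∈ Ico s₁ 0, c t ∉ I4.boundary M

variable {X}

/-- The automorphism `L` at parameter `s`: from `p₀` to `p₁ = c s₁` with the propagator `τ` of `g`,
from `p₁` to `c s` with the propagator `τ'` of `ĝ`, and from `c s` back to `p₀` with `τ`. Written
here on vectors; on a covariant tensor `T` at `p₀` it acts by `T ↦ T(L ·, …, L ·)`, which is
`L_α{}^μ ⋯ T_{μ⋯}` with
`L_α{}^β = t_α{}^μ(s₀, s₁) t̂_μ{}^ρ(s₁, s) t_ρ{}^β(s, s₀)`. -/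
def ArrivingGeodesic.L {p₀ : M} {ℓ : TangentSpace I4 p₀} (σ : X.ArrivingGeodesic p₀ ℓ)
    (τ τ' : (s t : ℝ) → TangentSpace I4 (σ.c s) →ₗ[ℝ] TangentSpace I4 (σ.c t)) (s : ℝ) :
    TangentSpace I4 (σ.c 0) →ₗ[ℝ] TangentSpace I4 (σ.c 0) :=
  (τ s 0).comp ((τ' σ.s₁ s).comp (τ 0 σ.s₁))

/-- The physical Weyl tensor `Ĉ_{αβγδ}` at `c s`, parallelly transported to `p₀` for `g` and then
acted upon by `L`. -/
def ArrivingGeodesic.transportedWeyl {p₀ : M} {ℓ : TangentSpace I4 p₀}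
    (σ : X.ArrivingGeodesic p₀ ℓ)
    (τ τ' : (s t : ℝ) → TangentSpace I4 (σ.c s) →ₗ[ℝ] TangentSpace I4 (σ.c t)) (s : ℝ) :
    Tensor4 (σ.c 0) :=
  ((weyl X.ghat (σ.c s)).compLinearMap (fun _ => τ 0 s)).compLinearMap
    (fun _ => σ.L τ τ' s)

variable (X)

/-- Components of the rescaled Bel-Robinson tensor of `d` at `x`:
`D_{abcf} = d_{a m c n} d_b{}^m{}_f{}^n + d_{a m f n} d_b{}^m{}_c{}^n
  - (1/8) g_{ab} g_{cf} d_{mnpq} d^{mnpq}`. -/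
def belRobinson (x : M) (a b c f : Fin 4) : ℝ :=
  let D := fun i j k l => X.d x ![ofComps x (Pi.single i 1), ofComps x (Pi.single j 1),
    ofComps x (Pi.single k 1), ofComps x (Pi.single l 1)]
  let G := compMatrix X.g x (extChartAt I4 x x)
  let H := X.gInv x
  (∑ m, ∑ n, ∑ m', ∑ n', H m m' * H n n' *
      (D a m c n * D b m' f n' + D a m f n * D b m' c n'))
    - (1 / 8) * G a b * G c f *
      ∑ m, ∑ n, ∑ p, ∑ q, ∑ m', ∑ n', ∑ p', ∑ q',
        H m m' * H n n' * H p p' * H q q' * D m n p q * D m' n' p' q'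

/-- The unit normal `n^α` of `𝒥` (for `Λ > 0`), parallel to `N^α`. -/
def unitNormal (x : M) : TangentSpace I4 x := (Real.sqrt (Λ / 3))⁻¹ • X.N x

/-- The asymptotic supermomentum `p^α = - D^α{}_{βγδ} n^β n^γ n^δ`. -/
def supermomentum (x : M) : TangentSpace I4 x :=
  ofComps x fun i => - ∑ a, X.gInv x i a * ∑ b, ∑ c, ∑ f, X.belRobinson x a b c f
    * comps (X.unitNormal x) b * comps (X.unitNormal x) c * comps (X.unitNormal x) f

/-- The asymptotic super-Poynting vector: the part of the asymptotic supermomentum tangent to `𝒥`,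
`P^α = (δ^α_β + n^α n_β) p^β`. -/
def superPoynting (x : M) : TangentSpace I4 x :=
  X.supermomentum x + X.g x (X.unitNormal x) (X.supermomentum x) • X.unitNormal x

end ConformalCompletion

end

end Peeling

namespace Peeling

noncomputable section

set_option linter.unusedSectionVars false
set_option maxSynthPendingDepth 3

/-! Along an arriving null geodesic take a `g`-parallel null frame `e 0, …, e 3` with `e 0` the
tangent and with `N` in the span of `e 3` and `e 0` at the endpoint. Because the Hessian of `Ω`
vanishes on the boundary, each `dΩ(e a)` differs from its endpoint value by `O(s²)`. Hence `Ω = -s +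
O(s³)`, and `dΩ(e 1)`, `dΩ(e 2)` are themselves `O(s²)` (`frameDeriv_isBigO`, `omega_isBigO`).

Physical parallel transport can then be integrated exactly. By the conformal change of connection
(`gamma_rescale`), the frame components of a `ĝ`-parallel field satisfy a triangular linear system,
whose constants of motion (`coeff_conserved`) involve only `Ω` and the primitives of `Ω⁻² dΩ(e 1)`
and `Ω⁻² dΩ(e 2)`. These integrands are bounded. Consequently a `ĝ`-parallel field has constant
coefficients with respect to `Ω² ψ₀, Ω ψ₁, Ω ψ₂, ψ₃`, where the frame `ψ` is differentiable at the
endpoint and agrees with `e` there (`eq_sum_scaledFrame`).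

Since `Ĉ = Ω⁻¹ d`, the transported Weyl tensor has components `Ω^(w-1) d(ψ, ψ, ψ, ψ)`, with `w` the
total weight of the four indices. Antisymmetry in each pair forces `w ≥ 2`, so the expansion starts
at order one (`component_expansion`). The first coefficient consists of the components `d(3,i,3,j)`,
`i, j ∈ {1, 2}`. The second contains their derivatives and the components of weight three, among
them `d(3,i,3,0)`. If the first coefficient vanishes, so do the `d(3,i,3,j)`. If the second is zero
or of type N, then the `d(3,i,3,0)` vanish too: contract with the principal null direction,
distinguishing whether it is along `e 0` (`lowest_components_eq_zero`). Uniqueness of the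
coefficients (`peelingCoeffs_unique`) makes this apply to any expansion of the same tensor.

The second geodesic gives the same statement with the two null directions exchanged. So `d` at the
endpoint is zero or of type D, aligned with the plane of `ℓ` and `k`, which contains `N`. Its
symmetries and trace-freeness are proved in the interior from those of the curvature, and reach the
boundary by continuity along the geodesic. For such a tensor `D(v, N, N, N) = 0` whenever `v` is
orthogonal to `N` (`doubleContraction_eq_zero`), which is the vanishing of the super-Poynting vector
(`superPoynting_eq_zero`). -/

theorem sum_rotate {ι : Type*} [Fintype ι] (f : ι → ι → ι → ℝ) :
    ∑ i, ∑ j, ∑ k, f i j k = ∑ k, ∑ i, ∑ j, f i j k := by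
  rw [Finset.sum_congr rfl fun i _ => Finset.sum_comm, Finset.sum_comm]

/-! ### Derivatives along curves, and the coordinate change of Christoffel symbols in abstract form.
-/

section Abstract

variable {E F : Type*} [NormedAddCommGroup E] [NormedSpace ℝ E] [NormedAddCommGroup F]
  [NormedSpace ℝ F]

theorem hasFDerivWithinAt_smul_vector {s : Set E} {f : E → ℝ} {f' : E →L[ℝ] ℝ} {x : E} (B : F)
    (hf : HasFDerivWithinAt f f' s x) :
    HasFDerivWithinAt (fun x => f x • B) (f'.smulRight B) s x := by
  simpa using hf.smul_const B

/-- The set `R` will be the half-space `range I4`, in which an extended chart takes all its values,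
even off its source; so `hR` can be asked for every `s`. -/
theorem hasDerivWithinAt_comp_curve {B : E → F} {R : Set E} {x : ℝ → E} {S : Set ℝ} {t : ℝ}
    {DB : E →L[ℝ] F} {u : E} (hB : HasFDerivWithinAt B DB R (x t))
    (hx : HasDerivWithinAt x u S t) (hR : ∀ s, x s ∈ R) :
    HasDerivWithinAt (fun s => B (x s)) (DB u) S t :=
  hB.comp_hasDerivWithinAt t hx (fun s _ => hR s)

/-- Derivative of a bilinear form evaluated on vector fields along a curve. -/
theorem hasDerivWithinAt_bilinear_curve {B : E → E →L[ℝ] E →L[ℝ] ℝ} {R : Set E} {x : ℝ → E}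
    {S : Set ℝ} {t : ℝ} {DB : E →L[ℝ] E →L[ℝ] E →L[ℝ] ℝ} {u : E} {V W : ℝ → E} {V' W' : E}
    (hB : HasFDerivWithinAt B DB R (x t)) (hx : HasDerivWithinAt x u S t) (hR : ∀ s, x s ∈ R)
    (hV : HasDerivWithinAt V V' S t) (hW : HasDerivWithinAt W W' S t) :
    HasDerivWithinAt (fun s => B (x s) (V s) (W s))
      (DB u (V t) (W t) + B (x t) V' (W t) + B (x t) (V t) W') S t := by
  have h := hasDerivWithinAt_comp_curve (F := E →L[ℝ] E →L[ℝ] ℝ) hB hx hR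
  have := (h.clm_apply hV).clm_apply hW
  refine this.congr_deriv ?_
  simp

/-- Behaviour of the Christoffel symbols under a change of coordinates `ψ`. -/
theorem christoffel_coordChange {B₀ B₁ : E → E →L[ℝ] E →L[ℝ] ℝ} {R : Set E} {y : E} {ψ : E → E}
    {P : E → E →L[ℝ] E} {Q : E →L[ℝ] E →L[ℝ] E} {D₀ D₁ : E →L[ℝ] E →L[ℝ] E →L[ℝ] ℝ}
    (hU : UniqueDiffWithinAt ℝ R y) (hy : y ∈ R)
    (hB₀ : HasFDerivWithinAt B₀ D₀ R (ψ y)) (hB₁ : HasFDerivWithinAt B₁ D₁ R y)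
    (hψ : HasFDerivWithinAt ψ (P y) R y) (hψR : ∀ z, ψ z ∈ R)
    (hP : HasFDerivWithinAt P Q R y) (hQ : ∀ u v, Q u v = Q v u)
    (hBB : ∀ᶠ z in 𝓝[R] y, ∀ v w, B₁ z v w = B₀ (ψ z) (P z v) (P z w))
    (hsymm : ∀ v w, B₀ (ψ y) v w = B₀ (ψ y) w v)
    (hnd : ∀ v, (∀ w, B₀ (ψ y) v w = 0) → v = 0) (hsurj : Function.Surjective (P y))
    {u v γ₀ γ₁ : E}
    (h₀ : ∀ w, B₀ (ψ y) γ₀ w =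
      1 / 2 * (D₀ (P y u) (P y v) w + D₀ (P y v) (P y u) w - D₀ w (P y u) (P y v)))
    (h₁ : ∀ w, B₁ y γ₁ w = 1 / 2 * (D₁ u v w + D₁ v u w - D₁ w u v)) :
    P y γ₁ = Q u v + γ₀ := by
  -- Product rule for the pulled-back form; unique differentiability of `R` identifies the two
  -- derivatives.
  have hD : ∀ a v w, D₁ a v w = D₀ (P y a) (P y v) (P y w) + B₀ (ψ y) (Q a v) (P y w)
      + B₀ (ψ y) (P y v) (Q a w) := by
    intro a v w
    have e₁ := (hB₁.clm_apply (hasFDerivWithinAt_const v y R)).clm_apply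
      (hasFDerivWithinAt_const w y R)
    have hc := HasFDerivWithinAt.comp (G := E →L[ℝ] E →L[ℝ] ℝ) y hB₀ hψ (fun z _ => hψR z)
    have hv : HasFDerivWithinAt (fun z => P z v) ((ContinuousLinearMap.apply ℝ E v).comp Q) R y :=
      (ContinuousLinearMap.apply ℝ E v).hasFDerivAt.comp_hasFDerivWithinAt y hP
    have hw : HasFDerivWithinAt (fun z => P z w) ((ContinuousLinearMap.apply ℝ E w).comp Q) R y :=
      (ContinuousLinearMap.apply ℝ E w).hasFDerivAt.comp_hasFDerivWithinAt y hP
    have e₂ := (hc.clm_apply hv).clm_apply hw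
    have e₃ := e₂.congr_of_eventuallyEq (f₁ := fun z => B₁ z v w)
      (by filter_upwards [hBB] with z hz using hz v w) (hBB.self_of_nhdsWithin hy v w)
    have := congrArg (fun L => L a) (hU.eq e₁ e₃)
    simp at this
    linarith
  -- In the Koszul combination the `Q` terms cancel by symmetry except for two copies of `B₀ (Q u v)
  -- (P w)`, which the factor `1 / 2` turns into one.
  have key : P y γ₁ - (Q u v + γ₀) = 0 := by
    refine hnd _ fun w => ?_
    obtain ⟨w, rfl⟩ := hsurj w
    have e := hBB.self_of_nhdsWithin hy γ₁ w
    rw [h₁, hD, hD, hD, hQ v u, hQ w u, hQ w v] at e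
    simp only [map_sub, map_add, sub_apply, add_apply, ← e,
      h₀]
    rw [hsymm (Q u w) (P y v)]
    ring
  exact sub_eq_zero.1 key

end Abstract

/-! ### Vectors, bilinear forms and tensors in a fixed chart. -/

section Charts

variable {M : Type*} [TopologicalSpace M] [ChartedSpace (EuclideanHalfSpace 4) M]
  [IsManifold I4 ∞ M]

/-- The tangent vector at `z` with given components in the chart around `x₀`. -/
def vecOf (x₀ z : M) : E4 →ₗ[ℝ] TangentSpace I4 z where
  toFun v := (tangentCoordChange I4 x₀ z z v : E4)
  map_add' v w := (tangentCoordChange I4 x₀ z z).map_add v w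
  map_smul' a v := (tangentCoordChange I4 x₀ z z).map_smul a v

/-- The components of a tangent vector at `z` in the chart around `x₀`. -/
def inChart (x₀ z : M) : TangentSpace I4 z →ₗ[ℝ] E4 where
  toFun v := (tangentCoordChange I4 z x₀ z (comps v) : E4)
  map_add' v w := (tangentCoordChange I4 z x₀ z).map_add (comps v) (comps w)
  map_smul' a v := (tangentCoordChange I4 z x₀ z).map_smul a (comps v)

theorem vecOf_inChart {x₀ z : M} (hz : z ∈ (extChartAt I4 x₀).source) (v : TangentSpace I4 z) :
    vecOf x₀ z (inChart x₀ z v) = v := by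
  change tangentCoordChange I4 x₀ z z (tangentCoordChange I4 z x₀ z (comps v)) = comps v
  rw [tangentCoordChange_comp ⟨⟨mem_extChartAt_source z, hz⟩, mem_extChartAt_source z⟩,
    tangentCoordChange_self (mem_extChartAt_source z)]

theorem inChart_vecOf {x₀ z : M} (hz : z ∈ (extChartAt I4 x₀).source) (v : E4) :
    inChart x₀ z (vecOf x₀ z v) = v := by
  change tangentCoordChange I4 z x₀ z (tangentCoordChange I4 x₀ z z v) = v
  rw [tangentCoordChange_comp ⟨⟨hz, mem_extChartAt_source z⟩, hz⟩,
    tangentCoordChange_self hz]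

theorem vecOf_coordChange {x₀ x₁ z : M} (h₀ : z ∈ (extChartAt I4 x₀).source)
    (h₁ : z ∈ (extChartAt I4 x₁).source) (v : E4) :
    vecOf x₀ z (tangentCoordChange I4 x₁ x₀ z v) = vecOf x₁ z v := by
  exact tangentCoordChange_comp (v := v) ⟨⟨h₁, h₀⟩, mem_extChartAt_source z⟩

theorem coordChange_inChart {x₀ x₁ z : M} (h₀ : z ∈ (extChartAt I4 x₀).source)
    (h₁ : z ∈ (extChartAt I4 x₁).source) (v : TangentSpace I4 z) :
    tangentCoordChange I4 x₁ x₀ z (inChart x₁ z v) = inChart x₀ z v := by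
  exact tangentCoordChange_comp ⟨⟨mem_extChartAt_source z, h₁⟩, h₀⟩

theorem inChart_self (x : M) (v : TangentSpace I4 x) : inChart x x v = comps v :=
  tangentCoordChange_self (mem_extChartAt_source x)

theorem sum_stdVec (v : E4) : v = ∑ i, v i • stdVec i := by
  ext j
  simp [stdVec, Finset.sum_apply, Pi.single_apply]

@[simp] theorem stdVec_apply (i j : Fin 4) : stdVec i j = if j = i then 1 else 0 := by
  simp [stdVec]

/-- The `i`-th coordinate as a continuous linear form. -/
abbrev coordCLM (i : Fin 4) : E4 →L[ℝ] ℝ := EuclideanSpace.proj i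

/-- The field of bilinear forms `h` in the chart around `x₀`. -/
def metricIn (h : BilinField M) (x₀ : M) (y : E4) : E4 →L[ℝ] E4 →L[ℝ] ℝ :=
  ∑ i, ∑ j, compMatrix h x₀ y i j • (coordCLM i).smulRight (coordCLM j)

theorem metricIn_apply (h : BilinField M) (x₀ : M) (y v w : E4) :
    metricIn h x₀ y v w = ∑ i, ∑ j, compMatrix h x₀ y i j * v i * w j := by
  simp [metricIn, mul_assoc]

theorem metricIn_stdVec (h : BilinField M) (x₀ : M) (y : E4) (i j : Fin 4) :
    metricIn h x₀ y (stdVec i) (stdVec j) = compMatrix h x₀ y i j := by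
  simp [metricIn_apply]

theorem metricIn_eq_symm (h : BilinField M) (x₀ : M) (y v w : E4) :
    metricIn h x₀ y v w = h ((extChartAt I4 x₀).symm y) (vecOf x₀ _ v) (vecOf x₀ _ w) := by
  conv_rhs => rw [sum_stdVec v, sum_stdVec w]
  simp only [map_sum, map_smul, LinearMap.sum_apply, LinearMap.smul_apply, smul_eq_mul,
    metricIn_apply]
  rw [Finset.sum_comm]
  simp only [Finset.mul_sum]
  refine Finset.sum_congr rfl fun j _ => Finset.sum_congr rfl fun i _ => ?_
  have : compMatrix h x₀ y i j = h _ (vecOf x₀ _ (stdVec i)) (vecOf x₀ _ (stdVec j)) := rfl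
  rw [this]
  ring

theorem metricIn_eq (h : BilinField M) {x₀ z : M} (hz : z ∈ (extChartAt I4 x₀).source)
    (v w : E4) :
    metricIn h x₀ (extChartAt I4 x₀ z) v w = h z (vecOf x₀ z v) (vecOf x₀ z w) := by
  rw [metricIn_eq_symm]
  have := (extChartAt I4 x₀).left_inv hz
  rw [this]

theorem metricIn_inChart (h : BilinField M) {x₀ z : M} (hz : z ∈ (extChartAt I4 x₀).source)
    (v w : TangentSpace I4 z) :
    metricIn h x₀ (extChartAt I4 x₀ z) (inChart x₀ z v) (inChart x₀ z w) = h z v w := by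
  rw [metricIn_eq h hz, vecOf_inChart hz, vecOf_inChart hz]

theorem metricIn_self (h : BilinField M) (x : M) (v w : TangentSpace I4 x) :
    metricIn h x (extChartAt I4 x x) (comps v) (comps w) = h x v w := by
  rw [← inChart_self, ← inChart_self, metricIn_inChart h (mem_extChartAt_source x)]

theorem apply_eq_compMatrix (h : BilinField M) (x : M) (v w : TangentSpace I4 x) :
    h x v w = ∑ i, ∑ j, compMatrix h x (extChartAt I4 x x) i j * comps v i * comps w j := by
  rw [← metricIn_self, metricIn_apply]

/-- Multilinear expansion in the coordinate basis of one fixed chart: a tensor field evaluated on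
vector fields along a curve becomes a sum of products of real functions. -/
theorem compTensor_self (T : (x : M) → Tensor4 x) {x₀ z : M}
    (hz : z ∈ (extChartAt I4 x₀).source) (v : Fin 4 → TangentSpace I4 z) :
    T z v = ∑ r : Fin 4 → Fin 4, (∏ m, inChart x₀ z (v m) (r m)) *
      compTensor T x₀ (extChartAt I4 x₀ z) (r 0) (r 1) (r 2) (r 3) := by
  have hv : v = fun m => ∑ i, inChart x₀ z (v m) i • vecOf x₀ z (stdVec i) := by
    funext m
    conv_lhs => rw [← vecOf_inChart hz (v m), sum_stdVec (inChart x₀ z (v m))]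
    simp only [map_sum, map_smul]
  conv_lhs => rw [hv]
  rw [MultilinearMap.map_sum]
  refine Finset.sum_congr rfl fun r _ => ?_
  rw [MultilinearMap.map_smul_univ, smul_eq_mul]
  congr 1
  -- `compTensor` evaluates at `symm` of the coordinates of `z`, which is only propositionally `z`;
  -- generalizing the base point reconciles the dependent types.
  have key : ∀ z', z' = z → T z (fun m => vecOf x₀ z (stdVec (r m))) =
      T z' ![coordVec x₀ (r 0) _, coordVec x₀ (r 1) _, coordVec x₀ (r 2) _,
        coordVec x₀ (r 3) _] := by
    rintro _ rfl
    congr 1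
    funext m
    fin_cases m <;> rfl
  exact key _ ((extChartAt I4 x₀).left_inv hz)

theorem mem_range_of_mem_target {x₀ : M} {y : E4} (hy : y ∈ (extChartAt I4 x₀).target) :
    y ∈ range I4 := extChartAt_target_subset_range x₀ hy

/-- The chart target is a neighbourhood of each of its points within the half-space, the set in
which all derivatives are taken. -/
theorem ContDiffOn.contDiffWithinAt_range {F : Type*} [NormedAddCommGroup F] [NormedSpace ℝ F]
    {f : E4 → F} {x₀ : M}
    (hf : ContDiffOn ℝ ∞ f (extChartAt I4 x₀).target) {y : E4}
    (hy : y ∈ (extChartAt I4 x₀).target) : ContDiffWithinAt ℝ ∞ f (range I4) y :=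
  (hf y hy).mono_of_mem_nhdsWithin (extChartAt_target_mem_nhdsWithin_of_mem hy)

theorem uniqueDiffWithinAt_range {y : E4} (hy : y ∈ range I4) :
    UniqueDiffWithinAt ℝ (range I4) y := I4.uniqueDiffOn y hy

/-- Smoothness of the components of `h` in the chart around `x₀`. -/
def SmoothIn (h : BilinField M) (x₀ : M) : Prop :=
  ∀ i j, ContDiffOn ℝ ∞ (fun y => compMatrix h x₀ y i j) (extChartAt I4 x₀).target

/-- Nondegenerate symmetric fields of bilinear forms. -/
structure IsMetric (h : BilinField M) : Prop where
  symm : ∀ x v w, h x v w = h x w v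
  nondeg : ∀ x v, (∀ w, h x v w = 0) → v = 0

/-- Symmetric fields of bilinear forms that are nondegenerate at `x`. -/
structure IsMetricAt (h : BilinField M) (x : M) : Prop where
  symm : ∀ x v w, h x v w = h x w v
  nondeg : ∀ v, (∀ w, h x v w = 0) → v = 0

theorem IsMetric.at {h : BilinField M} (hm : IsMetric h) (x : M) : IsMetricAt h x :=
  ⟨hm.symm, hm.nondeg x⟩

theorem IsLorentzian.nondeg {x : M} {b : LinearMap.BilinForm ℝ (TangentSpace I4 x)}
    (hb : IsLorentzian b) {v : TangentSpace I4 x} (hv : ∀ w, b v w = 0) : v = 0 := by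
  obtain ⟨f, hf⟩ := hb
  rw [← f.sum_repr v] at hv ⊢
  refine Finset.sum_eq_zero fun i _ => ?_
  have := hv (f i)
  simp only [map_sum, map_smul, LinearMap.sum_apply, LinearMap.smul_apply, hf, smul_eq_mul,
    mul_ite, mul_zero, Finset.sum_ite_eq', Finset.mem_univ, if_true] at this
  have h0 : f.repr v i = 0 := by
    split_ifs at this <;> linarith
  rw [h0, zero_smul]

theorem compMatrix_symm {h : BilinField M} (hm : ∀ x v w, h x v w = h x w v) (x₀ : M) (y : E4) (i j : Fin 4) :
    compMatrix h x₀ y i j = compMatrix h x₀ y j i := by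
  simp only [compMatrix, Matrix.of_apply]
  exact hm _ _ _

theorem metricIn_symm {h : BilinField M} (hm : ∀ x v w, h x v w = h x w v) (x₀ : M) (y v w : E4) :
    metricIn h x₀ y v w = metricIn h x₀ y w v := by
  rw [metricIn_eq_symm, hm, ← metricIn_eq_symm]

theorem metricIn_nondeg {h : BilinField M} {x₀ : M} {y : E4}
    (hm : IsMetricAt h ((extChartAt I4 x₀).symm y))
    (hy : y ∈ (extChartAt I4 x₀).target) {v : E4} (hv : ∀ w, metricIn h x₀ y v w = 0) :
    v = 0 := by
  have hz := (extChartAt I4 x₀).map_target hy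
  have h0 : vecOf x₀ ((extChartAt I4 x₀).symm y) v = 0 := by
    refine hm.nondeg _ fun w => ?_
    rw [← vecOf_inChart hz w, ← metricIn_eq_symm]
    exact hv _
  rw [← inChart_vecOf hz v, h0, map_zero]

theorem compMatrix_det {h : BilinField M} {x₀ : M} {y : E4}
    (hm : IsMetricAt h ((extChartAt I4 x₀).symm y))
    (hy : y ∈ (extChartAt I4 x₀).target) : IsUnit (compMatrix h x₀ y).det := by
  rw [isUnit_iff_ne_zero]
  intro hdet
  obtain ⟨v, hv0, hv⟩ := Matrix.exists_vecMul_eq_zero_iff.2 hdet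
  apply hv0
  have : (WithLp.toLp 2 v : E4) = 0 := by
    refine metricIn_nondeg hm hy fun w => ?_
    rw [metricIn_apply, Finset.sum_comm]
    refine Finset.sum_eq_zero fun j _ => ?_
    have := congrFun hv j
    simp only [Matrix.vecMul, dotProduct, Pi.zero_apply] at this
    rw [← Finset.sum_mul]
    simp only [mul_comm (compMatrix h x₀ y _ j)]
    rw [this, zero_mul]
  simpa using congrArg (WithLp.ofLp) this

end Charts

/-! ### The Christoffel symbols and the Koszul formula. -/

section Connection

variable {M : Type*} [TopologicalSpace M] [ChartedSpace (EuclideanHalfSpace 4) M]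
  [IsManifold I4 ∞ M]

theorem fderivWithin_eq_sum_pd (f : E4 → ℝ) (y u : E4) :
    fderivWithin ℝ f (range I4) y u = ∑ k, u k * pd k f y := by
  conv_lhs => rw [sum_stdVec u]
  simp [pd]

/-- The derivative of `metricIn h x₀`. -/
def metricDeriv (h : BilinField M) (x₀ : M) (y : E4) : E4 →L[ℝ] E4 →L[ℝ] E4 →L[ℝ] ℝ :=
  ∑ i, ∑ j, (fderivWithin ℝ (fun z => compMatrix h x₀ z i j) (range I4) y).smulRight
    ((coordCLM i).smulRight (coordCLM j) : E4 →L[ℝ] E4 →L[ℝ] ℝ)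

theorem metricDeriv_apply (h : BilinField M) (x₀ : M) (y u v w : E4) :
    metricDeriv h x₀ y u v w =
      ∑ k, ∑ i, ∑ j, pd k (fun z => compMatrix h x₀ z i j) y * u k * v i * w j := by
  have : metricDeriv h x₀ y u v w = ∑ i, ∑ j, ∑ k,
      pd k (fun z => compMatrix h x₀ z i j) y * u k * v i * w j := by
    simp only [metricDeriv, sum_apply, ContinuousLinearMap.smulRight_apply,
      fderivWithin_eq_sum_pd, smul_apply, smul_eq_mul, PiLp.proj_apply,
      Finset.sum_mul]
    refine Finset.sum_congr rfl fun i _ => Finset.sum_congr rfl fun j _ =>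
      Finset.sum_congr rfl fun k _ => by ring
  rw [this, sum_rotate]

theorem hasFDerivWithinAt_metricIn {h : BilinField M} {x₀ : M} (hs : SmoothIn h x₀) {y : E4}
    (hy : y ∈ (extChartAt I4 x₀).target) :
    HasFDerivWithinAt (metricIn h x₀) (metricDeriv h x₀ y) (range I4) y := by
  unfold metricIn metricDeriv
  refine HasFDerivWithinAt.fun_sum fun i _ => HasFDerivWithinAt.fun_sum fun j _ =>
    hasFDerivWithinAt_smul_vector _ ?_
  exact ((ContDiffOn.contDiffWithinAt_range (hs i j) hy).differentiableWithinAt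
    (by simp)).hasFDerivWithinAt

/-- The Christoffel symbols as a bilinear operation on the model space. -/
def gamma (h : BilinField M) (x₀ : M) (y u v : E4) : E4 :=
  WithLp.toLp 2 fun i => ∑ j, ∑ k, christoffel h x₀ i j k y * u j * v k

theorem compMatrix_mul_inv {h : BilinField M} {x₀ : M} {y : E4}
    (hm : IsMetricAt h ((extChartAt I4 x₀).symm y))
    (hy : y ∈ (extChartAt I4 x₀).target) (m l : Fin 4) :
    ∑ i, compMatrix h x₀ y m i * (compMatrix h x₀ y)⁻¹ i l = if m = l then 1 else 0 := by
  rw [← Matrix.mul_apply, Matrix.mul_nonsing_inv _ (compMatrix_det hm hy), Matrix.one_apply]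

/-- The Christoffel symbols of the first kind. -/
def christoffelFirst (h : BilinField M) (x₀ : M) (l j k : Fin 4) (y : E4) : ℝ :=
  1 / 2 * (pd j (fun z => compMatrix h x₀ z l k) y + pd k (fun z => compMatrix h x₀ z l j) y
      - pd l (fun z => compMatrix h x₀ z j k) y)

theorem compMatrix_mul_christoffel {h : BilinField M} {x₀ : M} {y : E4}
    (hm : IsMetricAt h ((extChartAt I4 x₀).symm y))
    (hy : y ∈ (extChartAt I4 x₀).target) (m j k : Fin 4) :
    ∑ i, compMatrix h x₀ y m i * christoffel h x₀ i j k y = christoffelFirst h x₀ m j k y := by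
  simp only [christoffel, Finset.mul_sum]
  rw [Finset.sum_comm]
  have : ∀ l, ∑ i, compMatrix h x₀ y m i * (1 / 2 * ((compMatrix h x₀ y)⁻¹ i l *
      (pd j (fun z => compMatrix h x₀ z l k) y + pd k (fun z => compMatrix h x₀ z l j) y
      - pd l (fun z => compMatrix h x₀ z j k) y))) =
      if m = l then christoffelFirst h x₀ l j k y else 0 := by
    intro l
    rw [← boole_mul, ← compMatrix_mul_inv hm hy, Finset.sum_mul]
    refine Finset.sum_congr rfl fun i _ => ?_
    rw [christoffelFirst]
    ring
  simp only [this]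
  simp

/-- The Koszul formula. By nondegeneracy it characterizes `gamma` without the inverse matrix; the
transformation law, the conformal change and metric compatibility all rest on it. -/
theorem metricIn_gamma {h : BilinField M} {x₀ : M} {y : E4}
    (hm : IsMetricAt h ((extChartAt I4 x₀).symm y))
    (hy : y ∈ (extChartAt I4 x₀).target) (u v w : E4) :
    metricIn h x₀ y (gamma h x₀ y u v) w = 1 / 2 * (metricDeriv h x₀ y u v w
      + metricDeriv h x₀ y v u w - metricDeriv h x₀ y w u v) := by
  have e₁ : metricIn h x₀ y (gamma h x₀ y u v) w =
      ∑ m, ∑ j, ∑ k, christoffelFirst h x₀ m j k y * u j * v k * w m := by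
    rw [metricIn_symm hm.symm, metricIn_apply]
    refine Finset.sum_congr rfl fun m _ => ?_
    simp only [gamma, Finset.mul_sum]
    rw [Finset.sum_comm]
    refine Finset.sum_congr rfl fun j _ => ?_
    rw [Finset.sum_comm]
    refine Finset.sum_congr rfl fun k _ => ?_
    rw [← compMatrix_mul_christoffel hm hy, Finset.sum_mul, Finset.sum_mul, Finset.sum_mul]
    refine Finset.sum_congr rfl fun i _ => ?_
    ring
  have e₂ : metricDeriv h x₀ y u v w = ∑ m, ∑ j, ∑ k,
      pd j (fun z => compMatrix h x₀ z m k) y * u j * v k * w m := by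
    rw [metricDeriv_apply, sum_rotate]
    refine Finset.sum_congr rfl fun m _ => Finset.sum_congr rfl fun j _ =>
      Finset.sum_congr rfl fun k _ => ?_
    simp only [compMatrix_symm hm.symm x₀ _ k m]
  have e₃ : metricDeriv h x₀ y v u w = ∑ m, ∑ j, ∑ k,
      pd k (fun z => compMatrix h x₀ z m j) y * u j * v k * w m := by
    rw [metricDeriv_apply, sum_rotate]
    refine Finset.sum_congr rfl fun m _ => ?_
    rw [Finset.sum_comm]
    refine Finset.sum_congr rfl fun j _ => Finset.sum_congr rfl fun k _ => ?_
    simp only [compMatrix_symm hm.symm x₀ _ j m]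
    ring
  have e₄ : metricDeriv h x₀ y w u v = ∑ m, ∑ j, ∑ k,
      pd m (fun z => compMatrix h x₀ z j k) y * u j * v k * w m := by
    rw [metricDeriv_apply]
    refine Finset.sum_congr rfl fun m _ => Finset.sum_congr rfl fun j _ =>
      Finset.sum_congr rfl fun k _ => by ring
  rw [e₁, e₂, e₃, e₄, ← Finset.sum_add_distrib, ← Finset.sum_sub_distrib, Finset.mul_sum]
  refine Finset.sum_congr rfl fun m _ => ?_
  rw [← Finset.sum_add_distrib, ← Finset.sum_sub_distrib, Finset.mul_sum]
  refine Finset.sum_congr rfl fun j _ => ?_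
  rw [← Finset.sum_add_distrib, ← Finset.sum_sub_distrib, Finset.mul_sum]
  refine Finset.sum_congr rfl fun k _ => ?_
  rw [christoffelFirst]
  ring

end Connection

/-! ### Curves, velocities and parallel transport in an arbitrary chart. -/

section Curves

variable {M : Type*} [TopologicalSpace M] [ChartedSpace (EuclideanHalfSpace 4) M]
  [IsManifold I4 ∞ M]

/-- `c` has velocity `u` on the set `S`. -/
def HasVelocity (c : ℝ → M) (u : (t : ℝ) → TangentSpace I4 (c t)) (S : Set ℝ) : Prop :=
  ∀ t ∈ S, HasMFDerivWithinAt 𝓘(ℝ, ℝ) I4 c S t ((1 : ℝ →L[ℝ] ℝ).smulRight (u t))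

variable {c : ℝ → M} {u : (t : ℝ) → TangentSpace I4 (c t)} {S : Set ℝ}

theorem HasVelocity.mono {S' : Set ℝ} (hc : HasVelocity c u S) (h : S' ⊆ S) :
    HasVelocity c u S' := fun t ht => (hc t (h ht)).mono h

theorem HasVelocity.continuousWithinAt (hc : HasVelocity c u S) {t : ℝ} (ht : t ∈ S) :
    ContinuousWithinAt c S t := (hc t ht).1

theorem HasVelocity.eventually_mem (hc : HasVelocity c u S) {t : ℝ} (ht : t ∈ S) {x₀ : M}
    (hx : c t ∈ (extChartAt I4 x₀).source) :
    ∀ᶠ s in 𝓝[S] t, c s ∈ (extChartAt I4 x₀).source :=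
  hc.continuousWithinAt ht (extChartAt_source_mem_nhds' hx)

theorem HasVelocity.hasDerivWithinAt_self (hc : HasVelocity c u S) {t : ℝ} (ht : t ∈ S) :
    HasDerivWithinAt (fun s => extChartAt I4 (c t) (c s)) (comps (u t)) S t := by
  have h := (hc t ht).2
  simp only [mfld_simps] at h
  have h' : HasFDerivWithinAt (fun s => extChartAt I4 (c t) (c s))
    ((1 : ℝ →L[ℝ] ℝ).smulRight (comps (u t))) S t := h
  simpa using h'.hasDerivWithinAt

theorem coordChange_mem_source {x₀ x₁ z : M} (h₀ : z ∈ (extChartAt I4 x₀).source)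
    (h₁ : z ∈ (extChartAt I4 x₁).source) :
    extChartAt I4 x₁ z ∈ ((extChartAt I4 x₁).symm ≫ extChartAt I4 x₀).source := by
  rw [PartialEquiv.trans_source'', PartialEquiv.symm_symm, PartialEquiv.symm_target]
  exact mem_image_of_mem _ ⟨h₁, h₀⟩

theorem HasVelocity.hasDerivWithinAt (hc : HasVelocity c u S) {t : ℝ} (ht : t ∈ S) {x₀ : M}
    (hx : c t ∈ (extChartAt I4 x₀).source) :
    HasDerivWithinAt (fun s => extChartAt I4 x₀ (c s)) (inChart x₀ (c t) (u t)) S t := by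
  have hP : HasFDerivWithinAt _ _ (range I4) (extChartAt I4 (c t) (c t)) :=
    hasFDerivWithinAt_tangentCoordChange (I := I4) (x := c t) (y := x₀)
      ⟨mem_extChartAt_source (c t), hx⟩
  have h := hasDerivWithinAt_comp_curve (x := fun s => extChartAt I4 (c t) (c s)) hP
    (hc.hasDerivWithinAt_self ht) (fun s => mem_range_self _)
  refine h.congr_of_eventuallyEq ?_ ?_
  · filter_upwards [hc.eventually_mem ht (mem_extChartAt_source (c t))] with s hs
    simp only [Function.comp, (extChartAt I4 (c t)).left_inv hs]
  · simp only [Function.comp, (extChartAt I4 (c t)).left_inv (mem_extChartAt_source (c t))]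

theorem contDiffWithinAt_coordChange {x₀ x₁ z : M} (h₀ : z ∈ (extChartAt I4 x₀).source)
    (h₁ : z ∈ (extChartAt I4 x₁).source) :
    ContDiffWithinAt ℝ ∞ (extChartAt I4 x₀ ∘ (extChartAt I4 x₁).symm) (range I4)
      (extChartAt I4 x₁ z) :=
  contDiffWithinAt_ext_coord_change x₀ x₁ (coordChange_mem_source h₀ h₁)

theorem eventually_mem_sources {x₀ x₁ z : M} (h₀ : z ∈ (extChartAt I4 x₀).source)
    (h₁ : z ∈ (extChartAt I4 x₁).source) :
    ∀ᶠ y in 𝓝[range I4] (extChartAt I4 x₁ z), y ∈ (extChartAt I4 x₁).target ∧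
      (extChartAt I4 x₁).symm y ∈ (extChartAt I4 x₀).source ∧
      (extChartAt I4 x₁).symm y ∈ (extChartAt I4 x₁).source := by
  have e₁ : ∀ᶠ y in 𝓝[range I4] (extChartAt I4 x₁ z), y ∈ (extChartAt I4 x₁).target :=
    extChartAt_target_mem_nhdsWithin' h₁
  have e₂ : ∀ᶠ y in 𝓝[range I4] (extChartAt I4 x₁ z),
      (extChartAt I4 x₁).symm y ∈ (extChartAt I4 x₀).source := by
    have := (continuousAt_extChartAt_symm' (I := I4) h₁).eventually
      (by rw [(extChartAt I4 x₁).left_inv h₁]; exact extChartAt_source_mem_nhds' h₀)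
    exact nhdsWithin_le_nhds this
  filter_upwards [e₁, e₂] with y h h'
  exact ⟨h, h', (extChartAt I4 x₁).map_target h⟩

/-- Symmetry holds at boundary points as well, because the half-space lies in the closure of its
interior. -/
theorem isSymmSndFDerivWithinAt_range {F : Type*} [NormedAddCommGroup F] [NormedSpace ℝ F]
    {f : E4 → F} {y : E4} (hf : ContDiffWithinAt ℝ ∞ f (range I4) y) (hy : y ∈ range I4) :
    IsSymmSndFDerivWithinAt ℝ f (range I4) y :=
  hf.isSymmSndFDerivWithinAt 
    (by rw [minSmoothness_of_isRCLikeNormedField]; exact WithTop.coe_le_coe.2 le_top) I4.uniqueDiffOn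
    (I4.range_subset_closure_interior hy) hy

theorem hasFDerivWithinAt_fderivWithin {F : Type*} [NormedAddCommGroup F] [NormedSpace ℝ F]
    {f : E4 → F} {y : E4} (hf : ContDiffWithinAt ℝ ∞ f (range I4) y) (hy : y ∈ range I4) :
    HasFDerivWithinAt (fderivWithin ℝ f (range I4))
      (fderivWithin ℝ (fderivWithin ℝ f (range I4)) (range I4) y) (range I4) y :=
  ((hf.fderivWithin_right (m := 1) I4.uniqueDiffOn (by norm_cast) hy).differentiableWithinAt
    (by simp)).hasFDerivWithinAt

/-- The transformation law of the Christoffel symbols. -/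
theorem gamma_coordChange {h : BilinField M} (hm : IsMetric h) {x₀ x₁ z : M}
    (h₀ : z ∈ (extChartAt I4 x₀).source) (h₁ : z ∈ (extChartAt I4 x₁).source)
    (hs₀ : SmoothIn h x₀) (hs₁ : SmoothIn h x₁) (v w : E4) :
    tangentCoordChange I4 x₁ x₀ z (gamma h x₁ (extChartAt I4 x₁ z) v w) =
      fderivWithin ℝ (fderivWithin ℝ (extChartAt I4 x₀ ∘ (extChartAt I4 x₁).symm) (range I4))
        (range I4) (extChartAt I4 x₁ z) v w
      + gamma h x₀ (extChartAt I4 x₀ z) (tangentCoordChange I4 x₁ x₀ z v)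
        (tangentCoordChange I4 x₁ x₀ z w) := by
  have hψ := contDiffWithinAt_coordChange h₀ h₁
  have hy₁ : extChartAt I4 x₁ z ∈ (extChartAt I4 x₁).target := (extChartAt I4 x₁).map_source h₁
  have hy₀ : extChartAt I4 x₀ z ∈ (extChartAt I4 x₀).target := (extChartAt I4 x₀).map_source h₀
  have hyR : extChartAt I4 x₁ z ∈ range I4 := mem_range_self _
  have hψz : (extChartAt I4 x₀ ∘ (extChartAt I4 x₁).symm) (extChartAt I4 x₁ z) =
      extChartAt I4 x₀ z := by
    rw [Function.comp_apply, (extChartAt I4 x₁).left_inv h₁]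
  have hfd := tangentCoordChange_def (I := I4) (x := x₁) (y := x₀) (z := z)
  rw [hfd]
  refine christoffel_coordChange (R := range I4) (B₀ := metricIn h x₀) (B₁ := metricIn h x₁)
    (ψ := extChartAt I4 x₀ ∘ (extChartAt I4 x₁).symm)
    (P := fderivWithin ℝ (extChartAt I4 x₀ ∘ (extChartAt I4 x₁).symm) (range I4))
    (u := v) (v := w)
    (D₀ := metricDeriv h x₀ (extChartAt I4 x₀ z)) (D₁ := metricDeriv h x₁ (extChartAt I4 x₁ z))
    (uniqueDiffWithinAt_range hyR) hyR ?_ (hasFDerivWithinAt_metricIn hs₁ hy₁)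
    (hψ.differentiableWithinAt (by simp)).hasFDerivWithinAt (fun z => mem_range_self _)
    (hasFDerivWithinAt_fderivWithin hψ hyR)
    (fun u v => (isSymmSndFDerivWithinAt_range hψ hyR) u v) ?_ ?_ ?_ ?_ ?_
    (metricIn_gamma (hm.at _) hy₁ v w)
  · rw [hψz]
    exact hasFDerivWithinAt_metricIn hs₀ hy₀
  · filter_upwards [eventually_mem_sources h₀ h₁] with y hy a b
    have hfd' := tangentCoordChange_def (I := I4) (x := x₁) (y := x₀)
      (z := (extChartAt I4 x₁).symm y)
    rw [(extChartAt I4 x₁).right_inv hy.1] at hfd'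
    rw [← hfd', Function.comp_apply, metricIn_eq h hy.2.1, vecOf_coordChange hy.2.1 hy.2.2,
      vecOf_coordChange hy.2.1 hy.2.2, metricIn_eq_symm]
  · intro a b
    exact metricIn_symm hm.symm _ _ _ _
  · intro a ha
    rw [hψz] at ha
    exact metricIn_nondeg (hm.at _) hy₀ ha
  · intro a
    refine ⟨tangentCoordChange I4 x₀ x₁ z a, ?_⟩
    rw [← hfd, tangentCoordChange_comp ⟨⟨h₀, h₁⟩, h₀⟩, tangentCoordChange_self h₀]
  · intro a
    rw [hψz]
    exact metricIn_gamma (hm.at _) hy₀ _ _ _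

theorem isParallelAlong_iff_self {h : BilinField M} {V : (t : ℝ) → TangentSpace I4 (c t)} :
    IsParallelAlong h c u S V ↔ ∀ t ∈ S,
      HasDerivWithinAt (fun s => inChart (c t) (c s) (V s))
        (-gamma h (c t) (extChartAt I4 (c t) (c t)) (comps (u t)) (comps (V t))) S t := by
  have : ∀ t, (WithLp.toLp 2 fun i => - ∑ j, ∑ k,
      christoffel h (c t) i j k (extChartAt I4 (c t) (c t)) * comps (u t) j * comps (V t) k : E4)
      = -gamma h (c t) (extChartAt I4 (c t) (c t)) (comps (u t)) (comps (V t)) := by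
    intro t
    ext i
    simp [gamma]
  unfold IsParallelAlong
  simp only [this]
  rfl

/-- The equation of parallel transport in an arbitrary chart. -/
theorem IsParallelAlong.hasDerivWithinAt {h : BilinField M} (hm : IsMetric h)
    (hs : ∀ x₀, SmoothIn h x₀) {V : (t : ℝ) → TangentSpace I4 (c t)} (hc : HasVelocity c u S)
    (hV : IsParallelAlong h c u S V) {t : ℝ} (ht : t ∈ S) {x₀ : M}
    (hx : c t ∈ (extChartAt I4 x₀).source) :
    HasDerivWithinAt (fun s => inChart x₀ (c s) (V s))
      (-gamma h x₀ (extChartAt I4 x₀ (c t)) (inChart x₀ (c t) (u t)) (inChart x₀ (c t) (V t)))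
      S t := by
  have hx₁ := mem_extChartAt_source (I := I4) (c t)
  have hψ := contDiffWithinAt_coordChange hx hx₁
  have hP := hasFDerivWithinAt_fderivWithin hψ (mem_range_self _)
  have h1 := hasDerivWithinAt_comp_curve (F := E4 →L[ℝ] E4) (R := range I4) hP (hc.hasDerivWithinAt_self ht)
    (fun s => mem_range_self _)
  have h2 := h1.clm_apply (isParallelAlong_iff_self.1 hV t ht)
  have hev : (fun s => inChart x₀ (c s) (V s)) =ᶠ[𝓝[S] t] fun s =>
      fderivWithin ℝ (extChartAt I4 x₀ ∘ (extChartAt I4 (c t)).symm) (range I4)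
        (extChartAt I4 (c t) (c s)) (inChart (c t) (c s) (V s)) := by
    filter_upwards [hc.eventually_mem ht hx, hc.eventually_mem ht hx₁] with s hs₀ hs₁
    rw [← tangentCoordChange_def, coordChange_inChart hs₀ hs₁]
  refine (h2.congr_of_eventuallyEq hev (hev.self_of_nhdsWithin ht)).congr_deriv ?_
  -- The second derivative of the chart change left by the product rule is cancelled by the
  -- inhomogeneous term of this law.
  have := gamma_coordChange hm hx hx₁ (hs x₀) (hs (c t)) (comps (u t)) (comps (V t))
  rw [← inChart_self, ← inChart_self, coordChange_inChart hx hx₁, coordChange_inChart hx hx₁] at this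
  rw [inChart_self, inChart_self] at this
  rw [map_neg, inChart_self, ← tangentCoordChange_def, this]
  abel

end Curves

/-! ### Differential and Hessian of a function. -/

section Differential

variable {M : Type*} [TopologicalSpace M] [ChartedSpace (EuclideanHalfSpace 4) M]
  [IsManifold I4 ∞ M]

/-- A function in the chart around `x₀`. -/
def funIn (f : M → ℝ) (x₀ : M) (y : E4) : ℝ := f ((extChartAt I4 x₀).symm y)

theorem contDiffOn_funIn {f : M → ℝ} (hf : ContMDiff I4 𝓘(ℝ, ℝ) ∞ f) (x₀ : M) :
    ContDiffOn ℝ ∞ (funIn f x₀) (extChartAt I4 x₀).target := by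
  rw [← contMDiffOn_iff_contDiffOn]
  exact hf.comp_contMDiffOn (contMDiffOn_extChartAt_symm x₀)

theorem contDiffWithinAt_funIn {f : M → ℝ} (hf : ContMDiff I4 𝓘(ℝ, ℝ) ∞ f) {x₀ z : M}
    (hz : z ∈ (extChartAt I4 x₀).source) :
    ContDiffWithinAt ℝ ∞ (funIn f x₀) (range I4) (extChartAt I4 x₀ z) :=
  ContDiffOn.contDiffWithinAt_range (contDiffOn_funIn hf x₀) ((extChartAt I4 x₀).map_source hz)

/-- The differential of a function in the chart around `x₀`. -/
def differentialIn (f : M → ℝ) (x₀ : M) (y : E4) : E4 →L[ℝ] ℝ :=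
  fderivWithin ℝ (funIn f x₀) (range I4) y

/-- The differential of a function at a point. -/
def differential (f : M → ℝ) (z : M) : TangentSpace I4 z →ₗ[ℝ] ℝ where
  toFun v := differentialIn f z (extChartAt I4 z z) (comps v)
  map_add' v w := (differentialIn f z (extChartAt I4 z z)).map_add (comps v) (comps w)
  map_smul' a v := (differentialIn f z (extChartAt I4 z z)).map_smul a (comps v)

theorem hasFDerivWithinAt_funIn {f : M → ℝ} (hf : ContMDiff I4 𝓘(ℝ, ℝ) ∞ f) {x₀ z : M}
    (hz : z ∈ (extChartAt I4 x₀).source) :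
    HasFDerivWithinAt (funIn f x₀) (differentialIn f x₀ (extChartAt I4 x₀ z)) (range I4)
      (extChartAt I4 x₀ z) :=
  ((contDiffWithinAt_funIn hf hz).differentiableWithinAt (by simp)).hasFDerivWithinAt

theorem differential_eq {f : M → ℝ} (hf : ContMDiff I4 𝓘(ℝ, ℝ) ∞ f) {x₀ z : M}
    (hz : z ∈ (extChartAt I4 x₀).source) (v : TangentSpace I4 z) :
    differential f z v = differentialIn f x₀ (extChartAt I4 x₀ z) (inChart x₀ z v) := by
  have hz₁ := mem_extChartAt_source (I := I4) z
  have hψ : HasFDerivWithinAt _ _ (range I4) (extChartAt I4 z z) :=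
    hasFDerivWithinAt_tangentCoordChange (I := I4) (x := z) (y := x₀) ⟨hz₁, hz⟩
  have h₁ := hasFDerivWithinAt_funIn hf hz₁
  have h₀ := hasFDerivWithinAt_funIn hf hz
  have hψz : (extChartAt I4 x₀ ∘ (extChartAt I4 z).symm) (extChartAt I4 z z) =
      extChartAt I4 x₀ z := by rw [Function.comp_apply, (extChartAt I4 z).left_inv hz₁]
  rw [← hψz] at h₀
  have h₂ := HasFDerivWithinAt.comp (t := range I4) _ h₀ hψ (fun y _ => mem_range_self _)
  have hev : funIn f z =ᶠ[𝓝[range I4] (extChartAt I4 z z)]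
      funIn f x₀ ∘ (extChartAt I4 x₀ ∘ (extChartAt I4 z).symm) := by
    filter_upwards [eventually_mem_sources hz hz₁] with y hy
    simp only [funIn, Function.comp_apply, (extChartAt I4 x₀).left_inv hy.2.1]
  have h₃ := h₂.congr_of_eventuallyEq hev (hev.self_of_nhdsWithin (mem_range_self _))
  have := (uniqueDiffWithinAt_range (mem_range_self _)).eq h₁ h₃
  change differentialIn f z (extChartAt I4 z z) (comps v) = _
  rw [this, hψz]
  rfl

theorem differential_eq_sum (f : M → ℝ) (z : M) (v : TangentSpace I4 z) :
    differential f z v = ∑ k, comps v k *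
      pd k (fun y => f ((extChartAt I4 z).symm y)) (extChartAt I4 z z) :=
  fderivWithin_eq_sum_pd _ _ _

/-- The Hessian of a function in the chart around `x₀`. -/
def hessianIn (h : BilinField M) (f : M → ℝ) (x₀ : M) (y u v : E4) : ℝ :=
  fderivWithin ℝ (differentialIn f x₀) (range I4) y u v - differentialIn f x₀ y (gamma h x₀ y u v)

theorem hasFDerivWithinAt_differentialIn {f : M → ℝ} (hf : ContMDiff I4 𝓘(ℝ, ℝ) ∞ f) {x₀ z : M}
    (hz : z ∈ (extChartAt I4 x₀).source) :
    HasFDerivWithinAt (differentialIn f x₀)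
      (fderivWithin ℝ (differentialIn f x₀) (range I4) (extChartAt I4 x₀ z)) (range I4)
      (extChartAt I4 x₀ z) :=
  hasFDerivWithinAt_fderivWithin (contDiffWithinAt_funIn hf hz) (mem_range_self _)

/-- Brings the Hessian to the form used in `ConformalCompletion.gauge`, so that the gauge condition
says that the Hessian of `Ω` vanishes on the boundary. -/
theorem hessianIn_self (h : BilinField M) {f : M → ℝ} (hf : ContMDiff I4 𝓘(ℝ, ℝ) ∞ f) (z : M)
    (u v : E4) : hessianIn h f z (extChartAt I4 z z) u v = ∑ i, ∑ j, u i * v j *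
    (pd i (pd j (fun y => f ((extChartAt I4 z).symm y))) (extChartAt I4 z z)
      - ∑ k, christoffel h z k i j (extChartAt I4 z z)
          * pd k (fun y => f ((extChartAt I4 z).symm y)) (extChartAt I4 z z)) := by
  have hD := hasFDerivWithinAt_differentialIn hf (mem_extChartAt_source (I := I4) z)
  have e₁ : ∀ i j, pd i (pd j (fun y => f ((extChartAt I4 z).symm y))) (extChartAt I4 z z) =
      fderivWithin ℝ (differentialIn f z) (range I4) (extChartAt I4 z z) (stdVec i) (stdVec j) := by
    intro i j
    have h₁ := hD.clm_apply (hasFDerivWithinAt_const (stdVec j) _ _)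
    have h₂ := h₁.fderivWithin (uniqueDiffWithinAt_range (mem_range_self _))
    unfold pd
    change fderivWithin ℝ (fun y => differentialIn f z y (stdVec j)) _ _ _ = _
    rw [h₂]
    simp
  simp only [e₁, hessianIn]
  conv_lhs => rw [sum_stdVec u, sum_stdVec v]
  simp only [mul_sub, Finset.sum_sub_distrib]
  congr 1
  · simp only [map_sum, map_smul, sum_apply, smul_apply, smul_eq_mul, Finset.mul_sum]
    rw [Finset.sum_comm]
    refine Finset.sum_congr rfl fun i _ => Finset.sum_congr rfl fun j _ => by ring
  · rw [← sum_stdVec, ← sum_stdVec]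
    unfold differentialIn
    rw [fderivWithin_eq_sum_pd]
    simp only [gamma, Finset.mul_sum, Finset.sum_mul]
    rw [← sum_rotate]
    refine Finset.sum_congr rfl fun i _ => Finset.sum_congr rfl fun j _ =>
      Finset.sum_congr rfl fun k _ => ?_
    change _ * pd k (fun y => f ((extChartAt I4 z).symm y)) (extChartAt I4 z z) = _
    ring

end Differential

/-! ### Smoothness of inverse matrices and of Christoffel symbols. -/

section Smoothness

variable {E : Type*} [NormedAddCommGroup E] [NormedSpace ℝ E] {ι : Type*} [Fintype ι]
  [DecidableEq ι] {n : WithTop ℕ∞} {s : Set E} {y : E}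

theorem contDiffWithinAt_det {A : E → Matrix ι ι ℝ}
    (hA : ∀ i j, ContDiffWithinAt ℝ n (fun y => A y i j) s y) :
    ContDiffWithinAt ℝ n (fun y => (A y).det) s y := by
  simp only [Matrix.det_apply]
  refine ContDiffWithinAt.sum fun σ _ => ?_
  simp only [Units.smul_def, zsmul_eq_mul]
  exact contDiffWithinAt_const.mul (contDiffWithinAt_prod fun i _ => hA _ _)

theorem contDiffWithinAt_inv_apply {A : E → Matrix ι ι ℝ}
    (hA : ∀ i j, ContDiffWithinAt ℝ n (fun y => A y i j) s y) (hdet : IsUnit (A y).det) (i j : ι) :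
    ContDiffWithinAt ℝ n (fun y => (A y)⁻¹ i j) s y := by
  simp only [Matrix.inv_def, Ring.inverse_eq_inv', Matrix.smul_apply, smul_eq_mul]
  refine ((contDiffWithinAt_det hA).inv hdet.ne_zero).mul ?_
  simp only [Matrix.adjugate_apply]
  refine contDiffWithinAt_det fun a b => ?_
  simp only [Matrix.updateRow_apply]
  split_ifs
  · exact contDiffWithinAt_const
  · exact hA _ _

end Smoothness

section Smoothness2

variable {M : Type*} [TopologicalSpace M] [ChartedSpace (EuclideanHalfSpace 4) M]
  [IsManifold I4 ∞ M]

theorem contDiffWithinAt_pd {f : E4 → ℝ} {y : E4} (hf : ContDiffWithinAt ℝ ∞ f (range I4) y)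
    (hy : y ∈ range I4) (k : Fin 4) : ContDiffWithinAt ℝ ∞ (pd k f) (range I4) y := by
  unfold pd
  exact (hf.fderivWithin_right (m := ∞) I4.uniqueDiffOn (by simp) hy).clm_apply
    contDiffWithinAt_const

theorem contDiffWithinAt_christoffel {h : BilinField M} {x₀ : M} {y : E4}
    (hm : IsMetricAt h ((extChartAt I4 x₀).symm y)) (hy : y ∈ (extChartAt I4 x₀).target)
    (hs : ∀ i j, ContDiffWithinAt ℝ ∞ (fun y => compMatrix h x₀ y i j) (range I4) y)
    (i j k : Fin 4) : ContDiffWithinAt ℝ ∞ (christoffel h x₀ i j k) (range I4) y := by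
  unfold christoffel
  have hyR := mem_range_of_mem_target hy
  refine contDiffWithinAt_const.mul (ContDiffWithinAt.sum fun l _ => ?_)
  exact (contDiffWithinAt_inv_apply hs (compMatrix_det hm hy) _ _).mul
    (((contDiffWithinAt_pd (hs _ _) hyR _).add (contDiffWithinAt_pd (hs _ _) hyR _)).sub
      (contDiffWithinAt_pd (hs _ _) hyR _))

end Smoothness2

/-! ### Functions, covariant derivatives and metric products along a curve. -/

section Curves

variable {M : Type*} [TopologicalSpace M] [ChartedSpace (EuclideanHalfSpace 4) M]
  [IsManifold I4 ∞ M] {c : ℝ → M} {u : (t : ℝ) → TangentSpace I4 (c t)} {S : Set ℝ}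

theorem HasVelocity.hasDerivWithinAt_fun (hc : HasVelocity c u S) {f : M → ℝ}
    (hf : ContMDiff I4 𝓘(ℝ, ℝ) ∞ f) {t : ℝ} (ht : t ∈ S) :
    HasDerivWithinAt (fun s => f (c s)) (differential f (c t) (u t)) S t := by
  have hx := mem_extChartAt_source (I := I4) (c t)
  have h := hasDerivWithinAt_comp_curve (x := fun s => extChartAt I4 (c t) (c s))
    (hasFDerivWithinAt_funIn hf hx) (hc.hasDerivWithinAt_self ht) (fun s => mem_range_self _)
  refine h.congr_of_eventuallyEq ?_ (by simp only [funIn, (extChartAt I4 (c t)).left_inv hx])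
  filter_upwards [hc.eventually_mem ht hx] with s hs
  simp only [funIn, (extChartAt I4 (c t)).left_inv hs]

/-- The derivative of `df(V)` along a curve, for parallel `V`, is the Hessian. -/
theorem IsParallelAlong.hasDerivWithinAt_differential {h : BilinField M} (hm : IsMetric h)
    (hs : ∀ x₀, SmoothIn h x₀) {V : (t : ℝ) → TangentSpace I4 (c t)} (hc : HasVelocity c u S)
    (hV : IsParallelAlong h c u S V) {f : M → ℝ} (hf : ContMDiff I4 𝓘(ℝ, ℝ) ∞ f) {t : ℝ}
    (ht : t ∈ S) {x₀ : M} (hx : c t ∈ (extChartAt I4 x₀).source) :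
    HasDerivWithinAt (fun s => differential f (c s) (V s))
      (hessianIn h f x₀ (extChartAt I4 x₀ (c t)) (inChart x₀ (c t) (u t)) (inChart x₀ (c t) (V t)))
      S t := by
  have h₁ := hasDerivWithinAt_comp_curve (F := E4 →L[ℝ] ℝ) (x := fun s => extChartAt I4 x₀ (c s))
    (hasFDerivWithinAt_differentialIn hf hx) (hc.hasDerivWithinAt ht hx)
    (fun s => mem_range_self _)
  have h₂ := h₁.clm_apply (hV.hasDerivWithinAt hm hs hc ht hx)
  refine (h₂.congr_of_eventuallyEq ?_ (differential_eq hf hx _)).congr_deriv ?_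
  · filter_upwards [hc.eventually_mem ht hx] with s hs
    exact differential_eq hf hs _
  · rw [hessianIn, map_neg, sub_eq_add_neg]

/-- `V` has covariant derivative `D` at the parameter `t`. -/
def HasCovDeriv (h : BilinField M) (c : ℝ → M) (u : (t : ℝ) → TangentSpace I4 (c t)) (S : Set ℝ)
    (V : (t : ℝ) → TangentSpace I4 (c t)) (t : ℝ) (D : TangentSpace I4 (c t)) : Prop :=
  HasDerivWithinAt (fun s => inChart (c t) (c s) (V s))
    (comps D - gamma h (c t) (extChartAt I4 (c t) (c t)) (comps (u t)) (comps (V t))) S t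

theorem IsParallelAlong.hasCovDeriv {h : BilinField M} {V : (t : ℝ) → TangentSpace I4 (c t)}
    (hV : IsParallelAlong h c u S V) {t : ℝ} (ht : t ∈ S) : HasCovDeriv h c u S V t 0 := by
  have := isParallelAlong_iff_self.1 hV t ht
  unfold HasCovDeriv
  have e : comps (0 : TangentSpace I4 (c t)) = 0 := rfl
  rwa [e, zero_sub]

theorem HasCovDeriv.mono {h : BilinField M} {V : (t : ℝ) → TangentSpace I4 (c t)} {t : ℝ}
    {D : TangentSpace I4 (c t)} {S' : Set ℝ} (hV : HasCovDeriv h c u S V t D) (hS : S' ⊆ S) :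
    HasCovDeriv h c u S' V t D := HasDerivWithinAt.mono hV hS

/-- Metric compatibility: by the Koszul formula the Christoffel terms of the two arguments add up to
the derivative of the metric. Neither field need be parallel, since a `ĝ`-parallel field will be
paired with a `g`-parallel one. -/
theorem HasCovDeriv.hasDerivWithinAt_metric {h : BilinField M} (hm : IsMetric h)
    (hs : ∀ x₀, SmoothIn h x₀) {V W : (t : ℝ) → TangentSpace I4 (c t)} (hc : HasVelocity c u S)
    {t : ℝ} (ht : t ∈ S) {D D' : TangentSpace I4 (c t)} (hV : HasCovDeriv h c u S V t D)
    (hW : HasCovDeriv h c u S W t D') :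
    HasDerivWithinAt (fun s => h (c s) (V s) (W s)) (h (c t) D (W t) + h (c t) (V t) D') S t := by
  have hx := mem_extChartAt_source (I := I4) (c t)
  have hy : extChartAt I4 (c t) (c t) ∈ (extChartAt I4 (c t)).target := mem_extChartAt_target _
  have h₁ := hasDerivWithinAt_bilinear_curve (x := fun s => extChartAt I4 (c t) (c s))
    (hasFDerivWithinAt_metricIn (hs (c t)) hy) (hc.hasDerivWithinAt_self ht)
    (fun s => mem_range_self _) hV hW
  refine (h₁.congr_of_eventuallyEq ?_ (metricIn_inChart h hx _ _).symm).congr_deriv ?_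
  · filter_upwards [hc.eventually_mem ht hx] with s hs
    exact (metricIn_inChart h hs _ _).symm
  · simp only [inChart_self, map_sub, sub_apply]
    rw [metricIn_self, metricIn_self, metricIn_symm hm.symm _ _ (comps (V t)) (gamma _ _ _ _ _),
      metricIn_gamma (hm.at _) hy, metricIn_gamma (hm.at _) hy]
    have hsym : ∀ a b w, metricDeriv h (c t) (extChartAt I4 (c t) (c t)) a b w =
        metricDeriv h (c t) (extChartAt I4 (c t) (c t)) a w b := by
      intro a b w
      rw [metricDeriv_apply, metricDeriv_apply]
      refine Finset.sum_congr rfl fun k _ => ?_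
      rw [Finset.sum_comm]
      refine Finset.sum_congr rfl fun i _ => Finset.sum_congr rfl fun j _ => ?_
      simp only [compMatrix_symm hm.symm _ _ j i]
      ring
    rw [hsym _ (comps (W t)) (comps (V t)), hsym _ (comps (u t)) (comps (V t)),
      hsym _ (comps (u t)) (comps (W t))]
    ring

end Curves

/-! ### The connection of a conformally rescaled metric. -/

section Conformal

variable {M : Type*} [TopologicalSpace M] [ChartedSpace (EuclideanHalfSpace 4) M]
  [IsManifold I4 ∞ M]

theorem compMatrix_rescale (g : BilinField M) (Ω : M → ℝ) (x₀ : M) (y : E4) (i j : Fin 4) :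
    compMatrix (rescale g Ω) x₀ y i j = (funIn Ω x₀ y ^ 2)⁻¹ * compMatrix g x₀ y i j := rfl

theorem IsMetric.rescale {g : BilinField M} (hm : IsMetric g) {Ω : M → ℝ} {x : M} (hx : Ω x ≠ 0) :
    IsMetricAt (rescale g Ω) x := by
  refine ⟨fun z v w => ?_, fun v hv => hm.nondeg x v fun w => ?_⟩
  · simp [Peeling.rescale, hm.symm z v w]
  · simpa [Peeling.rescale, hx] using hv w

theorem metricIn_rescale (g : BilinField M) (Ω : M → ℝ) (x₀ : M) (y v w : E4) :
    metricIn (rescale g Ω) x₀ y v w = (funIn Ω x₀ y ^ 2)⁻¹ * metricIn g x₀ y v w := by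
  simp only [metricIn_apply, compMatrix_rescale, Finset.mul_sum, mul_assoc]

theorem contDiffWithinAt_rescale {g : BilinField M} (hs : ∀ x₀, SmoothIn g x₀) {Ω : M → ℝ}
    (hf : ContMDiff I4 𝓘(ℝ, ℝ) ∞ Ω) {x₀ z : M} (hz : z ∈ (extChartAt I4 x₀).source)
    (hΩ : Ω z ≠ 0) (i j : Fin 4) :
    ContDiffWithinAt ℝ ∞ (fun y => compMatrix (rescale g Ω) x₀ y i j) (range I4)
      (extChartAt I4 x₀ z) := by
  simp only [compMatrix_rescale]
  refine (((contDiffWithinAt_funIn hf hz).pow 2).inv ?_).mul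
    (ContDiffOn.contDiffWithinAt_range (hs x₀ i j) ((extChartAt I4 x₀).map_source hz))
  rw [funIn, (extChartAt I4 x₀).left_inv hz]
  exact pow_ne_zero 2 hΩ

theorem metricDeriv_rescale {g : BilinField M} (hs : ∀ x₀, SmoothIn g x₀) {Ω : M → ℝ}
    (hf : ContMDiff I4 𝓘(ℝ, ℝ) ∞ Ω) {z : M} (hΩ : Ω z ≠ 0) (a v w : E4) :
    metricDeriv (rescale g Ω) z (extChartAt I4 z z) a v w =
      (Ω z ^ 2)⁻¹ * metricDeriv g z (extChartAt I4 z z) a v w -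
      2 * (Ω z ^ 3)⁻¹ * differentialIn Ω z (extChartAt I4 z z) a *
        metricIn g z (extChartAt I4 z z) v w := by
  have hz := mem_extChartAt_source (I := I4) z
  have hfz : funIn Ω z (extChartAt I4 z z) = Ω z := by
    simp only [funIn, (extChartAt I4 z).left_inv hz]
  have e : ∀ i j, fderivWithin ℝ (fun y => compMatrix (rescale g Ω) z y i j) (range I4)
      (extChartAt I4 z z) a = (Ω z ^ 2)⁻¹ *
        fderivWithin ℝ (fun y => compMatrix g z y i j) (range I4) (extChartAt I4 z z) a -
      2 * (Ω z ^ 3)⁻¹ * differentialIn Ω z (extChartAt I4 z z) a *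
        compMatrix g z (extChartAt I4 z z) i j := by
    intro i j
    simp only [compMatrix_rescale]
    have h₁ := hasFDerivWithinAt_funIn hf hz
    have h₂ := ((ContDiffOn.contDiffWithinAt_range (hs z i j)
      ((extChartAt I4 z).map_source hz)).differentiableWithinAt (by simp)).hasFDerivWithinAt
    have hi : HasFDerivWithinAt (fun y => (funIn Ω z y ^ 2)⁻¹)
        ((-(2 * (Ω z ^ 3)⁻¹)) • differentialIn Ω z (extChartAt I4 z z)) (range I4)
        (extChartAt I4 z z) := by
      have hd : HasDerivAt (fun r : ℝ => (r ^ 2)⁻¹) (-(2 * (Ω z ^ 3)⁻¹))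
          (funIn Ω z (extChartAt I4 z z)) := by
        rw [hfz]
        refine ((hasDerivAt_pow 2 (Ω z)).fun_inv (pow_ne_zero 2 hΩ)).congr_deriv ?_
        field_simp
        norm_num
        ring
      exact hd.comp_hasFDerivWithinAt _ h₁
    rw [(hi.fun_mul h₂).fderivWithin (uniqueDiffWithinAt_range (mem_range_self _)), hfz]
    simp only [add_apply, smul_apply, smul_eq_mul]
    ring
  simp only [metricDeriv, sum_apply, ContinuousLinearMap.smulRight_apply, smul_apply, smul_eq_mul,
    e, metricIn_apply, Finset.mul_sum, PiLp.proj_apply, ← Finset.sum_sub_distrib]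
  refine Finset.sum_congr rfl fun i _ => Finset.sum_congr rfl fun j _ => by ring

/-- The Levi-Civita connection of a conformally rescaled metric. -/
theorem gamma_rescale {g : BilinField M} (hm : IsMetric g) (hs : ∀ x₀, SmoothIn g x₀) {Ω : M → ℝ}
    (hf : ContMDiff I4 𝓘(ℝ, ℝ) ∞ Ω) {z : M} (hΩ : Ω z ≠ 0) (u v N : TangentSpace I4 z)
    (hN : ∀ w, g z N w = differential Ω z w) :
    gamma (rescale g Ω) z (extChartAt I4 z z) (comps u) (comps v) =
      gamma g z (extChartAt I4 z z) (comps u) (comps v) -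
      comps ((Ω z)⁻¹ • (differential Ω z u • v + differential Ω z v • u - g z u v • N)) := by
  have hz := mem_extChartAt_source (I := I4) z
  have hy := (extChartAt I4 z).map_source hz
  have hfz : funIn Ω z (extChartAt I4 z z) = Ω z := by
    simp only [funIn, (extChartAt I4 z).left_inv hz]
  have hz' := (extChartAt I4 z).left_inv hz
  rw [← sub_eq_zero]
  -- Both sides are compared through their `g`-products with `w`, which the Koszul formulas of the
  -- two metrics supply.
  refine metricIn_nondeg (hm.at _) hy fun w => ?_
  obtain ⟨w, rfl⟩ : ∃ w' : TangentSpace I4 z, comps w' = w := ⟨w, rfl⟩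
  have h₁ := metricIn_gamma (h := rescale g Ω) (by rw [hz']; exact hm.rescale hΩ) hy (comps u)
    (comps v) (comps w)
  have h₂ := metricIn_gamma (hm.at _) hy (comps u) (comps v) (comps w)
  rw [metricIn_rescale, metricDeriv_rescale hs hf hΩ, metricDeriv_rescale hs hf hΩ,
    metricDeriv_rescale hs hf hΩ, hfz] at h₁
  have hd : ∀ v, differentialIn Ω z (extChartAt I4 z z) (comps v) = differential Ω z v :=
    fun v => rfl
  simp only [hd, metricIn_self] at h₁ h₂
  simp only [map_sub, sub_apply, h₂, metricIn_self, map_smul, map_add, LinearMap.smul_apply,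
    LinearMap.add_apply, LinearMap.sub_apply, smul_eq_mul, hN]
  field_simp at h₁
  field_simp
  linarith

end Conformal

/-! ### Symmetries of the Riemann, Ricci and Weyl tensors. -/

section Curvature

variable {M : Type*} [TopologicalSpace M] [ChartedSpace (EuclideanHalfSpace 4) M]
  [IsManifold I4 ∞ M] {h : BilinField M} {x₀ : M} {y : E4}

theorem pd_congr {f f' : E4 → ℝ} (hf : f =ᶠ[𝓝[range I4] y] f') (hy : y ∈ range I4) (k : Fin 4) :
    pd k f y = pd k f' y := by
  unfold pd
  rw [hf.fderivWithin_eq (hf.self_of_nhdsWithin hy)]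

theorem pd_sum_mul {ι : Type*} [Fintype ι] {f f' : ι → E4 → ℝ} (hy : y ∈ range I4)
    (hf : ∀ i, ContDiffWithinAt ℝ ∞ (f i) (range I4) y)
    (hf' : ∀ i, ContDiffWithinAt ℝ ∞ (f' i) (range I4) y) (k : Fin 4) :
    pd k (fun z => ∑ i, f i z * f' i z) y = ∑ i, (pd k (f i) y * f' i y + f i y * pd k (f' i) y) := by
  have h₁ : ∀ i, HasFDerivWithinAt (f i) (fderivWithin ℝ (f i) (range I4) y) (range I4) y :=
    fun i => ((hf i).differentiableWithinAt (by simp)).hasFDerivWithinAt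
  have h₂ : ∀ i, HasFDerivWithinAt (f' i) (fderivWithin ℝ (f' i) (range I4) y) (range I4) y :=
    fun i => ((hf' i).differentiableWithinAt (by simp)).hasFDerivWithinAt
  have h₃ := (HasFDerivWithinAt.fun_sum fun i (_ : i ∈ Finset.univ) =>
    (h₁ i).fun_mul (h₂ i)).fderivWithin (uniqueDiffWithinAt_range hy)
  unfold pd
  rw [h₃]
  simp only [sum_apply, add_apply, smul_apply, smul_eq_mul]
  exact Finset.sum_congr rfl fun i _ => by ring

theorem pd_comm {f : E4 → ℝ} (hf : ContDiffWithinAt ℝ ∞ f (range I4) y) (hy : y ∈ range I4)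
    (i j : Fin 4) : pd i (pd j f) y = pd j (pd i f) y := by
  have hD := hasFDerivWithinAt_fderivWithin hf hy
  have e : ∀ i j, pd i (pd j f) y =
      fderivWithin ℝ (fderivWithin ℝ f (range I4)) (range I4) y (stdVec i) (stdVec j) := by
    intro i j
    have h₂ := (hD.clm_apply (hasFDerivWithinAt_const (stdVec j) _ _)).fderivWithin
      (uniqueDiffWithinAt_range hy)
    unfold pd
    rw [h₂]
    simp
  rw [e, e]
  exact isSymmSndFDerivWithinAt_range hf hy _ _

/-- Near `y`, the components of `h` are those of a smooth metric. -/
structure IsMetricNear (h : BilinField M) (x₀ : M) (y : E4) : Prop where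
  mem : y ∈ (extChartAt I4 x₀).target
  symm : ∀ x v w, h x v w = h x w v
  smooth : ∀ i j, ContDiffWithinAt ℝ ∞ (fun y => compMatrix h x₀ y i j) (range I4) y
  metric : ∀ᶠ z in 𝓝[range I4] y, IsMetricAt h ((extChartAt I4 x₀).symm z)

namespace IsMetricNear

theorem mem_range (H : IsMetricNear h x₀ y) : y ∈ range I4 := mem_range_of_mem_target H.mem

theorem metricAt (H : IsMetricNear h x₀ y) : IsMetricAt h ((extChartAt I4 x₀).symm y) :=
  H.metric.self_of_nhdsWithin H.mem_range

theorem contDiff_christoffel (H : IsMetricNear h x₀ y) (i j k : Fin 4) :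
    ContDiffWithinAt ℝ ∞ (christoffel h x₀ i j k) (range I4) y :=
  contDiffWithinAt_christoffel H.metricAt H.mem H.smooth i j k

theorem pd_compMatrix (H : IsMetricNear h x₀ y) (a m i : Fin 4) :
    pd a (fun z => compMatrix h x₀ z m i) y =
      christoffelFirst h x₀ m a i y + christoffelFirst h x₀ i a m y := by
  simp only [christoffelFirst, compMatrix_symm H.symm x₀ _ i m, compMatrix_symm H.symm x₀ _ i a,
    compMatrix_symm H.symm x₀ _ m a]
  ring

theorem christoffelFirst_comm (H : IsMetricNear h x₀ y) (m a i : Fin 4) :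
    christoffelFirst h x₀ m a i y = christoffelFirst h x₀ m i a y := by
  simp only [christoffelFirst, compMatrix_symm H.symm x₀ _ i a]
  ring

theorem inv_symm (H : IsMetricNear h x₀ y) (i j : Fin 4) :
    (compMatrix h x₀ y)⁻¹ i j = (compMatrix h x₀ y)⁻¹ j i := by
  have : (compMatrix h x₀ y).transpose = compMatrix h x₀ y := by
    ext i j
    exact compMatrix_symm H.symm x₀ y j i
  conv_rhs => rw [← this, ← Matrix.transpose_nonsing_inv, Matrix.transpose_apply]

/-- Differentiating the lowered identity `compMatrix_mul_christoffel` moves the index lowering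
through the derivative, without ever differentiating the inverse matrix. -/
theorem pd_christoffelFirst (H : IsMetricNear h x₀ y) (a m j k : Fin 4) :
    ∑ i, compMatrix h x₀ y m i * pd a (christoffel h x₀ i j k) y =
      pd a (christoffelFirst h x₀ m j k) y - ∑ i, christoffel h x₀ i j k y *
        (christoffelFirst h x₀ m a i y + christoffelFirst h x₀ i a m y) := by
  have hev : (fun z => ∑ i, compMatrix h x₀ z m i * christoffel h x₀ i j k z)
      =ᶠ[𝓝[range I4] y] christoffelFirst h x₀ m j k := by
    filter_upwards [H.metric, extChartAt_target_mem_nhdsWithin_of_mem H.mem] with z hz hz'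
    exact compMatrix_mul_christoffel hz hz' m j k
  rw [← pd_congr hev H.mem_range, pd_sum_mul H.mem_range (fun i => H.smooth m i)
    (fun i => H.contDiff_christoffel i j k), ← Finset.sum_sub_distrib]
  refine Finset.sum_congr rfl fun i _ => ?_
  rw [H.pd_compMatrix]
  ring

theorem pd_christoffelFirst_eq (H : IsMetricNear h x₀ y) (a l j k : Fin 4) :
    pd a (christoffelFirst h x₀ l j k) y = 1 / 2 *
      (pd a (pd j (fun z => compMatrix h x₀ z l k)) y
        + pd a (pd k (fun z => compMatrix h x₀ z l j)) y
        - pd a (pd l (fun z => compMatrix h x₀ z j k)) y) := by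
  have hd : ∀ a i j, HasFDerivWithinAt (pd a (fun z => compMatrix h x₀ z i j))
      (fderivWithin ℝ (pd a (fun z => compMatrix h x₀ z i j)) (range I4) y) (range I4) y :=
    fun a i j => ((contDiffWithinAt_pd (H.smooth i j) H.mem_range a).differentiableWithinAt
      (by simp)).hasFDerivWithinAt
  have h₁ := ((((hd j l k).fun_add (hd k l j)).fun_sub (hd l j k)).const_mul (1 / 2)).fderivWithin
    (uniqueDiffWithinAt_range H.mem_range)
  unfold christoffelFirst
  conv_lhs => rw [pd]
  rw [h₁]
  simp [pd]

/-- The quadratic part of the lowered Riemann tensor. -/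
def quad (h : BilinField M) (x₀ : M) (y : E4) (i k j l : Fin 4) : ℝ :=
  ∑ m, christoffel h x₀ m i k y * christoffelFirst h x₀ m j l y

theorem christoffel_eq (h : BilinField M) (x₀ : M) (y : E4) (i j k : Fin 4) :
    christoffel h x₀ i j k y = ∑ l, (compMatrix h x₀ y)⁻¹ i l * christoffelFirst h x₀ l j k y := by
  simp only [christoffel, christoffelFirst, Finset.mul_sum]
  exact Finset.sum_congr rfl fun l _ => by ring

theorem quad_comm (H : IsMetricNear h x₀ y) (i k j l : Fin 4) :
    quad h x₀ y i k j l = quad h x₀ y j l i k := by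
  simp only [quad, christoffel_eq, Finset.sum_mul]
  rw [Finset.sum_comm]
  refine Finset.sum_congr rfl fun m _ => Finset.sum_congr rfl fun n _ => ?_
  rw [H.inv_symm]
  ring

theorem quad_swap_left (H : IsMetricNear h x₀ y) (i k j l : Fin 4) :
    quad h x₀ y i k j l = quad h x₀ y k i j l := by
  simp only [quad, christoffel_eq, H.christoffelFirst_comm _ i k]

/-- The Riemann tensor with all indices down. -/
def riemannLow (h : BilinField M) (x₀ : M) (y : E4) (i j k l : Fin 4) : ℝ :=
  ∑ m, riemann h x₀ i j k m y * compMatrix h x₀ y m l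

/-- The classical form with second derivatives of the metric, in which the exchange of index pairs
can be read off from `pd_comm` and the symmetries of `quad`. -/
theorem riemannLow_eq (H : IsMetricNear h x₀ y) (i j k l : Fin 4) :
    riemannLow h x₀ y i j k l = 1 / 2 *
      (pd j (pd k (fun z => compMatrix h x₀ z l i)) y
        - pd j (pd l (fun z => compMatrix h x₀ z i k)) y
        - pd i (pd k (fun z => compMatrix h x₀ z l j)) y
        + pd i (pd l (fun z => compMatrix h x₀ z j k)) y)
      - quad h x₀ y i k j l + quad h x₀ y j k i l := by
  have e₁ := H.pd_christoffelFirst j l i k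
  have e₂ := H.pd_christoffelFirst i l j k
  have e₃ : ∀ i j k, ∑ a, ∑ m, compMatrix h x₀ y l a *
      (christoffel h x₀ m i k y * christoffel h x₀ a j m y) =
      ∑ m, christoffel h x₀ m i k y * christoffelFirst h x₀ l j m y := by
    intro i j k
    rw [Finset.sum_comm]
    refine Finset.sum_congr rfl fun m _ => ?_
    rw [← compMatrix_mul_christoffel H.metricAt H.mem, Finset.mul_sum]
    exact Finset.sum_congr rfl fun a _ => by ring
  have e₄ : riemannLow h x₀ y i j k l =
      ∑ a, compMatrix h x₀ y l a * pd j (christoffel h x₀ a i k) y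
      - ∑ a, compMatrix h x₀ y l a * pd i (christoffel h x₀ a j k) y
      + (∑ a, ∑ m, compMatrix h x₀ y l a *
          (christoffel h x₀ m i k y * christoffel h x₀ a j m y)
        - ∑ a, ∑ m, compMatrix h x₀ y l a *
          (christoffel h x₀ m j k y * christoffel h x₀ a i m y)) := by
    simp only [← Finset.sum_sub_distrib, ← Finset.sum_add_distrib, ← Finset.mul_sum, riemannLow]
    refine Finset.sum_congr rfl fun a _ => ?_
    rw [riemann, compMatrix_symm H.symm x₀ y a l, Finset.sum_sub_distrib]
    ring
  rw [e₄, e₃, e₃, e₁, e₂, H.pd_christoffelFirst_eq, H.pd_christoffelFirst_eq]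
  simp only [mul_add, Finset.sum_add_distrib]
  rw [pd_comm (H.smooth l k) H.mem_range j i]
  simp only [quad]
  ring

theorem riemannLow_pair (H : IsMetricNear h x₀ y) (i j k l : Fin 4) :
    riemannLow h x₀ y i j k l = riemannLow h x₀ y k l i j := by
  rw [H.riemannLow_eq, H.riemannLow_eq, H.quad_swap_left k i l j, H.quad_comm l i k j,
    H.quad_swap_left k j l i]
  have hq : quad h x₀ y i k l j = quad h x₀ y i k j l := by
    simp only [quad, H.christoffelFirst_comm _ l j]
  have hq' : quad h x₀ y j k l i = quad h x₀ y j k i l := by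
    simp only [quad, H.christoffelFirst_comm _ l i]
  rw [hq, hq', pd_comm (H.smooth l i) H.mem_range j k, pd_comm (H.smooth i k) H.mem_range j l,
    pd_comm (H.smooth l j) H.mem_range i k, pd_comm (H.smooth j k) H.mem_range i l]
  simp only [compMatrix_symm H.symm x₀ _ k i, compMatrix_symm H.symm x₀ _ j l]
  ring

theorem riemannLow_swap_left (h : BilinField M) (x₀ : M) (y : E4) (i j k l : Fin 4) :
    riemannLow h x₀ y i j k l = -riemannLow h x₀ y j i k l := by
  simp only [riemannLow, ← Finset.sum_neg_distrib]
  refine Finset.sum_congr rfl fun m _ => ?_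
  simp only [riemann, Finset.sum_sub_distrib]
  ring

theorem ricci_eq (H : IsMetricNear h x₀ y) (i k : Fin 4) :
    ricci h x₀ i k y = ∑ j, ∑ l, (compMatrix h x₀ y)⁻¹ j l * riemannLow h x₀ y i j k l := by
  unfold ricci
  refine Finset.sum_congr rfl fun j _ => ?_
  simp only [riemannLow, Finset.mul_sum]
  rw [Finset.sum_comm]
  have : ∀ m, ∑ l, (compMatrix h x₀ y)⁻¹ j l * (riemann h x₀ i j k m y * compMatrix h x₀ y m l) =
      if m = j then riemann h x₀ i j k m y else 0 := by
    intro m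
    rw [← boole_mul, ← compMatrix_mul_inv H.metricAt H.mem, Finset.sum_mul]
    refine Finset.sum_congr rfl fun l _ => ?_
    rw [H.inv_symm j l]
    ring
  simp [this]

theorem ricci_symm (H : IsMetricNear h x₀ y) (i k : Fin 4) :
    ricci h x₀ i k y = ricci h x₀ k i y := by
  rw [H.ricci_eq, H.ricci_eq, Finset.sum_comm]
  refine Finset.sum_congr rfl fun j _ => Finset.sum_congr rfl fun l _ => ?_
  rw [H.inv_symm l j, H.riemannLow_pair]

theorem weylComps_eq (h : BilinField M) (x₀ : M) (y : E4) (i j k l : Fin 4) :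
    weylComps h x₀ y i j k l = riemannLow h x₀ y i j k l
    - (1 / 2) * (compMatrix h x₀ y i k * ricci h x₀ l j y
        - compMatrix h x₀ y i l * ricci h x₀ k j y
        - compMatrix h x₀ y j k * ricci h x₀ l i y
        + compMatrix h x₀ y j l * ricci h x₀ k i y)
    + (1 / 6) * scalarCurv h x₀ y * (compMatrix h x₀ y i k * compMatrix h x₀ y l j
        - compMatrix h x₀ y i l * compMatrix h x₀ y k j) := rfl

theorem weylComps_swap_left (H : IsMetricNear h x₀ y) (i j k l : Fin 4) :
    weylComps h x₀ y i j k l = -weylComps h x₀ y j i k l := by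
  rw [weylComps_eq, weylComps_eq, riemannLow_swap_left, compMatrix_symm H.symm x₀ y l j,
    compMatrix_symm H.symm x₀ y k j, compMatrix_symm H.symm x₀ y l i,
    compMatrix_symm H.symm x₀ y k i]
  ring

theorem weylComps_pair (H : IsMetricNear h x₀ y) (i j k l : Fin 4) :
    weylComps h x₀ y i j k l = weylComps h x₀ y k l i j := by
  rw [weylComps_eq, weylComps_eq, H.riemannLow_pair, compMatrix_symm H.symm x₀ y k i,
    compMatrix_symm H.symm x₀ y k j, compMatrix_symm H.symm x₀ y l i,
    compMatrix_symm H.symm x₀ y l j, H.ricci_symm l j, H.ricci_symm k j, H.ricci_symm l i,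
    H.ricci_symm k i]
  ring

/-- The dimension enters through `t₄`: a metric trace equal to 4 is what makes the coefficients `1 /
2` and `1 / 6` cancel the Ricci tensor and the scalar curvature. -/
theorem weylComps_trace (H : IsMetricNear h x₀ y) (i k : Fin 4) :
    ∑ j, ∑ l, (compMatrix h x₀ y)⁻¹ j l * weylComps h x₀ y i j k l = 0 := by
  have hGH : ∀ m n, ∑ l, compMatrix h x₀ y m l * (compMatrix h x₀ y)⁻¹ l n =
      if m = n then 1 else 0 := compMatrix_mul_inv H.metricAt H.mem
  have hHG : ∀ m n, ∑ l, (compMatrix h x₀ y)⁻¹ n l * compMatrix h x₀ y m l =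
      if m = n then 1 else 0 := by
    intro m n
    rw [← hGH]
    exact Finset.sum_congr rfl fun l _ => by rw [H.inv_symm n l]; ring
  have t₁ : ∑ j, ∑ l, (compMatrix h x₀ y)⁻¹ j l * ricci h x₀ l j y = scalarCurv h x₀ y := by
    unfold scalarCurv
    refine Finset.sum_congr rfl fun j _ => Finset.sum_congr rfl fun l _ => ?_
    rw [H.ricci_symm]
  have t₂ : ∑ j, ∑ l, (compMatrix h x₀ y)⁻¹ j l *
      (compMatrix h x₀ y i l * ricci h x₀ k j y) = ricci h x₀ k i y := by
    have : ∀ j, ∑ l, (compMatrix h x₀ y)⁻¹ j l * (compMatrix h x₀ y i l * ricci h x₀ k j y) =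
        if i = j then ricci h x₀ k j y else 0 := by
      intro j
      rw [← boole_mul, ← hHG, Finset.sum_mul]
      exact Finset.sum_congr rfl fun l _ => by ring
    simp [this]
  have t₃ : ∑ j, ∑ l, (compMatrix h x₀ y)⁻¹ j l *
      (compMatrix h x₀ y j k * ricci h x₀ l i y) = ricci h x₀ k i y := by
    rw [Finset.sum_comm]
    have : ∀ l, ∑ j, (compMatrix h x₀ y)⁻¹ j l * (compMatrix h x₀ y j k * ricci h x₀ l i y) =
        if k = l then ricci h x₀ l i y else 0 := by
      intro l
      rw [← boole_mul, ← hHG, Finset.sum_mul]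
      refine Finset.sum_congr rfl fun j _ => ?_
      rw [H.inv_symm j l, compMatrix_symm H.symm x₀ y j k]
      ring
    simp [this]
  have t₄ : ∑ j, ∑ l, (compMatrix h x₀ y)⁻¹ j l * compMatrix h x₀ y j l = 4 := by
    simp [hHG]
  have t₅ : ∑ j, ∑ l, (compMatrix h x₀ y)⁻¹ j l *
      (compMatrix h x₀ y i l * compMatrix h x₀ y k j) = compMatrix h x₀ y k i := by
    have : ∀ j, ∑ l, (compMatrix h x₀ y)⁻¹ j l * (compMatrix h x₀ y i l * compMatrix h x₀ y k j) =
        if i = j then compMatrix h x₀ y k j else 0 := by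
      intro j
      rw [← boole_mul, ← hHG, Finset.sum_mul]
      exact Finset.sum_congr rfl fun l _ => by ring
    simp [this]
  have e : ∑ j, ∑ l, (compMatrix h x₀ y)⁻¹ j l * weylComps h x₀ y i j k l =
      ∑ j, ∑ l, (compMatrix h x₀ y)⁻¹ j l * riemannLow h x₀ y i j k l
      - 1 / 2 * (compMatrix h x₀ y i k *
          ∑ j, ∑ l, (compMatrix h x₀ y)⁻¹ j l * ricci h x₀ l j y
        - ∑ j, ∑ l, (compMatrix h x₀ y)⁻¹ j l * (compMatrix h x₀ y i l * ricci h x₀ k j y)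
        - ∑ j, ∑ l, (compMatrix h x₀ y)⁻¹ j l * (compMatrix h x₀ y j k * ricci h x₀ l i y)
        + ricci h x₀ k i y * ∑ j, ∑ l, (compMatrix h x₀ y)⁻¹ j l * compMatrix h x₀ y j l)
      + 1 / 6 * scalarCurv h x₀ y * (compMatrix h x₀ y i k *
          ∑ j, ∑ l, (compMatrix h x₀ y)⁻¹ j l * compMatrix h x₀ y j l
        - ∑ j, ∑ l, (compMatrix h x₀ y)⁻¹ j l *
          (compMatrix h x₀ y i l * compMatrix h x₀ y k j)) := by
    simp only [Finset.mul_sum, ← Finset.sum_add_distrib, ← Finset.sum_sub_distrib]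
    refine Finset.sum_congr rfl fun j _ => Finset.sum_congr rfl fun l _ => ?_
    rw [weylComps_eq, compMatrix_symm H.symm x₀ y l j]
    ring
  rw [e, ← H.ricci_eq, t₁, t₂, t₃, t₄, t₅, H.ricci_symm k i, compMatrix_symm H.symm x₀ y k i]
  ring

end IsMetricNear

end Curvature

/-! ### Rank-four tensors, contractions in a frame, and Weyl symmetries. -/

section Tensors

variable {M : Type*} [TopologicalSpace M] [ChartedSpace (EuclideanHalfSpace 4) M]
  [IsManifold I4 ∞ M] {x : M}

theorem update_vec {α : Type*} (a b c e v : α) :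
    Function.update ![a, b, c, e] 0 v = ![v, b, c, e] ∧
    Function.update ![a, b, c, e] 1 v = ![a, v, c, e] ∧
    Function.update ![a, b, c, e] 2 v = ![a, b, v, e] ∧
    Function.update ![a, b, c, e] 3 v = ![a, b, c, v] := by
  refine ⟨?_, ?_, ?_, ?_⟩ <;> (ext j; fin_cases j <;> rfl)

/-- A rank-four tensor as a linear map of its first argument. -/
def slot₀ (W : Tensor4 x) (b c e : TangentSpace I4 x) : TangentSpace I4 x →ₗ[ℝ] ℝ where
  toFun v := W ![v, b, c, e]
  map_add' v w := by
    have := W.map_update_add ![v, b, c, e] 0 v w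
    simpa only [(update_vec _ _ _ _ _).1] using this
  map_smul' r v := by
    have := W.map_update_smul ![v, b, c, e] 0 r v
    simpa only [(update_vec _ _ _ _ _).1, RingHom.id_apply] using this

/-- A rank-four tensor as a linear map of its second argument. -/
def slot₁ (W : Tensor4 x) (a c e : TangentSpace I4 x) : TangentSpace I4 x →ₗ[ℝ] ℝ where
  toFun v := W ![a, v, c, e]
  map_add' v w := by
    have := W.map_update_add ![a, v, c, e] 1 v w
    simpa only [(update_vec _ _ _ _ _).2.1] using this
  map_smul' r v := by
    have := W.map_update_smul ![a, v, c, e] 1 r v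
    simpa only [(update_vec _ _ _ _ _).2.1, RingHom.id_apply] using this

/-- A rank-four tensor as a linear map of its third argument. -/
def slot₂ (W : Tensor4 x) (a b e : TangentSpace I4 x) : TangentSpace I4 x →ₗ[ℝ] ℝ where
  toFun v := W ![a, b, v, e]
  map_add' v w := by
    have := W.map_update_add ![a, b, v, e] 2 v w
    simpa only [(update_vec _ _ _ _ _).2.2.1] using this
  map_smul' r v := by
    have := W.map_update_smul ![a, b, v, e] 2 r v
    simpa only [(update_vec _ _ _ _ _).2.2.1, RingHom.id_apply] using this

/-- A rank-four tensor as a linear map of its fourth argument. -/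
def slot₃ (W : Tensor4 x) (a b c : TangentSpace I4 x) : TangentSpace I4 x →ₗ[ℝ] ℝ where
  toFun v := W ![a, b, c, v]
  map_add' v w := by
    have := W.map_update_add ![a, b, c, v] 3 v w
    simpa only [(update_vec _ _ _ _ _).2.2.2] using this
  map_smul' r v := by
    have := W.map_update_smul ![a, b, c, v] 3 r v
    simpa only [(update_vec _ _ _ _ _).2.2.2, RingHom.id_apply] using this

theorem tensor_linear (W : Tensor4 x) :
    (∀ v w b c e, W ![v + w, b, c, e] = W ![v, b, c, e] + W ![w, b, c, e]) ∧
    (∀ a v w c e, W ![a, v + w, c, e] = W ![a, v, c, e] + W ![a, w, c, e]) ∧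
    (∀ a b v w e, W ![a, b, v + w, e] = W ![a, b, v, e] + W ![a, b, w, e]) ∧
    (∀ a b c v w, W ![a, b, c, v + w] = W ![a, b, c, v] + W ![a, b, c, w]) ∧
    (∀ (r : ℝ) v b c e, W ![r • v, b, c, e] = r * W ![v, b, c, e]) ∧
    (∀ (r : ℝ) a v c e, W ![a, r • v, c, e] = r * W ![a, v, c, e]) ∧
    (∀ (r : ℝ) a b v e, W ![a, b, r • v, e] = r * W ![a, b, v, e]) ∧
    (∀ (r : ℝ) a b c v, W ![a, b, c, r • v] = r * W ![a, b, c, v]) :=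
  ⟨fun v w b c e => (slot₀ W b c e).map_add v w, fun a v w c e => (slot₁ W a c e).map_add v w,
    fun a b v w e => (slot₂ W a b e).map_add v w, fun a b c v w => (slot₃ W a b c).map_add v w,
    fun r v b c e => (slot₀ W b c e).map_smul r v, fun r a v c e => (slot₁ W a c e).map_smul r v,
    fun r a b v e => (slot₂ W a b e).map_smul r v, fun r a b c v => (slot₃ W a b c).map_smul r v⟩

/-- The bilinear form obtained from a rank-four tensor by fixing the first and third arguments. -/
def slots₁₃ (W : Tensor4 x) (a c : TangentSpace I4 x) : LinearMap.BilinForm ℝ (TangentSpace I4 x) :=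
  LinearMap.mk₂ ℝ (fun v w => W ![a, v, c, w])
    (fun v v' w => (slot₁ W a c w).map_add v v') (fun r v w => (slot₁ W a c w).map_smul r v)
    (fun v w w' => (slot₃ W a v c).map_add w w') (fun r v w => (slot₃ W a v c).map_smul r w)

theorem slots₁₃_apply (W : Tensor4 x) (a c v w : TangentSpace I4 x) :
    slots₁₃ W a c v w = W ![a, v, c, w] := rfl

/-- The coordinate vectors of the preferred chart at `x`. -/
def basisVec (x : M) (i : Fin 4) : TangentSpace I4 x := ofComps x (Pi.single i 1)

theorem comps_basisVec (x : M) (i : Fin 4) : comps (basisVec x i) = stdVec i := rfl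

theorem sum_basisVec (v : TangentSpace I4 x) : v = ∑ i, comps v i • basisVec x i :=
  sum_stdVec v

theorem bilin_eq_sum (B : LinearMap.BilinForm ℝ (TangentSpace I4 x)) (v w : TangentSpace I4 x) :
    B v w = ∑ i, ∑ j, comps v i * comps w j * B (basisVec x i) (basisVec x j) := by
  conv_lhs => rw [sum_basisVec v, sum_basisVec w]
  simp only [map_sum, map_smul, LinearMap.sum_apply, LinearMap.smul_apply, smul_eq_mul,
    Finset.mul_sum]
  rw [Finset.sum_comm]
  refine Finset.sum_congr rfl fun i _ => Finset.sum_congr rfl fun j _ => by ring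

theorem apply_basisVec (h : BilinField M) (x : M) (i j : Fin 4) :
    h x (basisVec x i) (basisVec x j) = compMatrix h x (extChartAt I4 x x) i j := by
  rw [← metricIn_self, comps_basisVec, comps_basisVec, metricIn_stdVec]

/-- A contraction with the inverse metric, computed in a frame. -/
theorem contraction_eq (h : BilinField M) (x : M) (f : Fin 4 → TangentSpace I4 x)
    (Θ : Matrix (Fin 4) (Fin 4) ℝ)
    (hΘ : Θ * Matrix.of (fun a b => h x (f a) (f b)) = 1)
    (B : LinearMap.BilinForm ℝ (TangentSpace I4 x)) :
    ∑ i, ∑ j, (compMatrix h x (extChartAt I4 x x))⁻¹ i j * B (basisVec x i) (basisVec x j) =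
      ∑ a, ∑ b, Θ a b * B (f a) (f b) := by
  set G := compMatrix h x (extChartAt I4 x x) with hG
  let F : Matrix (Fin 4) (Fin 4) ℝ := Matrix.of fun a i => comps (f a) i
  have hgram : ∀ B : LinearMap.BilinForm ℝ (TangentSpace I4 x),
      Matrix.of (fun a b => B (f a) (f b)) =
        F * Matrix.of (fun i j => B (basisVec x i) (basisVec x j)) * F.transpose := by
    intro B
    ext a b
    simp only [Matrix.of_apply, Matrix.mul_apply, Matrix.transpose_apply, F, Finset.sum_mul]
    rw [bilin_eq_sum B (f a) (f b), Finset.sum_comm]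
    refine Finset.sum_congr rfl fun i _ => Finset.sum_congr rfl fun j _ => by ring
  have hGB : Matrix.of (fun i j => h x (basisVec x i) (basisVec x j)) = G := by
    ext i j
    exact apply_basisVec h x i j
  rw [hgram (h x), hGB] at hΘ
  -- The hypothesis now reads `Θ F G Fᵀ = 1`; for square matrices the last factor may be moved to
  -- the front, which exhibits `Fᵀ Θ F` as the inverse of `G`.
  have h₁ : F.transpose * (Θ * F * G) = 1 := by
    rw [mul_eq_one_comm, ← hΘ]
    simp only [Matrix.mul_assoc]
  have h₂ : G⁻¹ = F.transpose * Θ * F := by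
    refine Matrix.inv_eq_left_inv ?_
    rw [← h₁]
    simp only [Matrix.mul_assoc]
  have h₃ : ∀ a b, B (f a) (f b) =
      ∑ i, ∑ j, comps (f a) i * comps (f b) j * B (basisVec x i) (basisVec x j) :=
    fun a b => bilin_eq_sum B _ _
  have h₄ : ∀ i j, G⁻¹ i j = ∑ a, ∑ b, comps (f a) i * Θ a b * comps (f b) j := by
    intro i j
    rw [h₂]
    simp only [Matrix.mul_apply, Matrix.transpose_apply, F, Matrix.of_apply, Finset.sum_mul]
    rw [Finset.sum_comm]
  simp only [h₃, h₄, Finset.mul_sum, Finset.sum_mul]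
  have e₁ : ∀ T : Fin 4 → Fin 4 → Fin 4 → Fin 4 → ℝ,
      ∑ i, ∑ j, ∑ a, ∑ b, T i j a b = ∑ a, ∑ b, ∑ i, ∑ j, T i j a b := by
    intro T
    calc _ = ∑ i, ∑ a, ∑ b, ∑ j, T i j a b := by
          refine Finset.sum_congr rfl fun i _ => ?_
          rw [Finset.sum_comm]
          exact Finset.sum_congr rfl fun a _ => Finset.sum_comm
      _ = _ := by
          rw [Finset.sum_comm]
          exact Finset.sum_congr rfl fun a _ => Finset.sum_comm
  rw [e₁]
  refine Finset.sum_congr rfl fun a _ => Finset.sum_congr rfl fun b _ =>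
    Finset.sum_congr rfl fun i _ => Finset.sum_congr rfl fun j _ => by ring

/-- The Gram matrix of a null frame `(ℓ, e₁, e₂, k)`. -/
def nullGram : Matrix (Fin 4) (Fin 4) ℝ :=
  !![0, 0, 0, -1; 0, 1, 0, 0; 0, 0, 1, 0; -1, 0, 0, 0]

theorem nullGram_mul_self : nullGram * nullGram = 1 := by
  ext i j
  fin_cases i <;> fin_cases j <;> simp [nullGram, Matrix.mul_apply, Fin.sum_univ_four]

/-- A null frame `(ℓ, e₁, e₂, k)`. -/
def IsNullFrame (b : LinearMap.BilinForm ℝ (TangentSpace I4 x)) (f : Fin 4 → TangentSpace I4 x) :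
    Prop := ∀ i j, b (f i) (f j) = nullGram i j

theorem sum_nullGram (B : Fin 4 → Fin 4 → ℝ) :
    ∑ a, ∑ b, nullGram a b * B a b = B 1 1 + B 2 2 - B 0 3 - B 3 0 := by
  simp [nullGram, Fin.sum_univ_four]
  ring

theorem contraction_nullFrame (h : BilinField M) {f : Fin 4 → TangentSpace I4 x}
    (hf : IsNullFrame (h x) f) (B : LinearMap.BilinForm ℝ (TangentSpace I4 x)) :
    ∑ i, ∑ j, (compMatrix h x (extChartAt I4 x x))⁻¹ i j * B (basisVec x i) (basisVec x j) =
      B (f 1) (f 1) + B (f 2) (f 2) - B (f 0) (f 3) - B (f 3) (f 0) := by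
  rw [contraction_eq h x f nullGram, sum_nullGram fun a b => B (f a) (f b)]
  have : Matrix.of (fun a b => h x (f a) (f b)) = nullGram := by
    ext i j
    exact hf i j
  rw [this, nullGram_mul_self]

/-- The algebraic symmetries of the Weyl tensor. -/
structure IsWeylTensor (b : LinearMap.BilinForm ℝ (TangentSpace I4 x)) (W : Tensor4 x) : Prop where
  swap_left : ∀ v₀ v₁ v₂ v₃, W ![v₀, v₁, v₂, v₃] = -W ![v₁, v₀, v₂, v₃]
  pair : ∀ v₀ v₁ v₂ v₃, W ![v₀, v₁, v₂, v₃] = W ![v₂, v₃, v₀, v₁]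
  trace : ∀ f, IsNullFrame b f → ∀ v w,
    W ![v, f 1, w, f 1] + W ![v, f 2, w, f 2] - W ![v, f 0, w, f 3] - W ![v, f 3, w, f 0] = 0

theorem IsWeylTensor.swap_right {b : LinearMap.BilinForm ℝ (TangentSpace I4 x)} {W : Tensor4 x}
    (hW : IsWeylTensor b W) (v₀ v₁ v₂ v₃ : TangentSpace I4 x) :
    W ![v₀, v₁, v₂, v₃] = -W ![v₀, v₁, v₃, v₂] := by
  rw [hW.pair, hW.swap_left, hW.pair]

theorem tensorOfComps_vec (C : Fin 4 → Fin 4 → Fin 4 → Fin 4 → ℝ)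
    (v₀ v₁ v₂ v₃ : TangentSpace I4 x) :
    tensorOfComps x C ![v₀, v₁, v₂, v₃] = ∑ i, ∑ j, ∑ k, ∑ l,
      C i j k l * (comps v₀ i * comps v₁ j * comps v₂ k * comps v₃ l) :=
  tensorOfComps_apply x C _

/-- The curvature identities hold for the physical metric `h`, while null frames are taken for the
conformal one `b = r • h x`. The trace is homogeneous in the metric, so its vanishing is insensitive
to `r`. -/
theorem isWeylTensor_of_contraction {h : BilinField M} {b : LinearMap.BilinForm ℝ (TangentSpace I4 x)}
    {C : Fin 4 → Fin 4 → Fin 4 → Fin 4 → ℝ} {r : ℝ} (hr : r ≠ 0) (hb : b = r • h x)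
    (h₁ : ∀ i j k l, C i j k l = -C j i k l) (h₂ : ∀ i j k l, C i j k l = C k l i j)
    (h₃ : ∀ i k, ∑ j, ∑ l, (compMatrix h x (extChartAt I4 x x))⁻¹ j l * C i j k l = 0) :
    IsWeylTensor b (tensorOfComps x C) := by
  refine ⟨fun v₀ v₁ v₂ v₃ => ?_, fun v₀ v₁ v₂ v₃ => ?_, fun f hf v w => ?_⟩
  · rw [tensorOfComps_vec, tensorOfComps_vec, Finset.sum_comm]
    simp only [← Finset.sum_neg_distrib]
    refine Finset.sum_congr rfl fun i _ => Finset.sum_congr rfl fun j _ =>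
      Finset.sum_congr rfl fun k _ => Finset.sum_congr rfl fun l _ => ?_
    rw [h₁]
    ring
  · rw [tensorOfComps_vec, tensorOfComps_vec]
    have e₁ : ∀ T : Fin 4 → Fin 4 → Fin 4 → Fin 4 → ℝ,
        ∑ i, ∑ j, ∑ k, ∑ l, T i j k l = ∑ k, ∑ l, ∑ i, ∑ j, T i j k l := by
      intro T
      calc _ = ∑ i, ∑ k, ∑ l, ∑ j, T i j k l := by
            refine Finset.sum_congr rfl fun i _ => ?_
            rw [Finset.sum_comm]
            exact Finset.sum_congr rfl fun k _ => Finset.sum_comm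
        _ = _ := by
            rw [Finset.sum_comm]
            exact Finset.sum_congr rfl fun k _ => Finset.sum_comm
    rw [e₁]
    refine Finset.sum_congr rfl fun i _ => Finset.sum_congr rfl fun j _ =>
      Finset.sum_congr rfl fun k _ => Finset.sum_congr rfl fun l _ => ?_
    rw [h₂]
    ring
  · have hgram : r • Matrix.of (fun a b => h x (f a) (f b)) = nullGram := by
      ext i j
      rw [← hf i j, hb]
      rfl
    have e := contraction_eq h x f (r • nullGram)
      (by rw [Matrix.smul_mul, ← Matrix.mul_smul, hgram, nullGram_mul_self])
      (slots₁₃ (tensorOfComps x C) v w)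
    have e₀ : ∑ i, ∑ j, (compMatrix h x (extChartAt I4 x x))⁻¹ i j *
        slots₁₃ (tensorOfComps x C) v w (basisVec x i) (basisVec x j) = 0 := by
      have : ∀ j l, slots₁₃ (tensorOfComps x C) v w (basisVec x j) (basisVec x l) =
          ∑ i, ∑ k, comps v i * comps w k * C i j k l := by
        intro j l
        rw [slots₁₃_apply, tensorOfComps_vec]
        refine Finset.sum_congr rfl fun i _ => ?_
        simp only [comps_basisVec, stdVec_apply]
        rw [Finset.sum_eq_single j (fun b _ hb => by simp [hb]) (by simp)]
        refine Finset.sum_congr rfl fun k _ => ?_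
        rw [Finset.sum_eq_single l (fun b _ hb => by simp [hb]) (by simp)]
        simp
        ring
      simp only [this]
      have : ∑ i, ∑ k, comps v i * comps w k *
          ∑ j, ∑ l, (compMatrix h x (extChartAt I4 x x))⁻¹ j l * C i j k l = 0 := by
        simp only [h₃, mul_zero, Finset.sum_const_zero]
      rw [← this]
      simp only [Finset.mul_sum]
      have e₁ : ∀ T : Fin 4 → Fin 4 → Fin 4 → Fin 4 → ℝ,
          ∑ j, ∑ l, ∑ i, ∑ k, T i j k l = ∑ i, ∑ k, ∑ j, ∑ l, T i j k l := by
        intro T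
        calc _ = ∑ j, ∑ i, ∑ k, ∑ l, T i j k l := by
              refine Finset.sum_congr rfl fun j _ => ?_
              rw [Finset.sum_comm]
              exact Finset.sum_congr rfl fun i _ => Finset.sum_comm
          _ = _ := by
              rw [Finset.sum_comm]
              exact Finset.sum_congr rfl fun i _ => Finset.sum_comm
      rw [e₁]
      refine Finset.sum_congr rfl fun i _ => Finset.sum_congr rfl fun j _ =>
        Finset.sum_congr rfl fun k _ => Finset.sum_congr rfl fun l _ => by ring
    rw [e₀] at e
    simp only [Matrix.smul_apply, smul_eq_mul, mul_assoc, ← Finset.mul_sum] at e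
    rw [sum_nullGram fun a b => slots₁₃ (tensorOfComps x C) v w (f a) (f b)] at e
    exact (mul_eq_zero.1 e.symm).resolve_left hr

theorem IsWeylTensor.smul {b : LinearMap.BilinForm ℝ (TangentSpace I4 x)} {W : Tensor4 x}
    (hW : IsWeylTensor b W) (r : ℝ) : IsWeylTensor b (r • W) := by
  refine ⟨fun v₀ v₁ v₂ v₃ => ?_, fun v₀ v₁ v₂ v₃ => ?_, fun f hf v w => ?_⟩
  · rw [smul_apply, smul_apply, hW.swap_left, smul_neg]
  · rw [smul_apply, smul_apply, hW.pair]
  · simp only [smul_apply, smul_eq_mul, ← mul_add, ← mul_sub, hW.trace f hf, mul_zero]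

end Tensors

/-! ### The rescaled Weyl tensor in the interior. -/

namespace ConformalCompletion

variable {M : Type*} [TopologicalSpace M] [ChartedSpace (EuclideanHalfSpace 4) M]
  [IsManifold I4 ∞ M] {Λ : ℝ} (X : ConformalCompletion M Λ)

theorem isMetric : IsMetric X.g := ⟨X.g_symm, fun x _ hv => (X.g_lorentzian x).nondeg hv⟩

theorem smoothIn (x₀ : M) : SmoothIn X.g x₀ := X.g_smooth x₀

theorem isMetricNear_ghat {x : M} (hx : x ∉ I4.boundary M) :
    IsMetricNear X.ghat x (extChartAt I4 x x) := by
  have hΩ : X.Ω x ≠ 0 := (X.Ω_pos x hx).ne'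
  refine ⟨mem_extChartAt_target x, ?_, fun i j => contDiffWithinAt_rescale X.smoothIn X.Ω_smooth
    (mem_extChartAt_source x) hΩ i j, ?_⟩
  · exact (X.isMetric.rescale hΩ).symm
  · have hc : ContinuousWithinAt (funIn X.Ω x) (range I4) (extChartAt I4 x x) :=
      (contDiffWithinAt_funIn X.Ω_smooth (mem_extChartAt_source x)).continuousWithinAt
    have hne : funIn X.Ω x (extChartAt I4 x x) ≠ 0 := by
      rwa [funIn, (extChartAt I4 x).left_inv (mem_extChartAt_source x)]
    filter_upwards [hc.eventually_ne hne] with y hy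
    exact X.isMetric.rescale hy

theorem isWeylTensor_d {x : M} (hx : x ∉ I4.boundary M) : IsWeylTensor (X.g x) (X.d x) := by
  have H := X.isMetricNear_ghat hx
  rw [X.d_eq x hx]
  have hΩ : X.Ω x ≠ 0 := (X.Ω_pos x hx).ne'
  refine IsWeylTensor.smul ?_ _
  refine isWeylTensor_of_contraction (h := X.ghat) (r := X.Ω x ^ 2) (pow_ne_zero 2 hΩ) ?_
    H.weylComps_swap_left H.weylComps_pair H.weylComps_trace
  rw [ghat, rescale, smul_smul, mul_inv_cancel₀ (pow_ne_zero 2 hΩ), one_smul]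

end ConformalCompletion

/-! ### Expansions in a null frame, and the energy flux of a tensor of type D. -/

section NullFrame

variable {M : Type*} [TopologicalSpace M] [ChartedSpace (EuclideanHalfSpace 4) M]
  [IsManifold I4 ∞ M] {x : M}

theorem inv_contraction {h : BilinField M} (hm : IsMetric h) (v : TangentSpace I4 x)
    (ψ : TangentSpace I4 x →ₗ[ℝ] ℝ) :
    ∑ i, ∑ j, (compMatrix h x (extChartAt I4 x x))⁻¹ i j * (h x v (basisVec x i) * ψ (basisVec x j))
      = ψ v := by
  have hy := mem_extChartAt_target (I := I4) x
  have e : ∀ j, ∑ i, (compMatrix h x (extChartAt I4 x x))⁻¹ i j * h x v (basisVec x i) =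
      comps v j := by
    intro j
    have e₁ : ∀ i, h x v (basisVec x i) =
        ∑ a, compMatrix h x (extChartAt I4 x x) a i * comps v a := by
      intro i
      conv_lhs => rw [sum_basisVec v]
      simp only [map_sum, map_smul, LinearMap.sum_apply, LinearMap.smul_apply, smul_eq_mul,
        apply_basisVec]
      exact Finset.sum_congr rfl fun a _ => mul_comm _ _
    simp only [e₁, Finset.mul_sum]
    rw [Finset.sum_comm]
    have e₂ : ∀ a, ∑ i, (compMatrix h x (extChartAt I4 x x))⁻¹ i j *
        (compMatrix h x (extChartAt I4 x x) a i * comps v a) = if a = j then comps v a else 0 := by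
      intro a
      rw [← boole_mul, ← compMatrix_mul_inv (hm.at _) hy, Finset.sum_mul]
      exact Finset.sum_congr rfl fun i _ => by ring
    rw [Finset.sum_congr rfl fun a _ => e₂ a]
    simp
  rw [Finset.sum_comm]
  conv_rhs => rw [sum_basisVec v, map_sum]
  refine Finset.sum_congr rfl fun j _ => ?_
  rw [map_smul, smul_eq_mul, ← e, Finset.sum_mul]
  exact Finset.sum_congr rfl fun i _ => by ring

/-- Expansion of a vector in a null frame, under a linear form. -/
theorem linear_eq_nullFrame {h : BilinField M} (hm : IsMetric h) {f : Fin 4 → TangentSpace I4 x}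
    (hf : IsNullFrame (h x) f) (v : TangentSpace I4 x) (ψ : TangentSpace I4 x →ₗ[ℝ] ℝ) :
    ψ v = h x v (f 1) * ψ (f 1) + h x v (f 2) * ψ (f 2) - h x v (f 0) * ψ (f 3)
      - h x v (f 3) * ψ (f 0) := by
  have := contraction_nullFrame h hf (LinearMap.BilinForm.linMulLin (h x v) ψ)
  simp only [LinearMap.BilinForm.linMulLin_apply] at this
  rw [← this, inv_contraction hm]

theorem eq_nullFrame {h : BilinField M} (hm : IsMetric h) {f : Fin 4 → TangentSpace I4 x}
    (hf : IsNullFrame (h x) f) (v : TangentSpace I4 x) :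
    v = h x v (f 1) • f 1 + h x v (f 2) • f 2 - h x v (f 0) • f 3 - h x v (f 3) • f 0 := by
  rw [← sub_eq_zero]
  refine hm.nondeg x _ fun w => ?_
  have : h x v w = h x v (f 1) * h x (f 1) w + h x v (f 2) * h x (f 2) w
      - h x v (f 0) * h x (f 3) w - h x v (f 3) * h x (f 0) w :=
    linear_eq_nullFrame hm hf v ((h x).flip w)
  simp only [map_sub, map_add, map_smul, LinearMap.sub_apply, LinearMap.add_apply,
    LinearMap.smul_apply, smul_eq_mul]
  linarith

/-- The tensor `d_{α μ β ν} d_γ{}^μ{}_δ{}^ν`. -/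
def doubleContraction (h : BilinField M) (W : Tensor4 x) (a c b e : TangentSpace I4 x) : ℝ :=
  ∑ m, ∑ n, ∑ m', ∑ n', (compMatrix h x (extChartAt I4 x x))⁻¹ m m' *
    (compMatrix h x (extChartAt I4 x x))⁻¹ n n' *
    (W ![a, basisVec x m, c, basisVec x n] * W ![b, basisVec x m', e, basisVec x n'])

theorem doubleContraction_isLinearMap (h : BilinField M) (W : Tensor4 x) :
    (∀ c b e, IsLinearMap ℝ (fun a => doubleContraction h W a c b e)) ∧
    (∀ a b e, IsLinearMap ℝ (fun c => doubleContraction h W a c b e)) ∧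
    (∀ a c e, IsLinearMap ℝ (fun b => doubleContraction h W a c b e)) ∧
    (∀ a c b, IsLinearMap ℝ (fun e => doubleContraction h W a c b e)) := by
  obtain ⟨l₀, -, l₂, -, s₀, -, s₂, -⟩ := tensor_linear W
  refine ⟨fun c b e => ⟨fun v w => ?_, fun r v => ?_⟩, fun a b e => ⟨fun v w => ?_, fun r v => ?_⟩,
    fun a c e => ⟨fun v w => ?_, fun r v => ?_⟩, fun a c b => ⟨fun v w => ?_, fun r v => ?_⟩⟩ <;>
  (simp only [doubleContraction, l₀, l₂, s₀, s₂, ← Finset.sum_add_distrib, smul_eq_mul,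
      Finset.mul_sum]
   refine Finset.sum_congr rfl fun m _ => Finset.sum_congr rfl fun n _ =>
      Finset.sum_congr rfl fun m' _ => Finset.sum_congr rfl fun n' _ => by ring)

theorem doubleContraction_eq {h : BilinField M} {f : Fin 4 → TangentSpace I4 x}
    (hf : IsNullFrame (h x) f) (W : Tensor4 x) (a c b e : TangentSpace I4 x) :
    doubleContraction h W a c b e =
      (fun A B : Fin 4 → Fin 4 → ℝ =>
        (A 1 1 * B 1 1 + A 1 2 * B 1 2 - A 1 0 * B 1 3 - A 1 3 * B 1 0)
        + (A 2 1 * B 2 1 + A 2 2 * B 2 2 - A 2 0 * B 2 3 - A 2 3 * B 2 0)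
        - (A 0 1 * B 3 1 + A 0 2 * B 3 2 - A 0 0 * B 3 3 - A 0 3 * B 3 0)
        - (A 3 1 * B 0 1 + A 3 2 * B 0 2 - A 3 0 * B 0 3 - A 3 3 * B 0 0))
      (fun m n => W ![a, f m, c, f n]) (fun m n => W ![b, f m, e, f n]) := by
  have inner : ∀ v w : TangentSpace I4 x, ∑ n, ∑ n', (compMatrix h x (extChartAt I4 x x))⁻¹ n n' *
      (W ![a, v, c, basisVec x n] * W ![b, w, e, basisVec x n']) =
      W ![a, v, c, f 1] * W ![b, w, e, f 1] + W ![a, v, c, f 2] * W ![b, w, e, f 2]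
      - W ![a, v, c, f 0] * W ![b, w, e, f 3] - W ![a, v, c, f 3] * W ![b, w, e, f 0] :=
    fun v w => contraction_nullFrame h hf
      (LinearMap.BilinForm.linMulLin (slot₃ W a v c) (slot₃ W b w e))
  have outer := contraction_nullFrame h hf
      (LinearMap.BilinForm.linMulLin (slot₁ W a c (f 1)) (slot₁ W b e (f 1))
      + LinearMap.BilinForm.linMulLin (slot₁ W a c (f 2)) (slot₁ W b e (f 2))
      - LinearMap.BilinForm.linMulLin (slot₁ W a c (f 0)) (slot₁ W b e (f 3))
      - LinearMap.BilinForm.linMulLin (slot₁ W a c (f 3)) (slot₁ W b e (f 0)))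
  have hslot : ∀ (b c e v : TangentSpace I4 x), slot₁ W b c e v = W ![b, v, c, e] :=
    fun _ _ _ _ => rfl
  simp only [LinearMap.sub_apply, LinearMap.add_apply, LinearMap.BilinForm.linMulLin_apply,
    hslot] at outer
  refine Eq.trans ?_ outer
  rw [doubleContraction]
  refine Finset.sum_congr rfl fun m _ => ?_
  rw [Finset.sum_comm]
  refine Finset.sum_congr rfl fun m' _ => ?_
  rw [← inner, Finset.mul_sum]
  refine Finset.sum_congr rfl fun n _ => ?_
  rw [Finset.mul_sum]
  exact Finset.sum_congr rfl fun n' _ => by ring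

/-- For a Weyl tensor of type D aligned with the plane spanned by the timelike vector
`N = k + q ℓ`, the energy flux with respect to `N` vanishes. -/
theorem doubleContraction_eq_zero {h : BilinField M} (hm : IsMetric h)
    {f : Fin 4 → TangentSpace I4 x} (hf : IsNullFrame (h x) f) {W : Tensor4 x}
    (hW : IsWeylTensor (h x) W)
    (z₁ : ∀ i ∈ ({1, 2} : Set (Fin 4)), ∀ j ∈ ({1, 2} : Set (Fin 4)),
      W ![f 3, f i, f 3, f j] = 0)
    (z₂ : ∀ i ∈ ({1, 2} : Set (Fin 4)), W ![f 3, f i, f 3, f 0] = 0)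
    (z₃ : ∀ i ∈ ({1, 2} : Set (Fin 4)), ∀ j ∈ ({1, 2} : Set (Fin 4)),
      W ![f 0, f i, f 0, f j] = 0)
    (z₄ : ∀ i ∈ ({1, 2} : Set (Fin 4)), W ![f 0, f i, f 0, f 3] = 0)
    {q : ℝ} {N : TangentSpace I4 x} (hN : N = f 3 + q • f 0) {v : TangentSpace I4 x}
    (hv : h x v N = 0) : doubleContraction h W v N N N = 0 := by
  obtain ⟨l₀, l₁, l₂, l₃, s₀, s₁, s₂, s₃⟩ := tensor_linear W
  have p := hW.pair
  have a := hW.swap_left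
  have b := hW.swap_right
  have aa : ∀ u v w, W ![u, u, v, w] = 0 := fun u v w => by linarith [a u u v w]
  have bb : ∀ u v w, W ![u, v, w, w] = 0 := fun u v w => by linarith [b u v w w]
  have t := hW.trace f hf
  -- components with one transverse index and three in the plane
  have y₁ : ∀ i ∈ ({1, 2} : Set (Fin 4)), W ![f 3, f 0, f 3, f i] = 0 := fun i hi => by
    rw [p, z₂ i hi]
  have y₂ : ∀ i ∈ ({1, 2} : Set (Fin 4)), W ![f 0, f 3, f 0, f i] = 0 := fun i hi => by
    rw [p, z₄ i hi]
  have y₃ : ∀ i ∈ ({1, 2} : Set (Fin 4)), W ![f 0, f 3, f 3, f i] = 0 := fun i hi => by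
    rw [a, y₁ i hi, neg_zero]
  have y₄ : ∀ i ∈ ({1, 2} : Set (Fin 4)), W ![f 3, f 0, f 0, f i] = 0 := fun i hi => by
    rw [a, y₂ i hi, neg_zero]
  -- The electric part `W(N, ·, N, ·)`. It turns out to have no mixed components and to be a
  -- multiple of the identity on the transverse plane.
  have EE : ∀ m n, W ![N, f m, N, f n] = W ![f 3, f m, f 3, f n] + q * W ![f 0, f m, f 3, f n]
      + q * W ![f 3, f m, f 0, f n] + q ^ 2 * W ![f 0, f m, f 0, f n] := by
    intro m n
    rw [hN, l₀, l₂, l₂, s₀, s₀, s₂, s₂]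
    ring
  have E₁ : ∀ i ∈ ({1, 2} : Set (Fin 4)), W ![N, f 0, N, f i] = 0 := fun i hi => by
    rw [EE, y₁ i hi, aa, aa, y₄ i hi]
    ring
  have E₂ : ∀ i ∈ ({1, 2} : Set (Fin 4)), W ![N, f 3, N, f i] = 0 := fun i hi => by
    rw [EE, y₃ i hi, aa, aa, y₂ i hi]
    ring
  have E₃ : ∀ i ∈ ({1, 2} : Set (Fin 4)), W ![N, f i, N, f 0] = 0 := fun i hi => by
    rw [p, E₁ i hi]
  have E₄ : ∀ i ∈ ({1, 2} : Set (Fin 4)), W ![N, f i, N, f 3] = 0 := fun i hi => by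
    rw [p, E₂ i hi]
  have m₁ : (1 : Fin 4) ∈ ({1, 2} : Set (Fin 4)) := by simp
  have m₂ : (2 : Fin 4) ∈ ({1, 2} : Set (Fin 4)) := by simp
  have flip : ∀ u v w z, W ![u, v, w, z] = W ![v, u, z, w] := fun u v w z => by
    rw [a, b, neg_neg]
  -- By hypothesis only the two terms with one `f 0` and one `f 3` survive, and their sum is a trace
  -- identity.
  have E₅ : W ![N, f 1, N, f 2] = 0 := by
    have := t (f 1) (f 2)
    rw [aa, bb, flip (f 1) (f 0), flip (f 1) (f 3)] at this
    rw [EE, z₁ 1 m₁ 2 m₂, z₃ 1 m₁ 2 m₂]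
    linear_combination (-q) * this
  have E₆ : W ![N, f 2, N, f 1] = 0 := by rw [p, E₅]
  -- The two diagonal trace identities share the component `W(f 1, f 2, f 1, f 2)`; their difference
  -- is the claim.
  have E₇ : W ![N, f 1, N, f 1] = W ![N, f 2, N, f 2] := by
    have h₁ := t (f 1) (f 1)
    have h₂ := t (f 2) (f 2)
    rw [aa, flip (f 1) (f 0), flip (f 1) (f 3)] at h₁
    rw [aa, flip (f 2) (f 0), flip (f 2) (f 3), flip (f 2) (f 1)] at h₂
    rw [EE, EE, z₁ 1 m₁ 1 m₁, z₃ 1 m₁ 1 m₁, z₁ 2 m₂ 2 m₂, z₃ 2 m₂ 2 m₂]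
    linear_combination (-q) * h₁ + q * h₂
  have e₃ : W ![N, f 3, N, f 3] = q ^ 2 * W ![f 0, f 3, f 0, f 3] := by
    rw [EE, aa, aa, bb]
    ring
  have e₀ : W ![N, f 0, N, f 0] = W ![f 3, f 0, f 3, f 0] := by
    rw [EE, aa, aa, bb]
    ring
  have e₃₀ : W ![N, f 3, N, f 0] = q * W ![f 0, f 3, f 3, f 0] := by
    rw [EE, aa, aa, bb]
    ring
  have e₀₃ : W ![N, f 0, N, f 3] = q * W ![f 3, f 0, f 0, f 3] := by
    rw [EE, aa, aa, bb]
    ring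
  have AA : ∀ u m n, W ![u, f m, N, f n] = W ![u, f m, f 3, f n] + q * W ![u, f m, f 0, f n] := by
    intro u m n
    rw [hN, l₂, s₂]
  -- Since the transverse electric part is a multiple of the identity, it contracts with `W(u, ·, N,
  -- ·)` to the transverse trace, which trace-freeness expresses by `f 0` and `f 3`.
  have key : ∀ u, doubleContraction h W u N N N =
      W ![N, f 1, N, f 1] * (W ![u, f 0, N, f 3] + W ![u, f 3, N, f 0])
      + W ![u, f 0, N, f 0] * (q ^ 2 * W ![f 0, f 3, f 0, f 3])
      + W ![u, f 0, N, f 3] * (q * W ![f 0, f 3, f 3, f 0])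
      + W ![u, f 3, N, f 0] * (q * W ![f 3, f 0, f 0, f 3])
      + W ![u, f 3, N, f 3] * W ![f 3, f 0, f 3, f 0] := by
    intro u
    rw [doubleContraction_eq hf]
    simp only [E₁ 1 m₁, E₁ 2 m₂, E₂ 1 m₁, E₂ 2 m₂, E₃ 1 m₁, E₃ 2 m₂, E₄ 1 m₁, E₄ 2 m₂, E₅, E₆,
      e₃, e₀, e₃₀, e₀₃]
    linear_combination (-W ![u, f 2, N, f 2]) * E₇ + W ![N, f 1, N, f 1] * t u N
  have k₁ : ∀ i ∈ ({1, 2} : Set (Fin 4)), doubleContraction h W (f i) N N N = 0 := by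
    intro i hi
    have c₁ : W ![f i, f 0, f 3, f 0] = 0 := by rw [flip, z₄ i hi]
    have c₂ : W ![f i, f 0, f 0, f 3] = 0 := by rw [b, c₁, neg_zero]
    have c₃ : W ![f i, f 3, f 0, f 3] = 0 := by rw [flip, z₂ i hi]
    have c₄ : W ![f i, f 3, f 3, f 0] = 0 := by rw [b, c₃, neg_zero]
    have hs := AA (f i)
    rw [key, hs, hs, hs, hs]
    simp only [bb, c₁, c₂, c₃, c₄]
    ring
  -- `f 3 - q • f 0` is the direction of the null plane orthogonal to `N = f 3 + q • f 0`; with `f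
  -- 1` and `f 2` it spans every admissible `v`.
  have k₂ : doubleContraction h W (f 3 - q • f 0) N N N = 0 := by
    have hs : ∀ m n, W ![f 3 - q • f 0, f m, N, f n] = W ![f 3, f m, f 3, f n]
        + q * W ![f 3, f m, f 0, f n] - q * W ![f 0, f m, f 3, f n]
        - q ^ 2 * W ![f 0, f m, f 0, f n] := by
      intro m n
      rw [sub_eq_add_neg, ← neg_smul, l₀, s₀, AA, AA]
      ring
    rw [key, hs, hs, hs, hs]
    simp only [aa, bb]
    rw [p (f 3) (f 0) (f 0) (f 3)]
    ring
  have lin := (doubleContraction_isLinearMap h W).1 N N N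
  have hv' : h x v (f 3) = -(q * h x v (f 0)) := by
    rw [hN, map_add, map_smul, smul_eq_mul] at hv
    linarith
  have hvv : v = h x v (f 1) • f 1 + (h x v (f 2) • f 2 + (-h x v (f 0)) • (f 3 - q • f 0)) := by
    conv_lhs => rw [eq_nullFrame hm hf v, hv']
    module
  rw [hvv, lin.map_add, lin.map_add, lin.map_smul, lin.map_smul, lin.map_smul, k₁ 1 m₁, k₁ 2 m₂, k₂]
  simp

end NullFrame

/-! ### The super-Poynting vector in terms of double contractions. -/

namespace ConformalCompletion

variable {M : Type*} [TopologicalSpace M] [ChartedSpace (EuclideanHalfSpace 4) M]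
  [IsManifold I4 ∞ M] {Λ : ℝ} (X : ConformalCompletion M Λ) {x : M}

theorem metric_raise (x : M) (η : Fin 4 → ℝ) (w : TangentSpace I4 x) :
    X.g x (ofComps x fun i => ∑ j, X.gInv x i j * η j) w = ∑ j, η j * comps w j := by
  have hy := mem_extChartAt_target (I := I4) x
  have e : ∀ m l, ∑ i, compMatrix X.g x (extChartAt I4 x x) m i * X.gInv x i l =
      if m = l then 1 else 0 := compMatrix_mul_inv (X.isMetric.at _) hy
  rw [apply_eq_compMatrix, Finset.sum_comm]
  refine Finset.sum_congr rfl fun m _ => ?_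
  rw [← Finset.sum_mul]
  congr 1
  have e₂ : ∀ i, compMatrix X.g x (extChartAt I4 x x) i m *
      comps (ofComps x fun i => ∑ j, X.gInv x i j * η j) i =
      ∑ j, compMatrix X.g x (extChartAt I4 x x) m i * X.gInv x i j * η j := by
    intro i
    rw [compMatrix_symm X.g_symm x _ i m]
    change _ * ∑ j, X.gInv x i j * η j = _
    rw [Finset.mul_sum]
    exact Finset.sum_congr rfl fun j _ => by ring
  simp only [e₂]
  rw [Finset.sum_comm]
  simp only [← Finset.sum_mul, e]
  simp

theorem metric_N (x : M) (w : TangentSpace I4 x) :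
    X.g x (X.N x) w = differential X.Ω x w := by
  rw [N, metric_raise, differential_eq_sum]
  exact Finset.sum_congr rfl fun j _ => mul_comm _ _

theorem metric_N_N (hx : x ∈ I4.boundary M) : X.g x (X.N x) (X.N x) = -Λ / 3 := by
  rw [metric_N, differential_eq_sum, ← X.norm_grad x hx]
  refine Finset.sum_congr rfl fun i _ => ?_
  change (∑ j, X.gInv x i j * pd j (fun z => X.Ω ((extChartAt I4 x).symm z))
    (extChartAt I4 x x)) * _ = _
  rw [Finset.sum_mul]
  refine Finset.sum_congr rfl fun j _ => ?_
  rw [gInv]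
  ring

theorem metric_unitNormal (hΛ : 0 < Λ) (hx : x ∈ I4.boundary M) :
    X.g x (X.unitNormal x) (X.unitNormal x) = -1 := by
  have h0 : (0 : ℝ) < Λ / 3 := by positivity
  have hs : Real.sqrt (Λ / 3) ≠ 0 := (Real.sqrt_pos.2 h0).ne'
  simp only [unitNormal, map_smul, LinearMap.smul_apply, X.metric_N_N hx, smul_eq_mul]
  have := Real.mul_self_sqrt h0.le
  field_simp
  nlinarith

theorem linear_sum_basisVec {ψ : TangentSpace I4 x → ℝ} (hψ : IsLinearMap ℝ ψ)
    (v : TangentSpace I4 x) : ∑ i, ψ (basisVec x i) * comps v i = ψ v := by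
  have := congrArg (hψ.mk' ψ) (sum_basisVec v)
  rw [map_sum] at this
  simp only [map_smul, smul_eq_mul, IsLinearMap.mk'_apply] at this
  rw [this]
  exact Finset.sum_congr rfl fun i _ => mul_comm _ _

/-- The value of `K` is immaterial: its term is a multiple of `g(v, n)` after contraction, hence
drops out for `v` tangent to the boundary. -/
theorem belRobinson_eq (x : M) : ∃ K : ℝ, ∀ a b c f, X.belRobinson x a b c f =
    doubleContraction X.g (X.d x) (basisVec x a) (basisVec x c) (basisVec x b) (basisVec x f)
    + doubleContraction X.g (X.d x) (basisVec x a) (basisVec x f) (basisVec x b) (basisVec x c)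
    - K * X.g x (basisVec x a) (basisVec x b) * X.g x (basisVec x c) (basisVec x f) := by
  refine ⟨1 / 8 * ∑ m, ∑ n, ∑ p, ∑ q, ∑ m', ∑ n', ∑ p', ∑ q',
    X.gInv x m m' * X.gInv x n n' * X.gInv x p p' * X.gInv x q q' *
    X.d x ![basisVec x m, basisVec x n, basisVec x p, basisVec x q] *
    X.d x ![basisVec x m', basisVec x n', basisVec x p', basisVec x q'], fun a b c f => ?_⟩
  rw [apply_basisVec, apply_basisVec, belRobinson, doubleContraction, doubleContraction]
  simp only [← Finset.sum_add_distrib, ← mul_add]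
  simp only [basisVec, gInv]
  ring

theorem sum_belRobinson (x : M) : ∃ K : ℝ, ∀ v n : TangentSpace I4 x,
    ∑ a, (∑ b, ∑ c, ∑ f, X.belRobinson x a b c f * comps n b * comps n c * comps n f) * comps v a =
      2 * doubleContraction X.g (X.d x) v n n n - K * X.g x v n * X.g x n n := by
  obtain ⟨K, hK⟩ := X.belRobinson_eq x
  refine ⟨K, fun v n => ?_⟩
  obtain ⟨d₁, d₂, d₃, d₄⟩ := doubleContraction_isLinearMap X.g (X.d x)
  have g₁ : ∀ w, IsLinearMap ℝ (fun v => X.g x v w) := fun w => ((X.g x).flip w).isLinear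
  have g₂ : ∀ w, IsLinearMap ℝ (fun v => X.g x w v) := fun w => (X.g x w).isLinear
  have e₁ : ∀ a b c, ∑ f, X.belRobinson x a b c f * comps n b * comps n c * comps n f =
      (doubleContraction X.g (X.d x) (basisVec x a) (basisVec x c) (basisVec x b) n
      + doubleContraction X.g (X.d x) (basisVec x a) n (basisVec x b) (basisVec x c)
      - K * X.g x (basisVec x a) (basisVec x b) * X.g x (basisVec x c) n) *
      comps n b * comps n c := by
    intro a b c
    rw [← linear_sum_basisVec (d₄ _ _ _) n, ← linear_sum_basisVec (d₂ _ _ _) n,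
      ← linear_sum_basisVec (g₂ _) n, Finset.mul_sum, ← Finset.sum_add_distrib,
      ← Finset.sum_sub_distrib, Finset.sum_mul, Finset.sum_mul]
    refine Finset.sum_congr rfl fun f _ => ?_
    rw [hK]
    ring
  have e₂ : ∀ a b, ∑ c, ∑ f, X.belRobinson x a b c f * comps n b * comps n c * comps n f =
      (doubleContraction X.g (X.d x) (basisVec x a) n (basisVec x b) n
      + doubleContraction X.g (X.d x) (basisVec x a) n (basisVec x b) n
      - K * X.g x (basisVec x a) (basisVec x b) * X.g x n n) * comps n b := by
    intro a b
    conv_rhs => rw [← linear_sum_basisVec (g₁ n) n]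
    nth_rw 1 [← linear_sum_basisVec (d₂ (basisVec x a) (basisVec x b) n) n]
    rw [← linear_sum_basisVec (d₄ (basisVec x a) n (basisVec x b)) n]
    rw [Finset.mul_sum, ← Finset.sum_add_distrib, ← Finset.sum_sub_distrib, Finset.sum_mul]
    refine Finset.sum_congr rfl fun f _ => ?_
    rw [e₁]
    ring
  have e₃ : ∀ a, ∑ b, ∑ c, ∑ f, X.belRobinson x a b c f * comps n b * comps n c * comps n f =
      2 * doubleContraction X.g (X.d x) (basisVec x a) n n n
      - K * X.g x (basisVec x a) n * X.g x n n := by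
    intro a
    rw [← linear_sum_basisVec (d₃ (basisVec x a) n n) n,
      ← linear_sum_basisVec (g₂ (basisVec x a)) n, Finset.mul_sum, Finset.mul_sum,
      Finset.sum_mul, ← Finset.sum_sub_distrib]
    refine Finset.sum_congr rfl fun f _ => ?_
    rw [e₂]
    ring
  rw [← linear_sum_basisVec (d₁ n n n) v, ← linear_sum_basisVec (g₁ n) v, Finset.mul_sum,
    Finset.mul_sum, Finset.sum_mul, ← Finset.sum_sub_distrib]
  refine Finset.sum_congr rfl fun f _ => ?_
  rw [e₃]
  ring

/-- The super-Poynting vector vanishes if the flux `D(v, n, n, n)` does for `v` orthogonal to the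
normal. -/
theorem superPoynting_eq_zero (hΛ : 0 < Λ) (hx : x ∈ I4.boundary M)
    (h : ∀ v, X.g x v (X.N x) = 0 → doubleContraction X.g (X.d x) v (X.N x) (X.N x) (X.N x) = 0) :
    X.superPoynting x = 0 := by
  obtain ⟨K, hK⟩ := X.sum_belRobinson x
  set n := X.unitNormal x with hn
  have hnn : X.g x n n = -1 := X.metric_unitNormal hΛ hx
  obtain ⟨d₁, d₂, d₃, d₄⟩ := doubleContraction_isLinearMap X.g (X.d x)
  have hs : (Real.sqrt (Λ / 3))⁻¹ ≠ 0 := inv_ne_zero (Real.sqrt_pos.2 (by positivity)).ne'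
  let D : TangentSpace I4 x → ℝ := fun v =>
    2 * doubleContraction X.g (X.d x) v n n n - K * X.g x v n * X.g x n n
  have hD0 : ∀ v, X.g x v n = 0 → D v = 0 := by
    intro v hv
    have hv' : X.g x v (X.N x) = 0 := by
      rw [hn, unitNormal, map_smul, smul_eq_mul] at hv
      exact (mul_eq_zero.1 hv).resolve_left hs
    have : doubleContraction X.g (X.d x) v n n n = 0 := by
      rw [hn, unitNormal, (d₂ _ _ _).map_smul, (d₃ _ _ _).map_smul, (d₄ _ _ _).map_smul, h v hv']
      simp
    simp only [D, this, hv]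
    ring
  have hDadd : ∀ (v : TangentSpace I4 x) (r : ℝ), D (v + r • n) = D v + r * D n := by
    intro v r
    simp only [D, (d₁ _ _ _).map_add, (d₁ _ _ _).map_smul, map_add, map_smul, LinearMap.add_apply,
      LinearMap.smul_apply, smul_eq_mul]
    ring
  have hp : ∀ v, X.g x (X.supermomentum x) v = -D v := by
    intro v
    have : X.supermomentum x = ofComps x fun i => ∑ a, X.gInv x i a *
        -(∑ b, ∑ c, ∑ f, X.belRobinson x a b c f * comps n b * comps n c * comps n f) := by
      rw [supermomentum]
      simp only [mul_neg, Finset.sum_neg_distrib, ← hn]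
    rw [this, metric_raise]
    simp only [neg_mul, Finset.sum_neg_distrib]
    rw [hK]
  refine X.isMetric.nondeg x _ fun v => ?_
  -- As `g(n, n) = -1`, this is the projection of `v` orthogonal to `n`.
  have hz := hD0 (v + X.g x v n • n) (by
    rw [map_add, LinearMap.add_apply, map_smul, LinearMap.smul_apply, hnn, smul_eq_mul]; ring)
  rw [hDadd] at hz
  rw [superPoynting, ← hn, map_add, LinearMap.add_apply, map_smul, LinearMap.smul_apply, hp,
    X.g_symm x n, hp, X.g_symm x n v, smul_eq_mul]
  linarith

end ConformalCompletion

/-! ### One-variable estimates at the endpoint. -/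

section RealAnalysis

/-- Mean value inequality on `[s, 0]`, where the derivative is bounded by a multiple of `|s| ^ k`.
-/
theorem sub_isBigO_pow_succ {f f' : ℝ → ℝ} {s₁ : ℝ} (hs₁ : s₁ < 0) {k : ℕ}
    (hf : ∀ᶠ t in 𝓝[≤] 0, HasDerivWithinAt f (f' t) (Icc s₁ 0) t)
    (hO : f' =O[𝓝[≤] 0] fun s => s ^ k) :
    (fun s => f s - f 0) =O[𝓝[≤] 0] fun s => s ^ (k + 1) := by
  obtain ⟨C, hC⟩ := hO.bound
  obtain ⟨ε, hε, hb⟩ := Metric.mem_nhdsWithin_iff.1 (hf.and hC)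
  have hnear : ∀ᶠ s : ℝ in 𝓝[≤] 0, s ∈ Metric.ball (0 : ℝ) (min ε (-s₁)) ∩ Iic 0 :=
    inter_mem (nhdsWithin_le_nhds (Metric.ball_mem_nhds _ (lt_min hε (by linarith))))
      self_mem_nhdsWithin
  refine IsBigO.of_bound C ?_
  filter_upwards [hnear] with s hs
  have hs0 : s ≤ 0 := hs.2
  have hsε : |s| < min ε (-s₁) := by simpa [Real.dist_eq] using hs.1
  rw [abs_of_nonpos hs0] at hsε
  have hsub : Icc s 0 ⊆ Icc s₁ 0 := Icc_subset_Icc_left (by linarith [min_le_right ε (-s₁)])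
  have hmem : ∀ r ∈ Icc s 0, r ∈ Metric.ball (0 : ℝ) ε ∩ Iic 0 := by
    intro r hr
    refine ⟨?_, hr.2⟩
    rw [Metric.mem_ball, Real.dist_eq, sub_zero, abs_of_nonpos hr.2]
    linarith [min_le_left ε (-s₁), hr.1]
  have hC0 : 0 ≤ C * ‖s ^ k‖ := le_trans (norm_nonneg _) (hb (hmem s ⟨le_rfl, hs0⟩)).2
  have hbound : ∀ r ∈ Icc s 0, ‖f' r‖ ≤ C * ‖s ^ k‖ := by
    intro r hr
    refine (hb (hmem r hr)).2.trans ?_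
    rcases le_or_gt 0 C with hC' | hC'
    · refine mul_le_mul_of_nonneg_left ?_ hC'
      rw [norm_pow, norm_pow]
      refine pow_le_pow_left₀ (norm_nonneg _) ?_ k
      rw [Real.norm_eq_abs, Real.norm_eq_abs, abs_of_nonpos hr.2, abs_of_nonpos hs0]
      linarith [hr.1]
    · have h1 : C * ‖r ^ k‖ ≤ 0 := mul_nonpos_of_nonpos_of_nonneg hC'.le (norm_nonneg _)
      linarith
  have := (convex_Icc s 0).norm_image_sub_le_of_norm_hasDerivWithin_le
    (fun r hr => ((hb (hmem r hr)).1).mono hsub) hbound (right_mem_Icc.2 hs0) (left_mem_Icc.2 hs0)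
  rw [sub_zero] at this
  rwa [pow_succ, norm_mul, ← mul_assoc]

theorem eq_of_hasDerivWithinAt_zero {f : ℝ → ℝ} {S : Set ℝ} (hS : Convex ℝ S)
    (hf : ∀ t ∈ S, HasDerivWithinAt f 0 S t) {s t : ℝ} (hs : s ∈ S) (ht : t ∈ S) :
    f t = f s := by
  have := hS.norm_image_sub_le_of_norm_hasDerivWithin_le hf (C := 0) (fun r _ => by simp) hs ht
  rw [zero_mul, norm_le_zero_iff, sub_eq_zero] at this
  exact this

/-- A bounded continuous function on `[s₁, 0)` has a primitive vanishing at `0`. -/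
theorem exists_primitive {m : ℝ → ℝ} {s₁ : ℝ} (hs₁ : s₁ < 0) (hm : ContinuousOn m (Ico s₁ 0))
    (hO : m =O[𝓝[<] 0] fun _ => (1 : ℝ)) :
    ∃ I : ℝ → ℝ, (∀ t ∈ Ico s₁ 0, HasDerivWithinAt I (m t) (Ico s₁ 0) t) ∧
      I =O[𝓝[≤] 0] (fun s => s) ∧ I 0 = 0 := by
  -- Freezing `m` to the left of `s₁` makes it continuous on an open half-line, so that the integral
  -- is differentiable from both sides even at `s₁`.
  let m' : ℝ → ℝ := fun t => m (max t s₁)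
  have hm' : ContinuousOn m' (Iio 0) :=
    hm.comp (continuous_id.max continuous_const).continuousOn
      (fun t ht => ⟨le_max_right _ _, max_lt ht hs₁⟩)
  have hmm : ∀ t ∈ Ico s₁ 0, m' t = m t := fun t ht => by simp [m', max_eq_left ht.1]
  let J : ℝ → ℝ := fun t => ∫ r in s₁..t, m' r
  have hJ : ∀ t < 0, HasDerivAt J (m' t) t := by
    intro t ht
    refine intervalIntegral.integral_hasDerivAt_right ?_
      (hm'.stronglyMeasurableAtFilter isOpen_Iio t ht) (hm'.continuousAt (Iio_mem_nhds ht))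
    refine (hm'.mono fun r hr => ?_).intervalIntegrable
    exact lt_of_le_of_lt hr.2 (max_lt hs₁ ht)
  obtain ⟨C, hC⟩ := hO.bound
  obtain ⟨ε, hε, hb⟩ := Metric.mem_nhdsWithin_iff.1 hC
  have hmem : ∀ r ∈ Ioo (-min ε (-s₁)) 0, ‖m' r‖ ≤ C ∧ r ∈ Ico s₁ 0 := by
    intro r hr
    have h1 : r ∈ Ico s₁ 0 := ⟨by linarith [min_le_right ε (-s₁), hr.1], hr.2⟩
    have h2 : r ∈ Metric.ball (0 : ℝ) ε ∩ Iio 0 := by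
      refine ⟨?_, hr.2⟩
      rw [Metric.mem_ball, Real.dist_eq, sub_zero, abs_of_neg hr.2]
      linarith [min_le_left ε (-s₁), hr.1]
    have h3 : ‖m r‖ ≤ C * ‖(1 : ℝ)‖ := hb h2
    rw [norm_one, mul_one] at h3
    exact ⟨by rwa [hmm r h1], h1⟩
  have hδ : 0 < min ε (-s₁) := lt_min hε (by linarith)
  have hLip : LipschitzOnWith C.toNNReal J (Ioo (-min ε (-s₁)) 0) := by
    refine (convex_Ioo _ _).lipschitzOnWith_of_nnnorm_hasDerivWithin_le
      (fun r hr => (hJ r hr.2).hasDerivWithinAt) fun r hr => ?_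
    rw [← NNReal.coe_le_coe, coe_nnnorm, Real.coe_toNNReal']
    exact (hmem r hr).1.trans (le_max_left _ _)
  -- The Lipschitz extension supplies, as `g 0`, the limit of `J` at the endpoint; subtracting it
  -- normalizes the primitive.
  obtain ⟨g, hg, hgJ⟩ := hLip.extend_real
  refine ⟨fun t => if t < 0 then J t - g 0 else 0, fun t ht => ?_, ?_, by simp⟩
  · rw [← hmm t ht]
    refine ((hJ t ht.2).sub_const (g 0)).hasDerivWithinAt.congr_of_eventuallyEq ?_ (by simp [ht.2])
    filter_upwards [self_mem_nhdsWithin] with r hr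
    simp [hr.2]
  · refine IsBigO.of_bound C.toNNReal ?_
    have : ∀ᶠ s : ℝ in 𝓝[≤] 0, s ∈ Ioi (-min ε (-s₁)) ∩ Iic 0 :=
      inter_mem (nhdsWithin_le_nhds (Ioi_mem_nhds (by linarith))) self_mem_nhdsWithin
    filter_upwards [this] with s hs
    by_cases h0 : s < 0
    · have h1 := hg.dist_le_mul s 0
      rw [← hgJ ⟨hs.1, h0⟩, Real.dist_eq, Real.dist_eq, sub_zero] at h1
      simpa [h0] using h1
    · simp only [h0, if_false, norm_zero]
      positivity

theorem hasDerivWithinAt_zero_of_isBigO {f : ℝ → ℝ} {s₁ : ℝ} (h0 : f 0 = 0)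
    (hf : f =O[𝓝[≤] 0] fun s => s ^ 2) : HasDerivWithinAt f 0 (Icc s₁ 0) 0 := by
  rw [hasDerivWithinAt_iff_isLittleO]
  simp only [h0, sub_zero, smul_zero]
  have h1 : (fun s : ℝ => s ^ 2) =o[𝓝[≤] 0] fun s => s := by
    have : (fun s : ℝ => s ^ 2) =o[𝓝 0] fun s => s ^ 1 := isLittleO_pow_pow (by norm_num)
    simp only [pow_one] at this
    exact this.mono nhdsWithin_le_nhds
  exact (hf.trans_isLittleO h1).mono (nhdsWithin_mono _ Icc_subset_Iic_self)

/-- Expansion of `Ω ^ p * D` for `Ω = -s + O(s ^ 3)` and `D = x + y s + o(s)`. -/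
theorem pow_mul_expansion {Ω D : ℝ → ℝ} {x y : ℝ}
    (hΩ : (fun s => Ω s + s) =O[𝓝[<] 0] fun s => s ^ 3)
    (hD : (fun s => D s - x - s * y) =o[𝓝[<] 0] fun s => s) {p : ℕ} (hp : 1 ≤ p) :
    (fun s => Ω s ^ p * D s - s * (if p = 1 then -x else 0)
      - s ^ 2 * (if p = 1 then -y else if p = 2 then x else 0)) =o[𝓝[<] 0] fun s => s ^ 2 := by
  have o₁ : ∀ {k l : ℕ}, l < k → (fun s : ℝ => s ^ k) =o[𝓝[<] 0] fun s => s ^ l := fun h =>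
    (isLittleO_pow_pow h).mono nhdsWithin_le_nhds
  have hid : (fun s : ℝ => s) = fun s => s ^ 1 := by simp
  rw [hid] at hD
  have hx : (fun _ : ℝ => x) =O[𝓝[<] 0] fun s => s ^ 0 := by
    simpa using isBigO_const_const x (one_ne_zero (α := ℝ)) (𝓝[<] (0:ℝ))
  have hDx : (fun s => D s - x) =O[𝓝[<] 0] fun s => s ^ 1 := by
    have h1 : (fun s : ℝ => s * y) =O[𝓝[<] 0] fun s => s ^ 1 := by
      simpa [mul_comm] using (isBigO_refl (fun s : ℝ => s) (𝓝[<] 0)).const_mul_left y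
    have := hD.isBigO.add h1
    simpa using this
  have hD1 : D =O[𝓝[<] 0] fun s => s ^ 0 := by
    have := (hDx.trans (o₁ (by norm_num : 0 < 1)).isBigO).add hx
    simpa using this
  have hΩ1 : Ω =O[𝓝[<] 0] fun s => s ^ 1 := by
    have h1 : (fun s : ℝ => s) =O[𝓝[<] 0] fun s => s ^ 1 := by simpa using isBigO_refl _ _
    have := (hΩ.trans (o₁ (by norm_num : 1 < 3)).isBigO).sub h1
    simpa using this
  rcases Nat.lt_or_ge p 3 with hp3 | hp3
  · interval_cases p
    · simp only [pow_one, if_true]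
      have e : (fun s => Ω s * D s - s * -x - s ^ 2 * -y) =
          fun s => (Ω s + s) * D s - s * (D s - x - s * y) := by
        funext s
        ring
      rw [e]
      refine IsLittleO.sub ?_ ?_
      · have := hΩ.mul hD1
        simp only [← pow_add] at this
        exact this.trans_isLittleO (o₁ (by norm_num))
      · have := (isBigO_refl (fun s : ℝ => s) (𝓝[<] 0)).mul_isLittleO hD
        simpa [pow_two] using this
    · simp only [OfNat.ofNat_ne_one, if_false, if_true, mul_zero, sub_zero]
      have e : (fun s => Ω s ^ 2 * D s - s ^ 2 * x) =
          fun s => (Ω s + s) * ((Ω s - s) * D s) + s ^ 2 * (D s - x) := by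
        funext s
        ring
      rw [e]
      refine IsLittleO.add ?_ ?_
      · have h2 : (fun s => Ω s - s) =O[𝓝[<] 0] fun s => s ^ 1 := by
          have h1 : (fun s : ℝ => s) =O[𝓝[<] 0] fun s => s ^ 1 := by simpa using isBigO_refl _ _
          exact hΩ1.sub h1
        have := hΩ.mul (h2.mul hD1)
        simp only [← pow_add] at this
        exact this.trans_isLittleO (o₁ (by norm_num))
      · have := (isBigO_refl (fun s : ℝ => s ^ 2) (𝓝[<] 0)).mul hDx
        simp only [← pow_add] at this
        exact this.trans_isLittleO (o₁ (by norm_num))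
  · have h1 : p ≠ 1 := by omega
    have h2 : p ≠ 2 := by omega
    simp only [h1, h2, if_false, mul_zero, sub_zero]
    have := (hΩ1.pow p).mul hD1
    simp only [← pow_mul, ← pow_add] at this
    exact this.trans_isLittleO (o₁ (by omega))

/-- Allows hypotheses on arbitrary given coefficients to be transferred to the ones computed
explicitly. -/
theorem peelingCoeffs_unique {d d' e e' : ℝ} {F : ℝ → ℝ}
    (h : (fun s : ℝ => F s - s * d - s ^ 2 * e) =o[𝓝[<] 0] (fun s : ℝ => s ^ 2))
    (h' : (fun s : ℝ => F s - s * d' - s ^ 2 * e') =o[𝓝[<] 0] (fun s : ℝ => s ^ 2)) :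
    d = d' ∧ e = e' := by
  have hne : ∀ᶠ s : ℝ in 𝓝[<] 0, s ≠ 0 := by
    filter_upwards [self_mem_nhdsWithin] with s hs using ne_of_lt hs
  have hlim : Tendsto (fun s : ℝ => s) (𝓝[<] 0) (𝓝 0) := tendsto_id.mono_left nhdsWithin_le_nhds
  have h₁ : (fun s : ℝ => s * (d' - d) + s ^ 2 * (e' - e)) =o[𝓝[<] 0] (fun s : ℝ => s ^ 2) := by
    refine (h.sub h').congr_left fun s => ?_
    ring
  have h₂ := h₁.tendsto_div_nhds_zero
  have hd : d = d' := by
    have h₃ := h₂.mul hlim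
    have h₄ : Tendsto (fun s : ℝ => (d' - d) + s * (e' - e)) (𝓝[<] 0) (𝓝 (d' - d + 0 * (e' - e))) :=
      tendsto_const_nhds.add (hlim.mul_const _)
    have h₅ : Tendsto (fun s : ℝ => (d' - d) + s * (e' - e)) (𝓝[<] 0) (𝓝 (0 * 0)) := by
      refine h₃.congr' ?_
      filter_upwards [hne] with s hs
      field_simp
    have := tendsto_nhds_unique h₄ h₅
    linarith
  refine ⟨hd, ?_⟩
  have h₅ : Tendsto (fun _ : ℝ => e' - e) (𝓝[<] (0:ℝ)) (𝓝 0) := by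
    refine h₂.congr' ?_
    filter_upwards [hne] with s hs
    rw [hd]
    field_simp
    ring
  have := tendsto_nhds_unique tendsto_const_nhds h₅
  linarith

end RealAnalysis

/-! ### Parallel null frames and uniqueness of parallel fields. -/

section ParallelFrames

variable {M : Type*} [TopologicalSpace M] [ChartedSpace (EuclideanHalfSpace 4) M]
  [IsManifold I4 ∞ M]

variable {c : ℝ → M} {u : (t : ℝ) → TangentSpace I4 (c t)} {S : Set ℝ}

theorem IsParallelAlong.metric_eq {h : BilinField M} (hm : IsMetric h) (hs : ∀ x₀, SmoothIn h x₀)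
    (hc : HasVelocity c u S) (hS : Convex ℝ S) {V W : (t : ℝ) → TangentSpace I4 (c t)}
    (hV : IsParallelAlong h c u S V) (hW : IsParallelAlong h c u S W) {s t : ℝ} (h₁ : s ∈ S)
    (h₂ : t ∈ S) : h (c t) (V t) (W t) = h (c s) (V s) (W s) := by
  refine eq_of_hasDerivWithinAt_zero (f := fun t => h (c t) (V t) (W t)) hS (fun r hr => ?_) h₁ h₂
  refine (HasCovDeriv.hasDerivWithinAt_metric hm hs hc hr (hV.hasCovDeriv hr)
    (hW.hasCovDeriv hr)).congr_deriv ?_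
  simp

/-- A null frame parallel along `c`. -/
structure IsParallelNullFrame (h : BilinField M) (c : ℝ → M) (u : (t : ℝ) → TangentSpace I4 (c t))
    (S : Set ℝ) (e : Fin 4 → (t : ℝ) → TangentSpace I4 (c t)) : Prop where
  parallel : ∀ a, IsParallelAlong h c u S (e a)
  null : ∀ t ∈ S, IsNullFrame (h (c t)) fun a => e a t

theorem IsParallelPropagator.isParallelNullFrame {h : BilinField M} (hm : IsMetric h)
    (hs : ∀ x₀, SmoothIn h x₀) (hc : HasVelocity c u S) (hS : Convex ℝ S)
    {τ : (s t : ℝ) → TangentSpace I4 (c s) →ₗ[ℝ] TangentSpace I4 (c t)}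
    (hτ : IsParallelPropagator h c u S τ) {s : ℝ} (h₁ : s ∈ S)
    {f : Fin 4 → TangentSpace I4 (c s)} (hf : IsNullFrame (h (c s)) f) :
    IsParallelNullFrame h c u S fun a t => τ s t (f a) := by
  refine ⟨fun a => (hτ s h₁).2 (f a), fun t ht a b => ?_⟩
  rw [IsParallelAlong.metric_eq hm hs hc hS ((hτ s h₁).2 (f a)) ((hτ s h₁).2 (f b)) h₁ ht]
  simp only [(hτ s h₁).1, LinearMap.id_coe, id]
  exact hf a b

/-- A parallel field is determined by its value at one point. -/
theorem IsParallelAlong.eq_of_eq {h : BilinField M} (hm : IsMetric h)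
    (hs : ∀ x₀, SmoothIn h x₀) (hc : HasVelocity c u S) (hS : Convex ℝ S)
    {e : Fin 4 → (t : ℝ) → TangentSpace I4 (c t)} (he : IsParallelNullFrame h c u S e)
    {V W : (t : ℝ) → TangentSpace I4 (c t)} (hV : IsParallelAlong h c u S V)
    (hW : IsParallelAlong h c u S W) {s t : ℝ} (h₁ : s ∈ S) (h₂ : t ∈ S) (hVW : V s = W s) :
    V t = W t := by
  rw [eq_nullFrame hm (he.null t h₂) (V t), eq_nullFrame hm (he.null t h₂) (W t)]
  have H : ∀ a, h (c t) (V t) (e a t) = h (c t) (W t) (e a t) := fun a => by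
    rw [IsParallelAlong.metric_eq hm hs hc hS hV (he.parallel a) h₁ h₂, hVW,
      IsParallelAlong.metric_eq hm hs hc hS hW (he.parallel a) h₁ h₂]
  simp only [H]

end ParallelFrames

/-! ### Differentiability of tensors and Hessians along a curve. -/

section TensorCurves

variable {M : Type*} [TopologicalSpace M] [ChartedSpace (EuclideanHalfSpace 4) M]
  [IsManifold I4 ∞ M]

variable {c : ℝ → M} {u : (t : ℝ) → TangentSpace I4 (c t)} {S : Set ℝ}

/-- A field along `c` whose components are differentiable at `t`. -/
def IsDifferentiableAlong (c : ℝ → M) (S : Set ℝ) (V : (t : ℝ) → TangentSpace I4 (c t)) (t : ℝ) :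
    Prop := DifferentiableWithinAt ℝ (fun s => inChart (c t) (c s) (V s)) S t

theorem HasCovDeriv.isDifferentiableAlong {h : BilinField M}
    {V : (t : ℝ) → TangentSpace I4 (c t)} {t : ℝ} {D : TangentSpace I4 (c t)}
    (hV : HasCovDeriv h c u S V t D) : IsDifferentiableAlong c S V t :=
  HasDerivWithinAt.differentiableWithinAt hV

theorem IsDifferentiableAlong.add {V W : (t : ℝ) → TangentSpace I4 (c t)} {t : ℝ}
    (hV : IsDifferentiableAlong c S V t) (hW : IsDifferentiableAlong c S W t) :
    IsDifferentiableAlong c S (fun s => V s + W s) t := by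
  unfold IsDifferentiableAlong at *
  simp only [map_add]
  exact hV.add hW

theorem IsDifferentiableAlong.smul {f : ℝ → ℝ} {V : (t : ℝ) → TangentSpace I4 (c t)} {t : ℝ}
    (hf : DifferentiableWithinAt ℝ f S t) (hV : IsDifferentiableAlong c S V t) :
    IsDifferentiableAlong c S (fun s => f s • V s) t := by
  unfold IsDifferentiableAlong at *
  simp only [map_smul]
  exact hf.smul hV

theorem differentiableWithinAt_tensor {T : (x : M) → Tensor4 x}
    (hT : ∀ x₀ i j k l, ContDiffOn ℝ ∞ (fun y => compTensor T x₀ y i j k l) (extChartAt I4 x₀).target)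
    (hc : HasVelocity c u S) {t : ℝ} (ht : t ∈ S) {V : Fin 4 → (t : ℝ) → TangentSpace I4 (c t)}
    (hV : ∀ m, IsDifferentiableAlong c S (V m) t) :
    DifferentiableWithinAt ℝ (fun s => T (c s) fun m => V m s) S t := by
  have hx := mem_extChartAt_source (I := I4) (c t)
  have h : DifferentiableWithinAt ℝ (fun s => ∑ r : Fin 4 → Fin 4,
      (∏ m, inChart (c t) (c s) (V m s) (r m)) *
      compTensor T (c t) (extChartAt I4 (c t) (c s)) (r 0) (r 1) (r 2) (r 3)) S t := by
    refine DifferentiableWithinAt.fun_sum fun r _ => DifferentiableWithinAt.mul ?_ ?_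
    · refine DifferentiableWithinAt.fun_finsetProd fun m _ => ?_
      exact ((EuclideanSpace.proj (𝕜 := ℝ) (r m)).differentiableAt).comp_differentiableWithinAt t
        (hV m)
    · have hd := (ContDiffOn.contDiffWithinAt_range (hT (c t) (r 0) (r 1) (r 2) (r 3))
        (mem_extChartAt_target (c t))).differentiableWithinAt (by simp)
      exact (hasDerivWithinAt_comp_curve (x := fun s => extChartAt I4 (c t) (c s))
        hd.hasFDerivWithinAt (hc.hasDerivWithinAt_self ht)
        (fun s => mem_range_self _)).differentiableWithinAt
  refine h.congr_of_eventuallyEq ?_ (compTensor_self T hx _)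
  filter_upwards [hc.eventually_mem ht hx] with s hs using compTensor_self T hs _

theorem differentiableWithinAt_hessianIn {h : BilinField M} (hm : IsMetric h)
    (hs : ∀ x₀, SmoothIn h x₀) {f : M → ℝ} (hf : ContMDiff I4 𝓘(ℝ, ℝ) ∞ f)
    (hc : HasVelocity c u S) {t : ℝ} (ht : t ∈ S) {U V : (t : ℝ) → TangentSpace I4 (c t)}
    (hU : IsDifferentiableAlong c S U t) (hV : IsDifferentiableAlong c S V t) :
    DifferentiableWithinAt ℝ (fun s => hessianIn h f (c t) (extChartAt I4 (c t) (c s))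
      (inChart (c t) (c s) (U s)) (inChart (c t) (c s) (V s))) S t := by
  have hx := mem_extChartAt_source (I := I4) (c t)
  have hy : extChartAt I4 (c t) (c t) ∈ range I4 := mem_range_self _
  have hf' := contDiffWithinAt_funIn hf hx
  have hd := hf'.fderivWithin_right (m := ∞) I4.uniqueDiffOn (by simp) hy
  have hdd := hd.fderivWithin_right (m := ∞) I4.uniqueDiffOn (by simp) hy
  have key : ∀ {F : Type} [NormedAddCommGroup F] [NormedSpace ℝ F] {B : E4 → F},
      ContDiffWithinAt ℝ ∞ B (range I4) (extChartAt I4 (c t) (c t)) →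
      DifferentiableWithinAt ℝ (fun s => B (extChartAt I4 (c t) (c s))) S t := by
    intro F _ _ B hB
    exact (hasDerivWithinAt_comp_curve (x := fun s => extChartAt I4 (c t) (c s))
        (hB.differentiableWithinAt (by simp)).hasFDerivWithinAt (hc.hasDerivWithinAt_self ht)
        (fun s => mem_range_self _)).differentiableWithinAt
  have hcomp : ∀ {V : (t : ℝ) → TangentSpace I4 (c t)} (_ : IsDifferentiableAlong c S V t) i,
      DifferentiableWithinAt ℝ (fun s => inChart (c t) (c s) (V s) i) S t := fun h i =>
    ((EuclideanSpace.proj (𝕜 := ℝ) i).differentiableAt).comp_differentiableWithinAt t h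
  unfold hessianIn
  refine DifferentiableWithinAt.sub ?_ ?_
  · exact ((key (F := E4 →L[ℝ] E4 →L[ℝ] ℝ) hdd).clm_apply hU).clm_apply hV
  · refine (key (F := E4 →L[ℝ] ℝ) hd).clm_apply ?_
    rw [differentiableWithinAt_euclidean]
    intro i
    simp only [gamma]
    refine DifferentiableWithinAt.fun_sum fun j _ => DifferentiableWithinAt.fun_sum fun k _ => ?_
    refine DifferentiableWithinAt.mul (DifferentiableWithinAt.mul ?_ (hcomp hU j)) (hcomp hV k)
    refine key (contDiffWithinAt_christoffel (hm.at _) (mem_extChartAt_target _) (fun i j => ?_)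
      i j k)
    exact ContDiffOn.contDiffWithinAt_range (hs (c t) i j) (mem_extChartAt_target _)

end TensorCurves

/-! ### Expansion of the conformal factor, and the integration of physical parallel transport. -/

namespace ConformalCompletion

variable {M : Type*} [TopologicalSpace M] [ChartedSpace (EuclideanHalfSpace 4) M]
  [IsManifold I4 ∞ M] {Λ : ℝ} {X : ConformalCompletion M Λ}
  {c : ℝ → M} {u : (t : ℝ) → TangentSpace I4 (c t)} {s₁ : ℝ}
  {e : Fin 4 → (t : ℝ) → TangentSpace I4 (c t)}

/-- A parallel null frame along a geodesic arriving at `𝒥`, adapted to its tangent and to the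
normal `N` at the endpoint. -/
structure IsArrivingFrame (X : ConformalCompletion M Λ) (c : ℝ → M)
    (u : (t : ℝ) → TangentSpace I4 (c t)) (s₁ : ℝ)
    (e : Fin 4 → (t : ℝ) → TangentSpace I4 (c t)) : Prop where
  neg : s₁ < 0
  velocity : HasVelocity c u (Icc s₁ 0)
  frame : IsParallelNullFrame X.g c u (Icc s₁ 0) e
  tangent : ∀ t ∈ Icc s₁ 0, e 0 t = u t
  boundary : c 0 ∈ I4.boundary M
  physical : ∀ t ∈ Ico s₁ 0, c t ∉ I4.boundary M
  normal : ∃ q : ℝ, X.N (c 0) = e 3 0 + q • e 0 0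

/-- The derivative of `Ω` in the direction of the `a`-th vector of the frame. -/
def frameDeriv (X : ConformalCompletion M Λ) (e : Fin 4 → (t : ℝ) → TangentSpace I4 (c t))
    (a : Fin 4) (t : ℝ) : ℝ := differential X.Ω (c t) (e a t)

theorem hasDerivWithinAt_isBigO_sub {f : ℝ → ℝ} {f' : ℝ}
    (h : HasDerivWithinAt f f' (Icc s₁ 0) 0) (hs₁ : s₁ < 0) :
    (fun s => f s - f 0) =O[𝓝[≤] 0] fun s => s := by
  have := h.isBigO_sub
  rw [nhdsWithin_Icc_eq_nhdsLE hs₁] at this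
  simpa [Function.comp_def] using this

theorem nhdsWithin_Icc_eq (h : s₁ < 0) : 𝓝[Icc s₁ 0] (0 : ℝ) = 𝓝[≤] 0 :=
  nhdsWithin_Icc_eq_nhdsLE h

namespace IsArrivingFrame

variable (H : X.IsArrivingFrame c u s₁ e)
include H

theorem zero_mem : (0 : ℝ) ∈ Icc s₁ 0 := ⟨H.neg.le, le_rfl⟩

theorem omega_pos {t : ℝ} (ht : t ∈ Ico s₁ 0) : 0 < X.Ω (c t) := X.Ω_pos _ (H.physical t ht)

theorem omega_zero : X.Ω (c 0) = 0 := X.Ω_zero _ H.boundary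

/-- `dΩ(e a) = g(N, e a)` with `N = e 3 + q • e 0`; the term with `q` contributes only for `a = 3`.
-/
theorem frameDeriv_zero (a : Fin 4) (ha : a ≠ 3) : frameDeriv X e a 0 = nullGram 3 a := by
  obtain ⟨q, hq⟩ := H.normal
  have h : ∀ i j, X.g (c 0) (e i 0) (e j 0) = nullGram i j := H.frame.null 0 H.zero_mem
  rw [frameDeriv, ← X.metric_N, hq]
  simp only [map_add, map_smul, LinearMap.add_apply, LinearMap.smul_apply, h]
  fin_cases a <;> simp [nullGram] at ha ⊢

theorem hasDerivWithinAt_frameDeriv (a : Fin 4) {t : ℝ} (ht : t ∈ Icc s₁ 0) {x₀ : M}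
    (hx : c t ∈ (extChartAt I4 x₀).source) :
    HasDerivWithinAt (frameDeriv X e a) (hessianIn X.g X.Ω x₀ (extChartAt I4 x₀ (c t))
      (inChart x₀ (c t) (u t)) (inChart x₀ (c t) (e a t))) (Icc s₁ 0) t :=
  (H.frame.parallel a).hasDerivWithinAt_differential X.isMetric X.smoothIn H.velocity X.Ω_smooth
    ht hx

/-- The derivative of `dΩ(e a)` is a Hessian component. It is differentiable at the endpoint and
vanishes there by the gauge condition, so it is `O(s)`; integration gains one power. -/
theorem frameDeriv_isBigO (a : Fin 4) :
    (fun s => frameDeriv X e a s - frameDeriv X e a 0) =O[𝓝[≤] 0] fun s => s ^ 2 := by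
  have hx := mem_extChartAt_source (I := I4) (c 0)
  have hnear := H.velocity.eventually_mem H.zero_mem hx
  have hself : ∀ᶠ t in 𝓝[Icc s₁ 0] (0 : ℝ), t ∈ Icc s₁ 0 := self_mem_nhdsWithin
  rw [nhdsWithin_Icc_eq H.neg] at hnear hself
  refine sub_isBigO_pow_succ (k := 1) H.neg (f' := fun t => hessianIn X.g X.Ω (c 0)
      (extChartAt I4 (c 0) (c t)) (inChart (c 0) (c t) (u t)) (inChart (c 0) (c t) (e a t))) ?_ ?_
  · filter_upwards [hnear, hself] with t h₁ h₂
    exact H.hasDerivWithinAt_frameDeriv a h₂ h₁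
  · have hd := fun a => ((H.frame.parallel a).hasCovDeriv H.zero_mem).isDifferentiableAlong
    have := differentiableWithinAt_hessianIn X.isMetric X.smoothIn X.Ω_smooth H.velocity H.zero_mem
      (hd 0) (hd a)
    have h₀ := hasDerivWithinAt_isBigO_sub this.hasDerivWithinAt H.neg
    have hz : ∀ U V : E4, hessianIn X.g X.Ω (c 0) (extChartAt I4 (c 0) (c 0)) U V = 0 := by
      intro U V
      rw [hessianIn_self X.g X.Ω_smooth]
      refine Finset.sum_eq_zero fun i _ => Finset.sum_eq_zero fun j _ => ?_
      rw [X.gauge _ H.boundary, mul_zero]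
    simp only [hz, sub_zero, pow_one] at h₀ ⊢
    refine h₀.congr' ?_ EventuallyEq.rfl
    filter_upwards [hself] with t ht
    rw [H.tangent t ht]

theorem hasDerivWithinAt_omega {t : ℝ} (ht : t ∈ Icc s₁ 0) :
    HasDerivWithinAt (fun s => X.Ω (c s)) (frameDeriv X e 0 t) (Icc s₁ 0) t := by
  rw [frameDeriv, H.tangent t ht]
  exact H.velocity.hasDerivWithinAt_fun X.Ω_smooth ht

/-- Integrates `dΩ(e 0) = -1 + O(s²)`. The absence of an `s²` term keeps the second peeling
coefficient free of a correction from `Ω` at weight two. -/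
theorem omega_isBigO : (fun s => X.Ω (c s) + s) =O[𝓝[≤] 0] fun s => s ^ 3 := by
  have hself : ∀ᶠ t in 𝓝[Icc s₁ 0] (0 : ℝ), t ∈ Icc s₁ 0 := self_mem_nhdsWithin
  rw [nhdsWithin_Icc_eq H.neg] at hself
  have := sub_isBigO_pow_succ (k := 2) H.neg (f := fun s => X.Ω (c s) + s)
    (f' := fun t => frameDeriv X e 0 t - frameDeriv X e 0 0) ?_ (H.frameDeriv_isBigO 0)
  · simpa [H.omega_zero] using this
  · filter_upwards [hself] with t ht
    refine ((H.hasDerivWithinAt_omega ht).add (hasDerivWithinAt_id t _)).congr_deriv ?_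
    rw [H.frameDeriv_zero 0 (by decide)]
    simp [nullGram]

theorem omega_isBigO_id : (fun s => X.Ω (c s)) =O[𝓝[≤] 0] fun s => s := by
  have h := hasDerivWithinAt_isBigO_sub (H.hasDerivWithinAt_omega H.zero_mem) H.neg
  simpa [H.omega_zero] using h

theorem id_isBigO_omega : (fun s : ℝ => s) =O[𝓝[<] 0] fun s => X.Ω (c s) := by
  have h₁ : (fun s => X.Ω (c s) + s) =o[𝓝[<] 0] fun s : ℝ => s := by
    refine (H.omega_isBigO.mono (nhdsWithin_mono _ Iio_subset_Iic_self)).trans_isLittleO ?_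
    have : (fun s : ℝ => s ^ 3) =o[𝓝 0] fun s => s ^ 1 := isLittleO_pow_pow (by norm_num)
    simp only [pow_one] at this
    exact this.mono nhdsWithin_le_nhds
  have h₂ := h₁.right_isBigO_sub.neg_right
  simpa using h₂

/-- A primitive of `Ω⁻² dΩ(eₐ)`. -/
theorem exists_primitive_frameDeriv (a : Fin 4) (ha : frameDeriv X e a 0 = 0) :
    ∃ I : ℝ → ℝ, (∀ t ∈ Ico s₁ 0,
      HasDerivWithinAt I (frameDeriv X e a t / X.Ω (c t) ^ 2) (Ico s₁ 0) t) ∧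
      I =O[𝓝[≤] 0] (fun s => s) ∧ I 0 = 0 := by
  refine exists_primitive H.neg ?_ ?_
  · intro t ht
    have ht' := Ico_subset_Icc_self ht
    have h₁ := (H.hasDerivWithinAt_frameDeriv a ht'
      (mem_extChartAt_source (c t))).continuousWithinAt.mono Ico_subset_Icc_self
    have h₂ := (H.hasDerivWithinAt_omega ht').continuousWithinAt.mono Ico_subset_Icc_self
    exact h₁.div (h₂.pow 2) (pow_ne_zero 2 (H.omega_pos ht).ne')
  -- The integrand is bounded since `dΩ(e a) = O(s²) = O(Ω²)`.
  · have h₁ := (H.frameDeriv_isBigO a).mono (nhdsWithin_mono _ Iio_subset_Iic_self)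
    simp only [ha, sub_zero] at h₁
    have h₂ := h₁.trans (H.id_isBigO_omega.pow 2)
    have hne : ∀ᶠ s in 𝓝[<] (0 : ℝ), X.Ω (c s) ^ 2 ≠ 0 := by
      filter_upwards [Ico_mem_nhdsLT H.neg] with s hs using pow_ne_zero 2 (H.omega_pos hs).ne'
    refine (h₂.mul (isBigO_refl (fun s => (X.Ω (c s) ^ 2)⁻¹) _)).congr' ?_ ?_
    · exact Eventually.of_forall fun s => (div_eq_mul_inv _ _).symm
    · filter_upwards [hne] with s hs using mul_inv_cancel₀ hs

/-- The conformal change of connection, read as an equation for the `g`-covariant derivative of a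
`ĝ`-parallel field. -/
theorem hasCovDeriv_of_ghat {V : (t : ℝ) → TangentSpace I4 (c t)}
    (hV : IsParallelAlong X.ghat c u (Ico s₁ 0) V) {t : ℝ} (ht : t ∈ Ico s₁ 0) :
    HasCovDeriv X.g c u (Ico s₁ 0) V t ((X.Ω (c t))⁻¹ • (differential X.Ω (c t) (u t) • V t
      + differential X.Ω (c t) (V t) • u t - X.g (c t) (u t) (V t) • X.N (c t))) := by
  have h := hV.hasCovDeriv ht
  unfold HasCovDeriv at h ⊢
  refine HasDerivWithinAt.congr_deriv h ?_
  rw [ghat, gamma_rescale X.isMetric X.smoothIn X.Ω_smooth (H.omega_pos ht).ne' (u t) (V t)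
    (X.N (c t)) (X.metric_N (c t))]
  have e : comps (0 : TangentSpace I4 (c t)) = 0 := rfl
  rw [e]
  abel

/-- The components, in the parallel frame of `g`, of a field which is parallel for the physical
metric satisfy a linear system. -/
theorem hasDerivWithinAt_coeff {V : (t : ℝ) → TangentSpace I4 (c t)}
    (hV : IsParallelAlong X.ghat c u (Ico s₁ 0) V) (a : Fin 4) {t : ℝ} (ht : t ∈ Ico s₁ 0) :
    HasDerivWithinAt (fun s => X.g (c s) (V s) (e a s))
      ((X.Ω (c t))⁻¹ * (frameDeriv X e 0 t * X.g (c t) (V t) (e a t)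
        + (X.g (c t) (V t) (e 1 t) * frameDeriv X e 1 t
          + X.g (c t) (V t) (e 2 t) * frameDeriv X e 2 t
          - X.g (c t) (V t) (e 0 t) * frameDeriv X e 3 t
          - X.g (c t) (V t) (e 3 t) * frameDeriv X e 0 t) * nullGram 0 a
        - X.g (c t) (V t) (e 0 t) * frameDeriv X e a t)) (Ico s₁ 0) t := by
  have ht' := Ico_subset_Icc_self ht
  refine (HasCovDeriv.hasDerivWithinAt_metric X.isMetric X.smoothIn
    (H.velocity.mono Ico_subset_Icc_self) ht (H.hasCovDeriv_of_ghat hV ht)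
    (((H.frame.parallel a).hasCovDeriv ht').mono Ico_subset_Icc_self)).congr_deriv ?_
  have h₁ := linear_eq_nullFrame X.isMetric (H.frame.null t ht') (V t) (differential X.Ω (c t))
  have h₂ : X.g (c t) (e 0 t) (e a t) = nullGram 0 a := H.frame.null t ht' 0 a
  rw [← H.tangent t ht', h₁]
  simp only [frameDeriv, map_add, map_sub, map_smul, LinearMap.add_apply, LinearMap.sub_apply,
    LinearMap.smul_apply, h₂, X.metric_N, X.g_symm _ (e 0 t) (V t), smul_eq_mul, map_zero]
  ring

/-- The constants of motion of the system of `hasDerivWithinAt_coeff`. -/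
theorem coeff_conserved {V : (t : ℝ) → TangentSpace I4 (c t)}
    (hV : IsParallelAlong X.ghat c u (Ico s₁ 0) V) {I : Fin 4 → ℝ → ℝ}
    (hI : ∀ a, a = 1 ∨ a = 2 → ∀ t ∈ Ico s₁ 0,
      HasDerivWithinAt (I a) (frameDeriv X e a t / X.Ω (c t) ^ 2) (Ico s₁ 0) t) {t : ℝ}
    (ht : t ∈ Ico s₁ 0) {A : Fin 4 → ℝ → ℝ} (hA : ∀ a s, A a s = X.g (c s) (V s) (e a s)) :
    A 0 t = A 0 s₁ ∧
    (∀ a, a = 1 ∨ a = 2 →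
      A a t / X.Ω (c t) + A 0 t * I a t = A a s₁ / X.Ω (c s₁) + A 0 s₁ * I a s₁) ∧
    A 3 t / X.Ω (c t) ^ 2 + A 1 t / X.Ω (c t) * I 1 t + A 2 t / X.Ω (c t) * I 2 t
        + A 0 t * ((I 1 t ^ 2 + I 2 t ^ 2) / 2) =
      A 3 s₁ / X.Ω (c s₁) ^ 2 + A 1 s₁ / X.Ω (c s₁) * I 1 s₁ + A 2 s₁ / X.Ω (c s₁) * I 2 s₁
        + A 0 s₁ * ((I 1 s₁ ^ 2 + I 2 s₁ ^ 2) / 2) := by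
  have hmem : s₁ ∈ Ico s₁ 0 := ⟨le_rfl, H.neg⟩
  have hΩ : ∀ s ∈ Ico s₁ 0,
      HasDerivWithinAt (fun s => X.Ω (c s)) (frameDeriv X e 0 s) (Ico s₁ 0) s := fun s hs =>
    (H.hasDerivWithinAt_omega (Ico_subset_Icc_self hs)).mono Ico_subset_Icc_self
  -- With `nₐ = dΩ(e a)` the system is `A₀' = 0`, `Ω Aₐ' = n₀ Aₐ - A₀ nₐ` for `a = 1, 2`, and `Ω A₃'
  -- = 2 n₀ A₃ - A₁ n₁ - A₂ n₂`; `n₃` cancels. As `Ω' = n₀`, the natural variables are `A₀`, `Aₐ /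
  -- Ω` and `A₃ / Ω²`.
  have hA' := fun (a : Fin 4) {s : ℝ} (hs : s ∈ Ico s₁ 0) => H.hasDerivWithinAt_coeff hV a hs
  simp only [← hA] at hA'
  refine ⟨?_, fun a ha => ?_, ?_⟩
  · refine eq_of_hasDerivWithinAt_zero (convex_Ico s₁ 0) (fun s hs => ?_) hmem ht
    refine (hA' 0 hs).congr_deriv ?_
    simp only [nullGram]
    simp
    right
    ring
  · refine eq_of_hasDerivWithinAt_zero (f := fun t => A a t / X.Ω (c t) + A 0 t * I a t)
      (convex_Ico s₁ 0) (fun s hs => ?_) hmem ht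
    have hne := (H.omega_pos hs).ne'
    refine (((hA' a hs).div (hΩ s hs) hne).add ((hA' 0 hs).mul (hI a ha s hs))).congr_deriv ?_
    rcases ha with rfl | rfl <;> simp [nullGram] <;> field_simp <;> ring
  · refine eq_of_hasDerivWithinAt_zero (f := fun t => A 3 t / X.Ω (c t) ^ 2
      + A 1 t / X.Ω (c t) * I 1 t + A 2 t / X.Ω (c t) * I 2 t
        + A 0 t * ((I 1 t ^ 2 + I 2 t ^ 2) / 2)) (convex_Ico s₁ 0) (fun s hs => ?_) hmem ht
    have hne := (H.omega_pos hs).ne'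
    have i₁ := hI 1 (Or.inl rfl) s hs
    have i₂ := hI 2 (Or.inr rfl) s hs
    refine (((((hA' 3 hs).div ((hΩ s hs).pow 2) (pow_ne_zero 2 hne)).add
      (((hA' 1 hs).div (hΩ s hs) hne).mul i₁)).add (((hA' 2 hs).div (hΩ s hs) hne).mul i₂)).add
      ((hA' 0 hs).mul (((i₁.pow 2).add (i₂.pow 2)).div_const 2))).congr_deriv ?_
    simp [nullGram]
    field_simp
    ring

end IsArrivingFrame

end ConformalCompletion

/-- The powers of `Ω` by which the vectors of a null frame are scaled. -/
def weight : Fin 4 → ℕ := ![2, 1, 1, 0]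

/-! ### The scaled frame, in which physically parallel fields have constant components. -/

namespace ConformalCompletion

variable {M : Type*} [TopologicalSpace M] [ChartedSpace (EuclideanHalfSpace 4) M]
  [IsManifold I4 ∞ M] {Λ : ℝ} {X : ConformalCompletion M Λ}
  {c : ℝ → M} {u : (t : ℝ) → TangentSpace I4 (c t)} {s₁ : ℝ}
  {e : Fin 4 → (t : ℝ) → TangentSpace I4 (c t)}

/-- A frame regular at `𝒥` which, scaled with powers of `Ω`, is parallel for the physical metric. -/
def scaledFrame (X : ConformalCompletion M Λ) (e : Fin 4 → (t : ℝ) → TangentSpace I4 (c t))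
    (I : Fin 4 → ℝ → ℝ) : Fin 4 → (t : ℝ) → TangentSpace I4 (c t) :=
  ![e 0, fun t => e 1 t + (X.Ω (c t) * I 1 t) • e 0 t,
    fun t => e 2 t + (X.Ω (c t) * I 2 t) • e 0 t,
    fun t => e 3 t + ((X.Ω (c t) * I 1 t) • e 1 t + ((X.Ω (c t) * I 2 t) • e 2 t
      + (2⁻¹ * ((X.Ω (c t) * I 1 t) * (X.Ω (c t) * I 1 t)
        + (X.Ω (c t) * I 2 t) * (X.Ω (c t) * I 2 t))) • e 0 t))]

/-- The frame is the null rotation of `e` about `e 0` with parameters `Ω I₁` and `Ω I₂`. -/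
theorem scaledFrame_apply (I : Fin 4 → ℝ → ℝ) (t : ℝ) :
    scaledFrame X e I 0 t = e 0 t ∧
    scaledFrame X e I 1 t = e 1 t + (X.Ω (c t) * I 1 t) • e 0 t ∧
    scaledFrame X e I 2 t = e 2 t + (X.Ω (c t) * I 2 t) • e 0 t ∧
    scaledFrame X e I 3 t = e 3 t + ((X.Ω (c t) * I 1 t) • e 1 t + ((X.Ω (c t) * I 2 t) • e 2 t
      + (2⁻¹ * ((X.Ω (c t) * I 1 t) * (X.Ω (c t) * I 1 t)
        + (X.Ω (c t) * I 2 t) * (X.Ω (c t) * I 2 t))) • e 0 t)) := ⟨rfl, rfl, rfl, rfl⟩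

/-- The constant components, in the scaled frame, of a field which is parallel for the physical
metric and which at parameter `s₁` has the components of `v` in the parallel frame. -/
def scaledCoeff (X : ConformalCompletion M Λ) (e : Fin 4 → (t : ℝ) → TangentSpace I4 (c t))
    (I : Fin 4 → ℝ → ℝ) (s₁ : ℝ) : TangentSpace I4 (c 0) →ₗ[ℝ] (Fin 4 → ℝ) :=
  let A := fun a => (X.g (c 0)).flip (e a 0)
  LinearMap.pi ![
    -((X.Ω (c s₁) ^ 2)⁻¹ • A 3 + ((X.Ω (c s₁))⁻¹ * I 1 s₁) • A 1
      + ((X.Ω (c s₁))⁻¹ * I 2 s₁) • A 2 + ((I 1 s₁ ^ 2 + I 2 s₁ ^ 2) / 2) • A 0),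
    (X.Ω (c s₁))⁻¹ • A 1 + I 1 s₁ • A 0, (X.Ω (c s₁))⁻¹ • A 2 + I 2 s₁ • A 0, -A 0]

theorem scaledCoeff_apply (I : Fin 4 → ℝ → ℝ) (v : TangentSpace I4 (c 0)) :
    scaledCoeff X e I s₁ v 0 = -(X.g (c 0) v (e 3 0) / X.Ω (c s₁) ^ 2
      + X.g (c 0) v (e 1 0) / X.Ω (c s₁) * I 1 s₁ + X.g (c 0) v (e 2 0) / X.Ω (c s₁) * I 2 s₁
        + X.g (c 0) v (e 0 0) * ((I 1 s₁ ^ 2 + I 2 s₁ ^ 2) / 2)) ∧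
    scaledCoeff X e I s₁ v 1 =
      X.g (c 0) v (e 1 0) / X.Ω (c s₁) + X.g (c 0) v (e 0 0) * I 1 s₁ ∧
    scaledCoeff X e I s₁ v 2 =
      X.g (c 0) v (e 2 0) / X.Ω (c s₁) + X.g (c 0) v (e 0 0) * I 2 s₁ ∧
    scaledCoeff X e I s₁ v 3 = -X.g (c 0) v (e 0 0) := by
  refine ⟨?_, ?_, ?_, ?_⟩ <;> simp [scaledCoeff] <;> ring

namespace IsArrivingFrame

variable (H : X.IsArrivingFrame c u s₁ e)
include H

/-- The rotation parameters `Ω Iₐ` are `O(s²)`, hence have derivative zero at the endpoint. -/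
theorem isDifferentiableAlong_scaledFrame {I : Fin 4 → ℝ → ℝ}
    (hI : ∀ a, a = 1 ∨ a = 2 → I a =O[𝓝[≤] 0] (fun s => s)) (a : Fin 4) :
    IsDifferentiableAlong c (Icc s₁ 0) (scaledFrame X e I a) 0 := by
  have he := fun a => ((H.frame.parallel a).hasCovDeriv H.zero_mem).isDifferentiableAlong
  have hd : ∀ a, a = 1 ∨ a = 2 →
      DifferentiableWithinAt ℝ (fun s => X.Ω (c s) * I a s) (Icc s₁ 0) 0 := by
    intro a ha
    refine (hasDerivWithinAt_zero_of_isBigO ?_ ?_).differentiableWithinAt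
    · simp [H.omega_zero]
    · simpa [pow_two] using H.omega_isBigO_id.mul (hI a ha)
  have d₁ := hd 1 (Or.inl rfl)
  have d₂ := hd 2 (Or.inr rfl)
  fin_cases a
  · exact he 0
  · exact (he 1).add ((he 0).smul d₁)
  · exact (he 2).add ((he 0).smul d₂)
  · exact (he 3).add (((he 1).smul d₁).add (((he 2).smul d₂).add
      ((he 0).smul (((d₁.mul d₁).add (d₂.mul d₂)).const_mul 2⁻¹))))

theorem scaledFrame_zero (I : Fin 4 → ℝ → ℝ) (a : Fin 4) : scaledFrame X e I a 0 = e a 0 := by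
  have h : ∀ (r : ℝ) (w : TangentSpace I4 (c 0)), (X.Ω (c 0) * r) • w = 0 := fun r w => by
    rw [H.omega_zero, zero_mul, zero_smul]
  obtain ⟨h₀, h₁, h₂, h₃⟩ := scaledFrame_apply (X := X) (e := e) I 0
  fin_cases a
  · exact h₀
  · refine h₁.trans ?_
    rw [h, add_zero]
    rfl
  · refine h₂.trans ?_
    rw [h, add_zero]
    rfl
  · refine h₃.trans ?_
    simp only [H.omega_zero, zero_mul, mul_zero, zero_smul, add_zero]
    rfl

theorem scaledCoeff_surjective (I : Fin 4 → ℝ → ℝ) :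
    Function.Surjective (scaledCoeff X e I s₁) := by
  intro q
  have hne := (H.omega_pos ⟨le_rfl, H.neg⟩).ne'
  have h : ∀ i j, X.g (c 0) (e i 0) (e j 0) = nullGram i j := H.frame.null 0 H.zero_mem
  -- Found by solving the triangular equations of `scaledCoeff_apply` in the order `A₀ = -q 3`, then
  -- `A₁` and `A₂`, then `A₃`.
  refine ⟨(X.Ω (c s₁) * (q 1 + q 3 * I 1 s₁)) • e 1 0 + (X.Ω (c s₁) * (q 2 + q 3 * I 2 s₁)) • e 2 0
    + q 3 • e 3 0 + (X.Ω (c s₁) ^ 2 * (q 0 + q 1 * I 1 s₁ + q 2 * I 2 s₁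
      + q 3 * ((I 1 s₁ ^ 2 + I 2 s₁ ^ 2) / 2))) • e 0 0, ?_⟩
  set v := (X.Ω (c s₁) * (q 1 + q 3 * I 1 s₁)) • e 1 0 + (X.Ω (c s₁) * (q 2 + q 3 * I 2 s₁)) • e 2 0
    + q 3 • e 3 0 + (X.Ω (c s₁) ^ 2 * (q 0 + q 1 * I 1 s₁ + q 2 * I 2 s₁
      + q 3 * ((I 1 s₁ ^ 2 + I 2 s₁ ^ 2) / 2))) • e 0 0 with hv
  have hg : ∀ a, X.g (c 0) v (e a 0) = X.Ω (c s₁) * (q 1 + q 3 * I 1 s₁) * nullGram 1 a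
      + X.Ω (c s₁) * (q 2 + q 3 * I 2 s₁) * nullGram 2 a + q 3 * nullGram 3 a
      + X.Ω (c s₁) ^ 2 * (q 0 + q 1 * I 1 s₁ + q 2 * I 2 s₁
        + q 3 * ((I 1 s₁ ^ 2 + I 2 s₁ ^ 2) / 2)) * nullGram 0 a := by
    intro a
    simp only [hv, map_add, map_smul, LinearMap.add_apply, LinearMap.smul_apply, h, smul_eq_mul]
  obtain ⟨h₀, h₁, h₂, h₃⟩ := scaledCoeff_apply (X := X) (e := e) (s₁ := s₁) I v
  funext a
  fin_cases a
  · refine h₀.trans ?_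
    simp [hg, nullGram]
    field_simp
    ring
  · refine h₁.trans ?_
    simp [hg, nullGram]
    field_simp
    ring
  · refine h₂.trans ?_
    simp [hg, nullGram]
    field_simp
    ring
  · refine h₃.trans ?_
    simp [hg, nullGram]

/-- In these coordinates the metric is still a multiple of the standard null form, so whether a
principal direction is null can be read off from its coordinates. -/
theorem metric_scaledCoeff (I : Fin 4 → ℝ → ℝ) (v : TangentSpace I4 (c 0)) :
    X.g (c 0) v v = X.Ω (c s₁) ^ 2 * (scaledCoeff X e I s₁ v 1 ^ 2 + scaledCoeff X e I s₁ v 2 ^ 2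
      - 2 * scaledCoeff X e I s₁ v 0 * scaledCoeff X e I s₁ v 3) := by
  have hne := (H.omega_pos ⟨le_rfl, H.neg⟩).ne'
  obtain ⟨h₀, h₁, h₂, h₃⟩ := scaledCoeff_apply (X := X) (e := e) (s₁ := s₁) I v
  have hn := H.frame.null 0 H.zero_mem
  have := linear_eq_nullFrame X.isMetric hn v (X.g (c 0) v)
  rw [this, h₀, h₁, h₂, h₃]
  field_simp
  ring

theorem scaledCoeff_injective (I : Fin 4 → ℝ → ℝ) {v : TangentSpace I4 (c 0)}
    (hv : scaledCoeff X e I s₁ v = 0) : v = 0 := by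
  have hne := (H.omega_pos ⟨le_rfl, H.neg⟩).ne'
  obtain ⟨h₀, h₁, h₂, h₃⟩ := scaledCoeff_apply (X := X) (e := e) (s₁ := s₁) I v
  rw [hv] at h₀ h₁ h₂ h₃
  simp only [Pi.zero_apply] at h₀ h₁ h₂ h₃
  have g₀ : X.g (c 0) v (e 0 0) = 0 := by linarith
  simp only [g₀, zero_mul, add_zero] at h₀ h₁ h₂
  have g₁ : X.g (c 0) v (e 1 0) = 0 := by
    rcases div_eq_zero_iff.1 h₁.symm with h | h
    · exact h
    · exact absurd h hne
  have g₂ : X.g (c 0) v (e 2 0) = 0 := by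
    rcases div_eq_zero_iff.1 h₂.symm with h | h
    · exact h
    · exact absurd h hne
  simp only [g₁, g₂, zero_div, zero_mul, add_zero] at h₀
  have g₃ : X.g (c 0) v (e 3 0) = 0 := by
    rcases div_eq_zero_iff.1 (neg_eq_zero.1 h₀.symm) with h | h
    · exact h
    · exact absurd h (pow_ne_zero 2 hne)
  rw [eq_nullFrame X.isMetric (H.frame.null 0 H.zero_mem) v, g₀, g₁, g₂, g₃]
  simp

/-- The fields that are parallel for the physical metric have constant components in the scaled
frame. -/
theorem eq_sum_scaledFrame {I : Fin 4 → ℝ → ℝ}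
    (hI : ∀ a, a = 1 ∨ a = 2 → ∀ t ∈ Ico s₁ 0,
      HasDerivWithinAt (I a) (frameDeriv X e a t / X.Ω (c t) ^ 2) (Ico s₁ 0) t)
    {V : (t : ℝ) → TangentSpace I4 (c t)} (hV : IsParallelAlong X.ghat c u (Ico s₁ 0) V)
    {v : TangentSpace I4 (c 0)}
    (hv : ∀ a, X.g (c s₁) (V s₁) (e a s₁) = X.g (c 0) v (e a 0)) {t : ℝ} (ht : t ∈ Ico s₁ 0) :
    V t = ∑ a, (scaledCoeff X e I s₁ v a * X.Ω (c t) ^ weight a) • scaledFrame X e I a t := by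
  have hne := (H.omega_pos ht).ne'
  obtain ⟨h₀, h₁, h₂, h₃⟩ := scaledCoeff_apply (X := X) (e := e) (s₁ := s₁) I v
  obtain ⟨k₀, k, k₃⟩ := H.coeff_conserved hV hI ht (A := fun a s => X.g (c s) (V s) (e a s))
    (fun _ _ => rfl)
  have k₁ := k 1 (Or.inl rfl)
  have k₂ := k 2 (Or.inr rfl)
  simp only [hv] at k₀ k₁ k₂ k₃
  rw [← k₃] at h₀
  rw [← k₁] at h₁
  rw [← k₂] at h₂
  rw [← k₀] at h₃
  rw [Fin.sum_univ_four, h₀, h₁, h₂, h₃]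
  conv_lhs => rw [eq_nullFrame X.isMetric (H.frame.null t (Ico_subset_Icc_self ht)) (V t)]
  obtain ⟨f₀, f₁, f₂, f₃⟩ := scaledFrame_apply (X := X) (e := e) I t
  rw [f₀, f₁, f₂, f₃]
  have w : weight 0 = 2 ∧ weight 1 = 1 ∧ weight 2 = 1 ∧ weight 3 = 0 := ⟨rfl, rfl, rfl, rfl⟩
  rw [w.1, w.2.1, w.2.2.1, w.2.2.2]
  match_scalars <;> field_simp <;> ring

end IsArrivingFrame

end ConformalCompletion

/-! ### Weights of components and the algebra of the peeling coefficients. -/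

section PeelingTensor

variable {M : Type*} [TopologicalSpace M] [ChartedSpace (EuclideanHalfSpace 4) M]
  [IsManifold I4 ∞ M] {x : M}

/-- The tensor with components `C r` with respect to the linear coordinates `Q`. -/
def coordTensor (Q : TangentSpace I4 x →ₗ[ℝ] (Fin 4 → ℝ)) (C : (Fin 4 → Fin 4) → ℝ) : Tensor4 x :=
  ∑ r, C r • (MultilinearMap.mkPiAlgebra ℝ (Fin 4) ℝ).compLinearMap
    fun m => (LinearMap.proj (r m)).comp Q

theorem coordTensor_apply (Q : TangentSpace I4 x →ₗ[ℝ] (Fin 4 → ℝ)) (C : (Fin 4 → Fin 4) → ℝ)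
    (v : Fin 4 → TangentSpace I4 x) :
    coordTensor Q C v = ∑ r, C r * ∏ m, Q (v m) (r m) := by
  simp [coordTensor]

theorem coordTensor_basis {Q : TangentSpace I4 x →ₗ[ℝ] (Fin 4 → ℝ)} (C : (Fin 4 → Fin 4) → ℝ)
    {b : Fin 4 → TangentSpace I4 x} (hb : ∀ a, Q (b a) = Pi.single a 1) (r : Fin 4 → Fin 4) :
    coordTensor Q C (fun m => b (r m)) = C r := by
  rw [coordTensor_apply, Finset.sum_eq_single r]
  · simp [hb]
  · intro r' _ hr
    obtain ⟨m, hm⟩ := Function.ne_iff.1 hr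
    rw [Finset.prod_eq_zero (Finset.mem_univ m), mul_zero]
    simp [hb, hm]
  · simp

theorem apply_vec {α β : Type*} (F : α → β) (a b c d : α) :
    (fun m => F (![a, b, c, d] m)) = ![F a, F b, F c, F d] := by
  funext m
  fin_cases m <;> rfl

theorem apply_sum_last (W : Tensor4 x) (u v w : TangentSpace I4 x) {q : Fin 4 → ℝ}
    {B : Fin 4 → TangentSpace I4 x} {n : TangentSpace I4 x} (hn : n = ∑ a, q a • B a) :
    W ![u, v, w, n] = ∑ a, q a * W ![u, v, w, B a] := by
  change slot₃ W u v w n = _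
  rw [hn, map_sum]
  exact Finset.sum_congr rfl fun a _ => (slot₃ W u v w).map_smul _ _

/-- The total power of `Ω` carried by a component. -/
def totalWeight (r : Fin 4 → Fin 4) : ℕ := ∑ m, weight (r m)

/-- Components that vanish by antisymmetry. -/
def IsDegenerate (r : Fin 4 → Fin 4) : Prop := r 0 = r 1 ∨ r 2 = r 3

instance : DecidablePred IsDegenerate := fun _ => inferInstanceAs (Decidable (_ ∨ _))

/-- Only the index 3 has weight zero, and an antisymmetric pair cannot contain it twice. -/
theorem two_le_totalWeight {r : Fin 4 → Fin 4} (hr : ¬IsDegenerate r) : 2 ≤ totalWeight r := by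
  have h : ∀ a b : Fin 4, a ≠ b → 1 ≤ weight a + weight b := by decide
  rw [IsDegenerate, not_or] at hr
  have h₁ := h _ _ hr.1
  have h₂ := h _ _ hr.2
  rw [totalWeight, Fin.sum_univ_four]
  omega

/-- Components of the coefficient of the first order. -/
def linearPart (ξ : (Fin 4 → Fin 4) → ℝ) (r : Fin 4 → Fin 4) : ℝ :=
  if IsDegenerate r then 0 else if totalWeight r = 2 then -ξ r else 0

/-- Components of the coefficient of the second order. -/
def quadraticPart (ξ η : (Fin 4 → Fin 4) → ℝ) (r : Fin 4 → Fin 4) : ℝ :=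
  if IsDegenerate r then 0 else if totalWeight r = 2 then -η r else
    if totalWeight r = 3 then ξ r else 0

/-- Expansion of the components of a tensor in a scaled frame. -/
theorem component_expansion {Ω : ℝ → ℝ} {D : (Fin 4 → Fin 4) → ℝ → ℝ} {ξ η : (Fin 4 → Fin 4) → ℝ}
    (hΩ : (fun s => Ω s + s) =O[𝓝[<] 0] fun s => s ^ 3) (hne : ∀ᶠ s in 𝓝[<] 0, Ω s ≠ 0)
    (hD : ∀ r, (fun s => D r s - ξ r - s * η r) =o[𝓝[<] 0] fun s => s)
    (h₀ : ∀ r, IsDegenerate r → ∀ᶠ s in 𝓝[<] 0, D r s = 0) (r : Fin 4 → Fin 4) :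
    (fun s => (Ω s)⁻¹ * Ω s ^ totalWeight r * D r s - s * linearPart ξ r
      - s ^ 2 * quadraticPart ξ η r) =o[𝓝[<] 0] fun s => s ^ 2 := by
  by_cases hr : IsDegenerate r
  · refine (isLittleO_zero (fun s : ℝ => s ^ 2) _).congr' ?_ EventuallyEq.rfl
    filter_upwards [h₀ r hr] with s hs
    simp [linearPart, quadraticPart, hr, hs]
  -- `p` is the power of `Ω` that remains after the factor `Ω⁻¹`.
  · obtain ⟨p, hp⟩ : ∃ p, totalWeight r = p + 1 :=
      ⟨totalWeight r - 1, by have := two_le_totalWeight hr; omega⟩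
    have h1 : 1 ≤ p := by have := two_le_totalWeight hr; omega
    refine (pow_mul_expansion hΩ (hD r) h1).congr' ?_ EventuallyEq.rfl
    filter_upwards [hne] with s hs
    have e : (Ω s)⁻¹ * Ω s ^ (p + 1) = Ω s ^ p := by
      rw [pow_succ]
      field_simp
    simp only [linearPart, quadraticPart, hr, if_false, hp, e, Nat.reduceEqDiff]

/-- If a tensor has the peeling expansion with vanishing first coefficient, and with second
coefficient zero or of type N, then the components of lowest weight vanish. -/
theorem lowest_components_eq_zero {b : LinearMap.BilinForm ℝ (TangentSpace I4 x)}
    {Q : TangentSpace I4 x →ₗ[ℝ] (Fin 4 → ℝ)} (hinj : ∀ v, Q v = 0 → v = 0)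
    (hsurj : Function.Surjective Q)
    {ρ : ℝ} (hρ : ρ ≠ 0) (hb : ∀ v, b v v = ρ * (Q v 1 ^ 2 + Q v 2 ^ 2 - 2 * Q v 0 * Q v 3))
    {ξ η : (Fin 4 → Fin 4) → ℝ}
    (hξ : ∀ i j k l, ξ ![i, j, k, l] = -ξ ![i, j, l, k])
    (hd : coordTensor Q (linearPart ξ) = 0)
    (he : coordTensor Q (quadraticPart ξ η) = 0 ∨
      IsPetrovTypeN b (coordTensor Q (quadraticPart ξ η))) :
    (∀ i ∈ ({1, 2} : Set (Fin 4)), ∀ j ∈ ({1, 2} : Set (Fin 4)), ξ ![3, i, 3, j] = 0) ∧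
    ∀ i ∈ ({1, 2} : Set (Fin 4)), ξ ![3, i, 3, 0] = 0 := by
  -- The basis dual to the coordinates `Q`.
  choose B hB using fun a : Fin 4 => hsurj (Pi.single a 1)
  have hQ : ∀ C r, coordTensor Q C (fun m => B (r m)) = C r := fun C r => coordTensor_basis C hB r
  constructor
  · intro i hi j hj
    have h := hQ (linearPart ξ) ![3, i, 3, j]
    rw [hd] at h
    rcases hi with rfl | rfl <;> rcases hj with rfl | rfl <;>
      simpa [linearPart, IsDegenerate, totalWeight, weight, Fin.sum_univ_four] using h
  · intro i hi
    -- The component `(3, i, 3, 0)` has weight `0 + 1 + 0 + 2 = 3`, so the second coefficient shows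
    -- `ξ` itself there.
    have hE : ∀ k, quadraticPart ξ η ![3, i, k, 0] = 0 → k = 3 → ξ ![3, i, 3, 0] = 0 := by
      rintro k h rfl
      rcases hi with rfl | rfl <;>
        simpa [quadraticPart, IsDegenerate, totalWeight, weight, Fin.sum_univ_four] using h
    rcases he with he | ⟨-, n, hn, hnull, hprin⟩
    · refine hE 3 ?_ rfl
      rw [← hQ (quadraticPart ξ η), he]
      rfl
    · have hQ' : ∀ i j k a, coordTensor Q (quadraticPart ξ η) ![B i, B j, B k, B a] =
          quadraticPart ξ η ![i, j, k, a] := by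
        intro i j k a
        have h₃ : coordTensor Q (quadraticPart ξ η) (fun m => B (![i, j, k, a] m)) =
            quadraticPart ξ η ![i, j, k, a] := by
          generalize ![i, j, k, a] = r
          exact hQ _ r
        rw [← h₃, apply_vec B]
      have hnB : n = ∑ a, Q n a • B a := by
        rw [← sub_eq_zero]
        refine hinj _ ?_
        rw [map_sub, map_sum, sub_eq_zero]
        funext j
        simp [hB, Finset.sum_apply, Pi.single_apply]
      have hcontr : ∀ i j k, ∑ a, Q n a * quadraticPart ξ η ![i, j, k, a] = 0 := by
        intro i j k
        have h := (apply_sum_last (coordTensor Q (quadraticPart ξ η)) (B i) (B j) (B k) hnB).symm.trans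
          (hprin _ _ _)
        simpa only [hQ'] using h
      have hgram : Q n 1 ^ 2 + Q n 2 ^ 2 - 2 * Q n 0 * Q n 3 = 0 := by
        have := hb n
        rw [hnull] at this
        exact (mul_eq_zero.1 this.symm).resolve_left hρ
      -- If `Q n 3 = 0`, nullity makes the principal direction a multiple of `B 0`, and contraction
      -- with `(3, i, 3)` gives the claim.
      by_cases h₃ : Q n 3 = 0
      · rw [h₃, mul_zero, sub_zero] at hgram
        have h₁ : Q n 1 = 0 := by nlinarith [sq_nonneg (Q n 1), sq_nonneg (Q n 2)]
        have h₂ : Q n 2 = 0 := by nlinarith [sq_nonneg (Q n 1), sq_nonneg (Q n 2)]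
        have h₀ : Q n 0 ≠ 0 := by
          intro h₀
          refine hn (hinj n ?_)
          funext a
          fin_cases a <;> assumption
        have h := hcontr 3 i 3
        rw [Fin.sum_univ_four, h₁, h₂, h₃] at h
        simp only [zero_mul, add_zero] at h
        exact hE 3 ((mul_eq_zero.1 h).resolve_left h₀) rfl
      -- Otherwise contract with `(3, i, 0)`: the term `a = 0` is degenerate, `a = 1, 2` have weight
      -- four, and only `(3, i, 0, 3)` of weight three remains.
      · have h := hcontr 3 i 0
        rw [hξ, neg_eq_zero]
        rw [Fin.sum_univ_four] at h
        rcases hi with rfl | rfl <;>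
          simpa [quadraticPart, IsDegenerate, totalWeight, weight, Fin.sum_univ_four, h₃] using h

end PeelingTensor

/-! ### Peeling along one arriving geodesic. -/

namespace ConformalCompletion

variable {M : Type*} [TopologicalSpace M] [ChartedSpace (EuclideanHalfSpace 4) M]
  [IsManifold I4 ∞ M] {Λ : ℝ} {X : ConformalCompletion M Λ}
  {c : ℝ → M} {u : (t : ℝ) → TangentSpace I4 (c t)} {s₁ : ℝ}

theorem nhdsLT_le_Icc (hs₁ : s₁ < 0) : 𝓝[<] (0 : ℝ) ≤ 𝓝[Icc s₁ 0] 0 := by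
  rw [nhdsWithin_Icc_eq hs₁]
  exact nhdsWithin_mono _ Iio_subset_Iic_self

/-- The symmetries of the rescaled Weyl tensor extend to the endpoint on `𝒥`. -/
theorem isWeylTensor_d_endpoint (hs₁ : s₁ < 0) (hc : HasVelocity c u (Icc s₁ 0))
    (hphys : ∀ t ∈ Ico s₁ 0, c t ∉ I4.boundary M)
    {τ : (s t : ℝ) → TangentSpace I4 (c s) →ₗ[ℝ] TangentSpace I4 (c t)}
    (hτ : IsParallelPropagator X.g c u (Icc s₁ 0) τ) : IsWeylTensor (X.g (c 0)) (X.d (c 0)) := by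
  have h0 : (0 : ℝ) ∈ Icc s₁ 0 := ⟨hs₁.le, le_rfl⟩
  have hid : ∀ v, τ 0 0 v = v := fun v => by rw [(hτ 0 h0).1, LinearMap.id_coe, id]
  have key : ∀ a b p q : TangentSpace I4 (c 0), Tendsto
      (fun s => X.d (c s) ![τ 0 s a, τ 0 s b, τ 0 s p, τ 0 s q]) (𝓝[<] 0)
      (𝓝 (X.d (c 0) ![a, b, p, q])) := by
    intro a b p q
    have h := differentiableWithinAt_tensor X.d_smooth hc h0 (V := ![fun s => τ 0 s a,
      fun s => τ 0 s b, fun s => τ 0 s p, fun s => τ 0 s q]) (fun m => by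
        have := fun v => (((hτ 0 h0).2 v).hasCovDeriv h0).isDifferentiableAlong
        fin_cases m
        · exact this a
        · exact this b
        · exact this p
        · exact this q)
    have e : ∀ s, (fun m => (![fun s => τ 0 s a, fun s => τ 0 s b, fun s => τ 0 s p,
        fun s => τ 0 s q] : Fin 4 → (t : ℝ) → TangentSpace I4 (c t)) m s) =
        ![τ 0 s a, τ 0 s b, τ 0 s p, τ 0 s q] := fun s => by
      funext m
      fin_cases m <;> rfl
    have h' := h.continuousWithinAt.tendsto.mono_left (nhdsLT_le_Icc hs₁)
    simp only [e, hid] at h'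
    exact h'
  have hev : ∀ᶠ s in 𝓝[<] (0 : ℝ), s ∈ Ico s₁ 0 := Ico_mem_nhdsLT hs₁
  have hW : ∀ᶠ s in 𝓝[<] (0 : ℝ), IsWeylTensor (X.g (c s)) (X.d (c s)) := by
    filter_upwards [hev] with s hs using X.isWeylTensor_d (hphys s hs)
  refine ⟨fun a b p q => ?_, fun a b p q => ?_, fun f hf v w => ?_⟩
  · refine tendsto_nhds_unique (key a b p q) ((key b a p q).neg.congr' ?_)
    filter_upwards [hW] with s hs using (hs.swap_left _ _ _ _).symm
  · refine tendsto_nhds_unique (key a b p q) ((key p q a b).congr' ?_)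
    filter_upwards [hW] with s hs using (hs.pair _ _ _ _).symm
  -- A null frame at the endpoint stays null under parallel transport, so the trace identity is
  -- available at interior points and passes to the limit.
  · refine tendsto_nhds_unique ((((key v (f 1) w (f 1)).add (key v (f 2) w (f 2))).sub
      (key v (f 0) w (f 3))).sub (key v (f 3) w (f 0))) (tendsto_const_nhds.congr' ?_)
    filter_upwards [hW, hev] with s hs hs'
    exact (hs.trace _ ((hτ.isParallelNullFrame X.isMetric X.smoothIn hc (convex_Icc _ _) h0 hf).null
      s (Ico_subset_Icc_self hs')) _ _).symm

theorem map_scaled_sum {x : M} (W : Tensor4 x) (ψ : Fin 4 → TangentSpace I4 x) (ρ : ℝ)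
    (q : Fin 4 → Fin 4 → ℝ) :
    W (fun m => ∑ a, (q m a * ρ ^ weight a) • ψ a) =
      ∑ r : Fin 4 → Fin 4, (∏ m, q m (r m)) * (ρ ^ totalWeight r * W fun m => ψ (r m)) := by
  rw [MultilinearMap.map_sum]
  refine Finset.sum_congr rfl fun r _ => ?_
  rw [MultilinearMap.map_smul_univ W (fun m => q m (r m) * ρ ^ weight (r m)) fun m => ψ (r m),
    Finset.prod_mul_distrib, Finset.prod_pow_eq_pow_sum, smul_eq_mul, mul_assoc]
  rfl

/-- Peeling along a geodesic arriving at `𝒥`. -/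
theorem peeling (hs₁ : s₁ < 0) (hc : HasVelocity c u (Icc s₁ 0))
    (hgeo : IsParallelAlong X.g c u (Icc s₁ 0) u) (hb : c 0 ∈ I4.boundary M)
    (hphys : ∀ t ∈ Ico s₁ 0, c t ∉ I4.boundary M)
    {τ τhat : (s t : ℝ) → TangentSpace I4 (c s) →ₗ[ℝ] TangentSpace I4 (c t)}
    (hτ : IsParallelPropagator X.g c u (Icc s₁ 0) τ)
    (hτhat : IsParallelPropagator X.ghat c u (Ico s₁ 0) τhat)
    {f : Fin 4 → TangentSpace I4 (c 0)} (hf : IsNullFrame (X.g (c 0)) f) (hf₀ : f 0 = u 0)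
    (hN : ∃ q : ℝ, X.N (c 0) = f 3 + q • f 0) {F : ℝ → Tensor4 (c 0)}
    (hF : ∀ s, F s = ((weyl X.ghat (c s)).compLinearMap fun _ => τ 0 s).compLinearMap
      fun _ => (τ s 0).comp ((τhat s₁ s).comp (τ 0 s₁))) :
    (∃ d e, HasPeelingCoeffs F d e) ∧
    ∀ d e, HasPeelingCoeffs F d e → d = 0 → (e = 0 ∨ IsPetrovTypeN (X.g (c 0)) e) →
      (∀ i ∈ ({1, 2} : Set (Fin 4)), ∀ j ∈ ({1, 2} : Set (Fin 4)),
        X.d (c 0) ![f 3, f i, f 3, f j] = 0) ∧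
      ∀ i ∈ ({1, 2} : Set (Fin 4)), X.d (c 0) ![f 3, f i, f 3, f 0] = 0 := by
  have h0 : (0 : ℝ) ∈ Icc s₁ 0 := ⟨hs₁.le, le_rfl⟩
  have h1 : s₁ ∈ Ico s₁ 0 := ⟨le_rfl, hs₁⟩
  have hid : ∀ v, τ 0 0 v = v := fun v => by rw [(hτ 0 h0).1, LinearMap.id_coe, id]
  set e : Fin 4 → (t : ℝ) → TangentSpace I4 (c t) := fun a t => τ 0 t (f a) with he
  have he0 : ∀ a, e a 0 = f a := fun a => hid (f a)
  have hfr : IsParallelNullFrame X.g c u (Icc s₁ 0) e :=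
    hτ.isParallelNullFrame X.isMetric X.smoothIn hc (convex_Icc _ _) h0 hf
  have H : X.IsArrivingFrame c u s₁ e := by
    refine ⟨hs₁, hc, hfr, fun t ht => ?_, hb, hphys, ?_⟩
    · exact (hfr.parallel 0).eq_of_eq X.isMetric X.smoothIn hc (convex_Icc _ _) hfr hgeo h0 ht
        ((he0 0).trans hf₀)
    · rwa [he0, he0]
  have hn : ∀ a : Fin 4, a = 1 ∨ a = 2 → frameDeriv X e a 0 = 0 := by
    rintro a (rfl | rfl)
    · rw [H.frameDeriv_zero 1 (by decide)]
      simp [nullGram]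
    · rw [H.frameDeriv_zero 2 (by decide)]
      simp [nullGram]
  choose! I hI hIB _ using fun a ha => H.exists_primitive_frameDeriv a (hn a ha)
  set Q := scaledCoeff X e I s₁ with hQ
  set ψ := scaledFrame X e I with hψ
  -- The transport to the endpoint thus cancels the last factor of `L`, leaving `Ĉ` evaluated on
  -- `ĝ`-parallel fields.
  have hback : ∀ s ∈ Icc s₁ 0, ∀ w, τ 0 s (τ s 0 w) = w := by
    intro s hs w
    have := ((hτ s hs).2 w).eq_of_eq X.isMetric X.smoothIn hc (convex_Icc _ _) hfr
      ((hτ 0 h0).2 (τ s 0 w)) h0 hs (hid _).symm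
    rw [← this, (hτ s hs).1, LinearMap.id_coe, id]
  have hV : ∀ v, ∀ s ∈ Ico s₁ 0, τhat s₁ s (τ 0 s₁ v) =
      ∑ a, (Q v a * X.Ω (c s) ^ weight a) • ψ a s := by
    intro v s hs
    refine H.eq_sum_scaledFrame hI ((hτhat s₁ h1).2 (τ 0 s₁ v)) (fun a => ?_) hs
    rw [(hτhat s₁ h1).1, LinearMap.id_coe, id,
      ((hτ 0 h0).2 v).metric_eq X.isMetric X.smoothIn hc (convex_Icc _ _) (hfr.parallel a) h0
        (Ico_subset_Icc_self h1), hid]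
  -- The single factor `Ω⁻¹` comes from `Ĉ = Ω⁻¹ d`, the other powers from the weights of the scaled
  -- frame.
  have hFs : ∀ s ∈ Ico s₁ 0, ∀ v, F s v = ∑ r : Fin 4 → Fin 4, (∏ m, Q (v m) (r m)) *
      ((X.Ω (c s))⁻¹ * X.Ω (c s) ^ totalWeight r * X.d (c s) fun m => ψ (r m) s) := by
    intro s hs v
    have hΩ := (H.omega_pos hs).ne'
    have hw : weyl X.ghat (c s) = (X.Ω (c s))⁻¹ • X.d (c s) := by
      rw [X.d_eq (c s) (hphys s hs), smul_smul, inv_mul_cancel₀ hΩ, one_smul, ghat]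
    have e₁ : F s v = (X.Ω (c s))⁻¹ * X.d (c s) fun m => τhat s₁ s (τ 0 s₁ (v m)) := by
      rw [hF, hw]
      simp only [MultilinearMap.compLinearMap_apply, LinearMap.comp_apply,
        hback s (Ico_subset_Icc_self hs), smul_apply, smul_eq_mul]
    rw [e₁]
    simp only [hV _ s hs]
    rw [map_scaled_sum (X.d (c s)) (fun a => ψ a s) (X.Ω (c s)) fun m => Q (v m), Finset.mul_sum]
    refine Finset.sum_congr rfl fun r _ => ?_
    ring
  set D : (Fin 4 → Fin 4) → ℝ → ℝ := fun r s => X.d (c s) fun m => ψ (r m) s with hD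
  have hev : ∀ᶠ s in 𝓝[<] (0 : ℝ), s ∈ Ico s₁ 0 := Ico_mem_nhdsLT hs₁
  have hDd : ∀ r, DifferentiableWithinAt ℝ (D r) (Icc s₁ 0) 0 := fun r =>
    differentiableWithinAt_tensor X.d_smooth hc h0
      fun m => H.isDifferentiableAlong_scaledFrame hIB (r m)
  set η : (Fin 4 → Fin 4) → ℝ := fun r => derivWithin (D r) (Icc s₁ 0) 0
  have hexp := component_expansion (Ω := fun s => X.Ω (c s)) (D := D) (ξ := fun r => D r 0) (η := η)
    (H.omega_isBigO.mono (nhdsWithin_mono _ Iio_subset_Iic_self))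
    (by filter_upwards [hev] with s hs using (H.omega_pos hs).ne')
    (fun r => by
      have h := hasDerivWithinAt_iff_isLittleO.1 (hDd r).hasDerivWithinAt
      simpa using h.mono (nhdsLT_le_Icc hs₁))
    -- Exact vanishing near the endpoint is needed here, since a component of weight zero would
    -- carry `Ω⁻¹`.
    (fun r hr => by
      filter_upwards [hev] with s hs
      have hW := X.isWeylTensor_d (hphys s hs)
      have e₁ : (fun m => ψ (r m) s) = ![ψ (r 0) s, ψ (r 1) s, ψ (r 2) s, ψ (r 3) s] := by
        funext m
        fin_cases m <;> rfl
      simp only [hD, e₁]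
      rcases hr with hr | hr
      · have := hW.swap_left (ψ (r 0) s) (ψ (r 1) s) (ψ (r 2) s) (ψ (r 3) s)
        rw [hr] at this ⊢
        linarith
      · have := hW.swap_right (ψ (r 0) s) (ψ (r 1) s) (ψ (r 2) s) (ψ (r 3) s)
        rw [hr] at this ⊢
        linarith)
  set ξ : (Fin 4 → Fin 4) → ℝ := fun r => D r 0 with hξ
  have hpeel : HasPeelingCoeffs F (coordTensor Q (linearPart ξ))
      (coordTensor Q (quadraticPart ξ η)) := by
    intro v
    have hsum := IsLittleO.sum (s := Finset.univ) fun r (_ : r ∈ Finset.univ) =>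
      (hexp r).const_mul_left (∏ m, Q (v m) (r m))
    refine hsum.congr' ?_ EventuallyEq.rfl
    filter_upwards [hev] with s hs
    rw [hFs s hs v, coordTensor_apply, coordTensor_apply, Finset.mul_sum, Finset.mul_sum,
      ← Finset.sum_sub_distrib, ← Finset.sum_sub_distrib, Finset.sum_apply]
    refine Finset.sum_congr rfl fun r _ => ?_
    ring
  refine ⟨⟨_, _, hpeel⟩, fun d e' h hd hee => ?_⟩
  have hdT : d = coordTensor Q (linearPart ξ) := by
    ext v
    exact (peelingCoeffs_unique (h v) (hpeel v)).1
  have heT : e' = coordTensor Q (quadraticPart ξ η) := by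
    ext v
    exact (peelingCoeffs_unique (h v) (hpeel v)).2
  have hξ' : ∀ i j k l, ξ ![i, j, k, l] = X.d (c 0) ![f i, f j, f k, f l] := by
    intro i j k l
    simp only [hξ, hD]
    refine congrArg _ ?_
    funext m
    rw [hψ, H.scaledFrame_zero, he0]
    fin_cases m <;> rfl
  have hW0 := isWeylTensor_d_endpoint hs₁ hc hphys hτ
  have := lowest_components_eq_zero (b := X.g (c 0)) (Q := Q)
    (fun v hv => H.scaledCoeff_injective I hv) (H.scaledCoeff_surjective I)
    (pow_ne_zero 2 (H.omega_pos h1).ne') (H.metric_scaledCoeff I) (ξ := ξ) (η := η)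
    (fun i j k l => by rw [hξ', hξ']; exact hW0.swap_right _ _ _ _)
    (hdT.symm.trans hd) (by rwa [heT] at hee)
  simpa only [hξ'] using this

end ConformalCompletion

/-! ### Construction of null frames in a Lorentzian vector space. -/

section Frames

variable {M : Type*} [TopologicalSpace M] [ChartedSpace (EuclideanHalfSpace 4) M]
  [IsManifold I4 ∞ M] {x : M} {b : LinearMap.BilinForm ℝ (TangentSpace I4 x)}

theorem isNullFrame_of (hs : ∀ v w, b v w = b w v) {f₀ f₁ f₂ f₃ : TangentSpace I4 x}
    (h₀₀ : b f₀ f₀ = 0) (h₀₁ : b f₀ f₁ = 0) (h₀₂ : b f₀ f₂ = 0) (h₀₃ : b f₀ f₃ = -1)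
    (h₁₁ : b f₁ f₁ = 1) (h₁₂ : b f₁ f₂ = 0) (h₁₃ : b f₁ f₃ = 0) (h₂₂ : b f₂ f₂ = 1)
    (h₂₃ : b f₂ f₃ = 0) (h₃₃ : b f₃ f₃ = 0) : IsNullFrame b ![f₀, f₁, f₂, f₃] := by
  have h₁₀ := (hs f₁ f₀).trans h₀₁
  have h₂₀ := (hs f₂ f₀).trans h₀₂
  have h₃₀ := (hs f₃ f₀).trans h₀₃
  have h₂₁ := (hs f₂ f₁).trans h₁₂
  have h₃₁ := (hs f₃ f₁).trans h₁₃
  have h₃₂ := (hs f₃ f₂).trans h₂₃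
  intro i j
  fin_cases i <;> fin_cases j <;> simpa [nullGram]

/-- Cauchy–Schwarz for the spatial parts contradicts orthogonality unless the spatial part of `v`
vanishes. -/
theorem eq_zero_of_minkowski {n₀ n₁ n₂ n₃ v₀ v₁ v₂ v₃ : ℝ} (hn : n₁ ^ 2 + n₂ ^ 2 + n₃ ^ 2 < n₀ ^ 2)
    (h : n₁ * v₁ + n₂ * v₂ + n₃ * v₃ = n₀ * v₀) (hv : v₁ ^ 2 + v₂ ^ 2 + v₃ ^ 2 ≤ v₀ ^ 2) :
    v₀ = 0 ∧ v₁ = 0 ∧ v₂ = 0 ∧ v₃ = 0 := by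
  have hcs : (n₁ * v₁ + n₂ * v₂ + n₃ * v₃) ^ 2 ≤
      (n₁ ^ 2 + n₂ ^ 2 + n₃ ^ 2) * (v₁ ^ 2 + v₂ ^ 2 + v₃ ^ 2) := by
    nlinarith [sq_nonneg (n₁ * v₂ - n₂ * v₁), sq_nonneg (n₁ * v₃ - n₃ * v₁),
      sq_nonneg (n₂ * v₃ - n₃ * v₂)]
  rw [h, mul_pow] at hcs
  have h₁ := mul_le_mul_of_nonneg_left hv (sq_nonneg n₀)
  have h₂ : (n₀ ^ 2 - (n₁ ^ 2 + n₂ ^ 2 + n₃ ^ 2)) * (v₁ ^ 2 + v₂ ^ 2 + v₃ ^ 2) ≤ 0 := by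
    rw [sub_mul]
    linarith
  have h₃ : v₁ ^ 2 + v₂ ^ 2 + v₃ ^ 2 ≤ 0 := nonpos_of_mul_nonpos_right h₂ (by linarith)
  have z₁ : v₁ = 0 := pow_eq_zero_iff two_ne_zero |>.1
    (le_antisymm (by linarith [sq_nonneg v₂, sq_nonneg v₃]) (sq_nonneg v₁))
  have z₂ : v₂ = 0 := pow_eq_zero_iff two_ne_zero |>.1
    (le_antisymm (by linarith [sq_nonneg v₁, sq_nonneg v₃]) (sq_nonneg v₂))
  have z₃ : v₃ = 0 := pow_eq_zero_iff two_ne_zero |>.1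
    (le_antisymm (by linarith [sq_nonneg v₁, sq_nonneg v₂]) (sq_nonneg v₃))
  refine ⟨?_, z₁, z₂, z₃⟩
  have hn₀ : n₀ ≠ 0 := by
    rintro rfl
    linarith [sq_nonneg n₁, sq_nonneg n₂, sq_nonneg n₃]
  rw [z₁, z₂, z₃] at h
  exact (mul_eq_zero.1 (show n₀ * v₀ = 0 by linarith)).resolve_left hn₀

/-- A nonzero vector orthogonal to a timelike vector is spacelike. -/
theorem IsLorentzian.pos_of_orthogonal (hb : IsLorentzian b) {n v : TangentSpace I4 x}
    (hn : b n n < 0) (hv : b n v = 0) (hne : v ≠ 0) : 0 < b v v := by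
  obtain ⟨f, hf⟩ := hb
  have hB : ∀ p q : Fin 4 → ℝ, b (∑ i, p i • f i) (∑ i, q i • f i) =
      -(p 0 * q 0) + p 1 * q 1 + p 2 * q 2 + p 3 * q 3 := by
    intro p q
    simp [hf, Fin.sum_univ_four]
  obtain ⟨p, rfl⟩ : ∃ p : Fin 4 → ℝ, n = ∑ i, p i • f i := ⟨f.repr n, (f.sum_repr n).symm⟩
  obtain ⟨q, rfl⟩ : ∃ q : Fin 4 → ℝ, v = ∑ i, q i • f i := ⟨f.repr v, (f.sum_repr v).symm⟩
  rw [hB] at hn hv ⊢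
  by_contra hle
  obtain ⟨z₀, z₁, z₂, z₃⟩ := eq_zero_of_minkowski (n₀ := p 0) (n₁ := p 1) (n₂ := p 2) (n₃ := p 3)
    (v₀ := q 0) (v₁ := q 1) (v₂ := q 2) (v₃ := q 3) (by nlinarith) (by linarith) (by nlinarith)
  refine hne ?_
  rw [Fin.sum_univ_four, z₀, z₁, z₂, z₃]
  simp

/-- Three linear conditions in dimension four have a nonzero solution, which is spacelike because it
is orthogonal to `n` and so can be normalized. -/
theorem IsLorentzian.exists_unit_orthogonal (hb : IsLorentzian b) {n : TangentSpace I4 x}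
    (hn : b n n < 0) (v w : TangentSpace I4 x) :
    ∃ e, b e e = 1 ∧ b n e = 0 ∧ b v e = 0 ∧ b w e = 0 := by
  obtain ⟨f, -⟩ := id hb
  have hfd : FiniteDimensional ℝ (TangentSpace I4 x) := f.finiteDimensional_of_finite
  have hdim : Module.finrank ℝ (TangentSpace I4 x) = 4 := by
    simpa using Module.finrank_eq_card_basis f
  have hker := LinearMap.ker_ne_bot_of_finrank_lt (f := LinearMap.pi ![b n, b v, b w])
    (by rw [hdim, Module.finrank_fin_fun]; norm_num)
  obtain ⟨z, hz, hne⟩ := Submodule.exists_mem_ne_zero_of_ne_bot hker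
  have hz' := LinearMap.mem_ker.1 hz
  have z₀ : b n z = 0 := congrFun hz' 0
  have z₁ : b v z = 0 := congrFun hz' 1
  have z₂ : b w z = 0 := congrFun hz' 2
  have hpos := hb.pos_of_orthogonal hn z₀ hne
  refine ⟨(Real.sqrt (b z z))⁻¹ • z, ?_, ?_, ?_, ?_⟩
  · have hs := Real.mul_self_sqrt hpos.le
    have hs0 := (Real.sqrt_pos.2 hpos).ne'
    rw [map_smul, map_smul, LinearMap.smul_apply, smul_eq_mul, smul_eq_mul]
    field_simp
    rw [pow_two]
    exact hs.symm
  · rw [map_smul, z₀, smul_zero]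
  · rw [map_smul, z₁, smul_zero]
  · rw [map_smul, z₂, smul_zero]

end Frames

/-! ### Combination of the two geodesics. -/

namespace ConformalCompletion

variable {M : Type*} [TopologicalSpace M] [ChartedSpace (EuclideanHalfSpace 4) M]
  [IsManifold I4 ∞ M] {Λ : ℝ} {X : ConformalCompletion M Λ}

theorem ArrivingGeodesic.peeling {p₀ : M} {ℓ : TangentSpace I4 p₀}
    (σ : X.ArrivingGeodesic p₀ ℓ) (hb : p₀ ∈ I4.boundary M)
    {τ τhat : (s t : ℝ) → TangentSpace I4 (σ.c s) →ₗ[ℝ] TangentSpace I4 (σ.c t)}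
    (hτ : IsParallelPropagator X.g σ.c σ.u (Icc σ.s₁ 0) τ)
    (hτhat : IsParallelPropagator X.ghat σ.c σ.u (Ico σ.s₁ 0) τhat)
    {f : Fin 4 → TangentSpace I4 p₀} (hf : IsNullFrame (X.g p₀) f) (hf₀ : f 0 = ℓ)
    (hN : ∃ q : ℝ, X.N p₀ = f 3 + q • f 0) :
    IsWeylTensor (X.g p₀) (X.d p₀) ∧ (∃ d e, HasPeelingCoeffs (σ.transportedWeyl τ τhat) d e) ∧
    ∀ d e, HasPeelingCoeffs (σ.transportedWeyl τ τhat) d e → d = 0 →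
      (e = 0 ∨ IsPetrovTypeN (X.g (σ.c 0)) e) →
      (∀ i ∈ ({1, 2} : Set (Fin 4)), ∀ j ∈ ({1, 2} : Set (Fin 4)),
        X.d p₀ ![f 3, f i, f 3, f j] = 0) ∧
      ∀ i ∈ ({1, 2} : Set (Fin 4)), X.d p₀ ![f 3, f i, f 3, f 0] = 0 := by
  rcases σ with ⟨s₁, hs₁, c, u, hc, hgeo, hend, htan, hphys⟩
  subst hend
  exact ⟨isWeylTensor_d_endpoint hs₁ hc hphys hτ, ConformalCompletion.peeling hs₁ hc hgeo hb hphys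
    hτ hτhat hf (hf₀.trans (show ℓ = u 0 from htan.symm)) hN fun _ => rfl⟩

/-- The null frames adapted to the two null directions of the plane spanned by `ℓ` and `N`. -/
theorem exists_nullFrames (hΛ : 0 < Λ) {p₀ : M} (hb : p₀ ∈ I4.boundary M) {ℓ : TangentSpace I4 p₀}
    (hnull : X.g p₀ ℓ ℓ = 0) (hnorm : X.g p₀ ℓ (X.N p₀) = -1) :
    ∃ e₁ e₂, IsNullFrame (X.g p₀) ![ℓ, e₁, e₂, X.k ℓ] ∧
      IsNullFrame (X.g p₀) ![(6 / Λ) • X.k ℓ, e₁, e₂, (Λ / 6) • ℓ] := by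
  have hs := X.g_symm p₀
  have hNN := X.metric_N_N hb
  have hneg : X.g p₀ (X.N p₀) (X.N p₀) < 0 := by
    rw [hNN]
    linarith
  -- The third condition is idle for the first vector; for the second one it imposes orthogonality
  -- to the first.
  obtain ⟨e₁, h₁₁, h₁N, h₁ℓ, -⟩ := (X.g_lorentzian p₀).exists_unit_orthogonal hneg ℓ ℓ
  obtain ⟨e₂, h₂₂, h₂N, h₂ℓ, h₁₂⟩ := (X.g_lorentzian p₀).exists_unit_orthogonal hneg ℓ e₁
  have hNℓ : X.g p₀ (X.N p₀) ℓ = -1 := (hs _ _).trans hnorm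
  have hkℓ : X.g p₀ (X.k ℓ) ℓ = -1 := by
    simp [k, hNℓ, hnull]
  have hℓk := (hs ℓ (X.k ℓ)).trans hkℓ
  have hk : ∀ w, X.g p₀ (X.N p₀) w = 0 → X.g p₀ ℓ w = 0 → X.g p₀ (X.k ℓ) w = 0 := by
    intro w h h'
    simp [k, h, h']
  have hk₁ := hk _ h₁N h₁ℓ
  have hk₂ := hk _ h₂N h₂ℓ
  have hkk : X.g p₀ (X.k ℓ) (X.k ℓ) = 0 := by
    simp only [k, map_sub, map_smul, LinearMap.sub_apply, LinearMap.smul_apply, smul_eq_mul, hNN,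
      hNℓ, hnorm, hnull]
    ring
  have h₁k := (hs e₁ (X.k ℓ)).trans hk₁
  have h₂k := (hs e₂ (X.k ℓ)).trans hk₂
  have h₁ℓ' := (hs e₁ ℓ).trans h₁ℓ
  have h₂ℓ' := (hs e₂ ℓ).trans h₂ℓ
  refine ⟨e₁, e₂, isNullFrame_of hs hnull h₁ℓ h₂ℓ hℓk h₁₁ h₁₂ h₁k h₂₂ h₂k hkk,
    isNullFrame_of hs ?_ ?_ ?_ ?_ h₁₁ h₁₂ ?_ h₂₂ ?_ ?_⟩ <;>
  simp only [map_smul, LinearMap.smul_apply, smul_eq_mul, hkk, hk₁, hk₂, hkℓ, h₁ℓ', h₂ℓ', hnull,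
    mul_zero]
  field_simp

/-- The frame `f'` is `f` with its null vectors exchanged and rescaled by nonzero factors, so its
conditions are those of `f` with 0 and 3 interchanged. -/
theorem superPoynting_eq_zero_of_peeling (hΛ : 0 < Λ) {p₀ : M} (hb : p₀ ∈ I4.boundary M)
    {ℓ e₁ e₂ : TangentSpace I4 p₀} (hf : IsNullFrame (X.g p₀) ![ℓ, e₁, e₂, X.k ℓ])
    (hW : IsWeylTensor (X.g p₀) (X.d p₀)) {f f' : Fin 4 → TangentSpace I4 p₀}
    (hf₁ : f = ![ℓ, e₁, e₂, X.k ℓ]) (hf₂ : f' = ![(6 / Λ) • X.k ℓ, e₁, e₂, (Λ / 6) • ℓ])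
    (h : (∀ i ∈ ({1, 2} : Set (Fin 4)), ∀ j ∈ ({1, 2} : Set (Fin 4)),
        X.d p₀ ![f 3, f i, f 3, f j] = 0) ∧
      ∀ i ∈ ({1, 2} : Set (Fin 4)), X.d p₀ ![f 3, f i, f 3, f 0] = 0)
    (h' : (∀ i ∈ ({1, 2} : Set (Fin 4)), ∀ j ∈ ({1, 2} : Set (Fin 4)),
        X.d p₀ ![f' 3, f' i, f' 3, f' j] = 0) ∧
      ∀ i ∈ ({1, 2} : Set (Fin 4)), X.d p₀ ![f' 3, f' i, f' 3, f' 0] = 0) :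
    X.superPoynting p₀ = 0 := by
  obtain ⟨-, -, -, -, s₀, s₁, s₂, s₃⟩ := tensor_linear (X.d p₀)
  have hne : Λ / 6 ≠ 0 := by positivity
  have hne' : 6 / Λ ≠ 0 := by positivity
  have e0 : f' 0 = (6 / Λ) • f 3 := by rw [hf₁, hf₂]; rfl
  have e3 : f' 3 = (Λ / 6) • f 0 := by rw [hf₁, hf₂]; rfl
  have ei : ∀ i ∈ ({1, 2} : Set (Fin 4)), f' i = f i := by
    rintro i (rfl | rfl) <;> rw [hf₁, hf₂] <;> rfl
  rw [← hf₁] at hf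
  refine X.superPoynting_eq_zero hΛ hb fun v hv =>
    doubleContraction_eq_zero X.isMetric hf hW h.1 h.2 (fun i hi j hj => ?_) (fun i hi => ?_)
      (q := Λ / 6) ?_ hv
  · have := h'.1 i hi j hj
    rw [e3, ei i hi, ei j hj, s₀, s₂] at this
    simpa [hne] using this
  · have := h'.2 i hi
    rw [e3, e0, ei i hi, s₀, s₂, s₃] at this
    simpa [hne, hne'] using this
  · rw [hf₁]
    simp [k]

end ConformalCompletion

end

end Peeling

/-! ### The main theorem. -/

open Peeling in
theorem mainTheorem3 {M : Type*} [TopologicalSpace M] [T2Space M] [SecondCountableTopology M]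
    [ChartedSpace (EuclideanHalfSpace 4) M] [IsManifold I4 ∞ M]
    {Λ : ℝ} (hΛ : 0 < Λ) (X : ConformalCompletion M Λ)
    (p₀ : M) (hp₀ : p₀ ∈ X.scriPlus)
    (ℓ : TangentSpace I4 p₀) (hnull : X.g p₀ ℓ ℓ = 0) (hfuture : X.IsFuture ℓ)
    (hnorm : X.g p₀ ℓ (X.N p₀) = -1)
    -- the null geodesics arriving at `p₀` along `ℓ` and along `k`; the affine parameters are
    -- normalized by `dΩ/ds = -1` at `p₀`, which for the second one gives the tangent `(6/Λ) k`
    (σ : X.ArrivingGeodesic p₀ ℓ) (σ' : X.ArrivingGeodesic p₀ ((6 / Λ) • X.k ℓ))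
    -- the parallel propagators of `g` and of the physical metric along the two geodesics
    (τ τhat : (s t : ℝ) → TangentSpace I4 (σ.c s) →ₗ[ℝ] TangentSpace I4 (σ.c t))
    (hτ : IsParallelPropagator X.g σ.c σ.u (Set.Icc σ.s₁ 0) τ)
    (hτhat : IsParallelPropagator X.ghat σ.c σ.u (Set.Ico σ.s₁ 0) τhat)
    (τ' τhat' : (s t : ℝ) → TangentSpace I4 (σ'.c s) →ₗ[ℝ] TangentSpace I4 (σ'.c t))
    (hτ' : IsParallelPropagator X.g σ'.c σ'.u (Set.Icc σ'.s₁ 0) τ')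
    (hτhat' : IsParallelPropagator X.ghat σ'.c σ'.u (Set.Ico σ'.s₁ 0) τhat') :
    (∃ d e, HasPeelingCoeffs (σ.transportedWeyl τ τhat) d e) ∧
    (∃ d' e', HasPeelingCoeffs (σ'.transportedWeyl τ' τhat') d' e') ∧
    ∀ d e d' e', HasPeelingCoeffs (σ.transportedWeyl τ τhat) d e →
      HasPeelingCoeffs (σ'.transportedWeyl τ' τhat') d' e' →
      d = 0 → d' = 0 →
      (e = 0 ∨ IsPetrovTypeN (X.g (σ.c 0)) e) →
      (e' = 0 ∨ IsPetrovTypeN (X.g (σ'.c 0)) e') →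
      X.superPoynting p₀ = 0 := by
  obtain ⟨e₁, e₂, hf, hf'⟩ := ConformalCompletion.exists_nullFrames hΛ hp₀.1 hnull hnorm
  have hN : X.N p₀ = X.k ℓ + (Λ / 6) • ℓ := by simp [ConformalCompletion.k]
  -- The normal has the form `f 3 + q • f 0` in the second frame too, again with `q = Λ / 6`.
  have hN' : X.N p₀ = (Λ / 6) • ℓ + (Λ / 6) • ((6 / Λ) • X.k ℓ) := by
    rw [smul_smul, show Λ / 6 * (6 / Λ) = 1 by field_simp, one_smul, hN, add_comm]
  obtain ⟨hW, hex, himp⟩ := σ.peeling hp₀.1 hτ hτhat hf rfl ⟨Λ / 6, hN⟩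
  obtain ⟨-, hex', himp'⟩ := σ'.peeling hp₀.1 hτ' hτhat' hf' rfl ⟨Λ / 6, hN'⟩
  exact ⟨hex, hex', fun d e d' e' h h' hd hd' he he' =>
    ConformalCompletion.superPoynting_eq_zero_of_peeling hΛ hp₀.1 hf hW rfl rfl
      (himp d e h hd he) (himp' d' e' h' hd' he')⟩
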